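/- Let $M$ be a closed (compact, without boundary) connected smooth manifold of dimension $m\ge 3$ with first Betti number $b=\dim H_1(M,\mathbb R)\ge 1$, and let $g$ be a smooth Riemannian metric on $M$. A class in $H_1(M,\mathbb R)$ is called integral if it lies in the image of $H_1(M,\mathbb Z)\to H_1(M,\mathbb R)$, and a point $s\in H_1(M,\mathbb R)$ is said to have rational direction if $s\in\mathbb R v$ for some integral class $v$. For a smooth Riemannian metric $h$ on $M$, the stable norm $\|\cdot\|_h$ is the unique norm on $H_1(M,\mathbb R)$ such that, for every integral class $v$, $$\|v\|_h=\lim_{n\to\infty}\frac{1}{n}\,\inf\{L_h(\gamma) : \gamma \text{ a piecewise } C^1 \text{ closed curve in } M \text{ with } [\gamma]=n v \text{ in } H_1(M,\mathbb R)\},$$ where $L_h$ denotes length with respect to $h$; let $\mathcal B(h)=\{u\in H_1(M,\mathbb R) : \|u\|_h\le 1\}$ be its unit ball. Let $K\subset H_1(M,\mathbb R)$ be a convex polytope (the convex hull of a finite set) which is centrally symmetric ($-K=K$), has nonempty interior, and all of whose vertices have rational direction. Then there is a smooth Riemannian metric $g'$ on $M$ conformal to $g$ (that is, $g'=f g$ for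 some smooth function $f:M\to(0,\infty)$) such that $$\mathcal B(g')=K.$$ -/

import Mathlib

open CategoryTheory AlgebraicTopology Bundle Manifold Filter Set MeasureTheory
open scoped Manifold ContDiff Topology ENNReal Simplicial Pointwise

universe u

noncomputable section

/-! ### First homology -/

section Homology

variable (M : Type u) [TopologicalSpace M]

/-- The real singular chain complex of `M`. -/
abbrev realSingularComplex : ChainComplex (ModuleCat.{u} ℝ) ℕ :=
  ((singularChainComplexFunctor (ModuleCat.{u} ℝ)).obj (ModuleCat.of ℝ (ULift.{u} ℝ))).obj
    (TopCat.of M)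

/-- `H₁(M, ℝ)`, the first singular homology of `M` with real coefficients. -/
def realH1 : ModuleCat.{u} ℝ :=
  ((singularHomologyFunctor (ModuleCat.{u} ℝ) 1).obj (ModuleCat.of ℝ (ULift.{u} ℝ))).obj
    (TopCat.of M)

/-- The canonical vector space topology on `H₁(M, ℝ)`: the finest one making the operations
continuous. In finite dimension it is the usual one. -/
instance : TopologicalSpace (realH1 M) := moduleTopology ℝ (realH1 M)

instance : IsModuleTopology ℝ (realH1 M) := ⟨rfl⟩

variable {M}

/-- The singular `1`-simplex `σ`, as a morphism from the coefficients to the `1`-chains. -/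
def simplexMap (σ : (TopCat.toSSet.obj (TopCat.of M)) _⦋1⦌) :
    ModuleCat.of ℝ (ULift.{u} ℝ) ⟶ (realSingularComplex M).X 1 :=
  SSet.ιChainComplex _ σ

/-- The singular `1`-simplex `σ`, as a `1`-chain with coefficient `1`. -/
def simplexChain (σ : (TopCat.toSSet.obj (TopCat.of M)) _⦋1⦌) : (realSingularComplex M).X 1 :=
  (simplexMap σ).hom ⟨1⟩

/-- The homology class of a `1`-cycle. -/
def cycleClass (z : (realSingularComplex M).cycles 1) : realH1 M :=
  ((realSingularComplex M).homologyπ 1).hom z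

/-- Integral classes: the image of `H₁(M, ℤ)` in `H₁(M, ℝ)`, that is, the classes of the cycles
which are integral linear combinations of singular simplices. -/
def IsIntegralClass (v : realH1 M) : Prop :=
  ∃ z : (realSingularComplex M).cycles 1,
    ((realSingularComplex M).iCycles 1).hom z ∈ AddSubgroup.closure (range (simplexChain (M := M)))
      ∧ cycleClass z = v

/-- A point has rational direction if it lies on the line spanned by an integral class. -/
def HasRationalDirection (s : realH1 M) : Prop :=
  ∃ v : realH1 M, IsIntegralClass v ∧ s ∈ Submodule.span ℝ {v}

/-- A path, as a singular `1`-simplex. -/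
def pathSimplex {x y : M} (γ : Path x y) : (TopCat.toSSet.obj (TopCat.of M)) _⦋1⦌ :=
  TopCat.toSSetObj₁Equiv.symm (TopCat.pathEquiv (X := TopCat.of M).symm γ).hom

lemma pathSimplex_comp_d {x : M} (γ : Path x x) :
    simplexMap (pathSimplex γ) ≫ (realSingularComplex M).d 1 0 = 0 := by
  refine (SSet.ιChainComplex_d (R := ModuleCat.of ℝ (ULift.{u} ℝ)) _ _).trans ?_
  have h0 : (TopCat.pathEquiv (X := TopCat.of M).symm γ).hom 0 = x :=
    (TopCat.pathEquiv (X := TopCat.of M).symm γ).hom₀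
  have h1 : (TopCat.pathEquiv (X := TopCat.of M).symm γ).hom 1 = x :=
    (TopCat.pathEquiv (X := TopCat.of M).symm γ).hom₁
  simp [Fin.sum_univ_two, pathSimplex, h0, h1]
  rfl

/-- A closed curve, as a `1`-cycle. -/
def loopCycle {x : M} (γ : Path x x) : (realSingularComplex M).cycles 1 :=
  ((realSingularComplex M).liftCycles (simplexMap (pathSimplex γ)) 0 (by simp)
    (pathSimplex_comp_d γ)).hom ⟨1⟩

/-- The real homology class of a closed curve. -/
def loopClass {x : M} (γ : Path x x) : realH1 M := cycleClass (loopCycle γ)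

end Homology

/-! ### Stable norm -/

section Stable

variable {m : ℕ} {M : Type u} [TopologicalSpace M] [ChartedSpace (EuclideanSpace ℝ (Fin m)) M]
  [IsManifold (𝓡 m) ∞ M]

variable (m M) in
/-- Smooth Riemannian metrics on `M`. -/
abbrev SmoothMetric :=
  ContMDiffRiemannianMetric (𝓡 m) ∞ (EuclideanSpace ℝ (Fin m))
    (fun x : M ↦ TangentSpace (𝓡 m) x)

/-- `g'` is conformal to `g`: it is `g` multiplied by a smooth positive function. -/
def IsConformalTo (g g' : SmoothMetric m M) : Prop :=
  ∃ f : M → ℝ, ContMDiff (𝓡 m) 𝓘(ℝ) ∞ f ∧ (∀ x, 0 < f x) ∧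
    ∀ (x : M) (v w : TangentSpace (𝓡 m) x), g'.inner x v w = f x * g.inner x v w

variable (m) in
/-- A curve defined on `[0, 1]` is piecewise `C¹` if it is continuous and `C¹` on each of
the closed intervals of a finite subdivision. -/
def IsPiecewiseC1 (γ : ℝ → M) : Prop :=
  ContinuousOn γ (Icc 0 1) ∧ ∃ (n : ℕ) (t : ℕ → ℝ), Monotone t ∧ t 0 = 0 ∧ t n = 1 ∧
    ∀ i < n, ContMDiffOn 𝓘(ℝ) (𝓡 m) 1 γ (Icc (t i) (t (i + 1)))

/-- The length of a curve on `[0, 1]` for the metric `g`. -/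
def curveLength (g : SmoothMetric m M) (γ : ℝ → M) : ℝ≥0∞ :=
  letI : RiemannianBundle (fun x : M ↦ TangentSpace (𝓡 m) x) := ⟨g.toRiemannianMetric⟩
  pathELength (𝓡 m) γ 0 1

/-- The infimum of the lengths of the closed curves in the homology class `v`. -/
def minLength (g : SmoothMetric m M) (v : realH1 M) : ℝ≥0∞ :=
  ⨅ (x : M) (γ : Path x x) (_ : IsPiecewiseC1 m γ.extend) (_ : loopClass γ = v),
    curveLength g γ.extend

/-- `N` is the stable norm of `g`: the (unique) norm on `H₁(M, ℝ)` whose value at each integral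
class `v` is the limit of `L(n v) / n`, where `L(n v)` is the minimal length of a closed curve in
the class `n v`. -/
structure IsStableNorm (g : SmoothMetric m M) (N : Seminorm ℝ (realH1 M)) : Prop where
  definite : ∀ u, N u = 0 → u = 0
  tendsto : ∀ v, IsIntegralClass v →
    Tendsto (fun n : ℕ ↦ minLength g (n • v) / n) atTop (𝓝 (ENNReal.ofReal (N v)))

end Stable

end

/-!
For each nonzero vertex of `K`, let `w` be an integral class which is a positive multiple of it. As
`m ≥ 3`, the classes `w` are represented by pairwise disjoint embedded closed curves. The homology
class of closed curves extends to a functional `Ψ` on all paths, additive under concatenation and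
invariant under homotopies fixing the endpoints, that is, locally to the differences of the values
of a function `k` with values in `H₁(M, ℝ)`. After subtracting a function `F` on `M`, the
differentials `d(k - F)` form a smooth closed `H₁(M, ℝ)`-valued one-form `α` with periods given by
homology classes, and `F` can be chosen such that along each curve `γ`, parametrized by a period
of length one, `α` is `w` times the `g`-orthogonal projection to the normalized velocity of `γ`.

Let `N` be the norm with unit ball `K`. Then the supremum of `N(α(v))² / g(v, v)` over `v` is
dominated by a smooth positive function `f`, with equality along the curves. For `g' = f g` every
closed curve in the class `u` has length at least `N(u)`, and equality holds for the chosen curves.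
Finally, an integral class `v` is a nonnegative combination of classes `w` which come from the
independent vertices of a face of `K`, so that `N` is additive on it; its coefficients are rational
because a `ℚ`-linear retraction `ℝ → ℚ` acts on chains. Joining multiples of the chosen curves at
a bounded cost shows that the minimal length in the class `n v` is `n N(v) + O(1)`.
-/

noncomputable section

/-! ### Singular chains -/

section SingularChains

variable {M : Type u} [TopologicalSpace M]

/-- The singular `n`-simplex `σ` as an `n`-chain, as a linear function of its coefficient. -/
def chainSingle {n : ℕ} (σ : (TopCat.toSSet.obj (TopCat.of M)) _⦋n⦌) :
    ℝ →ₗ[ℝ] (realSingularComplex M).X n :=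
  (show ModuleCat.of ℝ (ULift.{u} ℝ) ⟶ (realSingularComplex M).X n from
    SSet.ιChainComplex _ σ).hom ∘ₗ (ULift.moduleEquiv (R := ℝ) (M := ℝ)).symm.toLinearMap

lemma simplexChain_eq_chainSingle (σ : (TopCat.toSSet.obj (TopCat.of M)) _⦋1⦌) :
    simplexChain σ = chainSingle σ 1 := rfl

lemma d_chainSingle {n : ℕ} (σ : (TopCat.toSSet.obj (TopCat.of M)) _⦋n + 1⦌) (a : ℝ) :
    ((realSingularComplex M).d (n + 1) n).hom (chainSingle σ a) =
      ∑ i : Fin (n + 2), (-1 : ℤ) ^ i.val •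
        chainSingle ((TopCat.toSSet.obj (TopCat.of M)).δ i σ) a := by
  have hd := congrArg (fun f ↦ f.hom (ULift.up a))
    (SSet.ιChainComplex_d (R := ModuleCat.of ℝ (ULift.{u} ℝ)) _ σ)
  refine hd.trans ?_
  rw [ModuleCat.hom_sum, LinearMap.sum_apply]
  rfl

/-- The coefficients of a chain, as a finitely supported function of the singular simplices. -/
def chainCoeff (n : ℕ) : (realSingularComplex M).X n ⟶
    ModuleCat.of ℝ ((TopCat.toSSet.obj (TopCat.of M)) _⦋n⦌ →₀ ℝ) :=
  Limits.Sigma.desc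
    (f := fun _ : (TopCat.toSSet.obj (TopCat.of M)) _⦋n⦌ ↦ ModuleCat.of ℝ (ULift.{u} ℝ)) fun σ ↦
      ModuleCat.ofHom ((Finsupp.lsingle σ).comp (ULift.moduleEquiv (R := ℝ) (M := ℝ)).toLinearMap)

lemma chainCoeff_chainSingle {n : ℕ} (σ : (TopCat.toSSet.obj (TopCat.of M)) _⦋n⦌) (a : ℝ) :
    (chainCoeff n).hom (chainSingle σ a) = Finsupp.single σ a :=
  congrArg (fun f ↦ f.hom (ULift.up a)) (Limits.Sigma.ι_desc
    (f := fun _ : (TopCat.toSSet.obj (TopCat.of M)) _⦋n⦌ ↦ ModuleCat.of ℝ (ULift.{u} ℝ))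
    (fun σ ↦ ModuleCat.ofHom ((Finsupp.lsingle σ).comp
      (ULift.moduleEquiv (R := ℝ) (M := ℝ)).toLinearMap)) σ)

/-- Chains are finitely supported functions on singular simplices. -/
def chainEquiv (n : ℕ) :
    ((TopCat.toSSet.obj (TopCat.of M)) _⦋n⦌ →₀ ℝ) ≃ₗ[ℝ] (realSingularComplex M).X n := by
  let ofCoeff : ModuleCat.of ℝ ((TopCat.toSSet.obj (TopCat.of M)) _⦋n⦌ →₀ ℝ) ⟶
      (realSingularComplex M).X n :=
    ModuleCat.ofHom (Finsupp.lsum ℝ fun σ ↦ chainSingle σ)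
  have coeff_ofCoeff : chainCoeff n ≫ ofCoeff = 𝟙 _ := by
    apply SSet.chainComplex_hom_ext (X := TopCat.toSSet.obj (TopCat.of M))
      (R := ModuleCat.of ℝ (ULift.{u} ℝ)) (n := n)
    intro σ
    ext a
    change ofCoeff.hom ((chainCoeff n).hom (chainSingle σ a.down)) = chainSingle σ a.down
    rw [chainCoeff_chainSingle]
    change (Finsupp.lsum ℝ fun σ ↦ chainSingle σ) _ = _
    simp
  have ofCoeff_coeff : ofCoeff ≫ chainCoeff n = 𝟙 _ := by
    ext σ : 3
    ext
    change (chainCoeff n).hom ((Finsupp.lsum ℝ fun σ ↦ chainSingle σ) (Finsupp.single σ 1)) _ =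
      Finsupp.single σ 1 _
    rw [Finsupp.lsum_single, chainCoeff_chainSingle]
  exact LinearEquiv.ofLinearMap ofCoeff.hom (chainCoeff n).hom
    (by rw [← ModuleCat.hom_comp, coeff_ofCoeff]; rfl)
    (by rw [← ModuleCat.hom_comp, ofCoeff_coeff]; rfl)

lemma chainEquiv_single {n : ℕ} (σ : (TopCat.toSSet.obj (TopCat.of M)) _⦋n⦌) (a : ℝ) :
    chainEquiv n (Finsupp.single σ a) = chainSingle σ a := by
  change (Finsupp.lsum ℝ fun σ ↦ chainSingle σ) (Finsupp.single σ a) = _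
  simp

lemma chainEquiv_symm_chainSingle {n : ℕ} (σ : (TopCat.toSSet.obj (TopCat.of M)) _⦋n⦌) (a : ℝ) :
    (chainEquiv n).symm (chainSingle σ a) = Finsupp.single σ a := by
  rw [← chainEquiv_single, LinearEquiv.symm_apply_apply]

@[elab_as_elim]
lemma chain_induction {n : ℕ} {p : (realSingularComplex M).X n → Prop}
    (add : ∀ x y, p x → p y → p (x + y)) (zero : p 0) (single : ∀ σ a, p (chainSingle σ a))
    (z : (realSingularComplex M).X n) : p z := by
  obtain ⟨f, rfl⟩ := (chainEquiv n).surjective z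
  induction f using Finsupp.induction_linear with
  | zero => simpa only [map_zero] using zero
  | add f g hf hg => simpa only [map_add] using add _ _ hf hg
  | single σ a => rw [chainEquiv_single]; exact single σ a

lemma exists_d_eq_of_pOpcycles_eq_zero {z : (realSingularComplex M).X 1}
    (hz : ((realSingularComplex M).pOpcycles 1).hom z = 0) :
    ∃ y, ((realSingularComplex M).d 2 1).hom y = z := by
  have hexact : (ShortComplex.mk ((realSingularComplex M).d 2 1)
      ((realSingularComplex M).pOpcycles 1) (HomologicalComplex.d_pOpcycles _ _ _)).Exact :=
    ShortComplex.exact_of_g_is_cokernel _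
      ((realSingularComplex M).opcyclesIsCokernel 2 1 (by simp))
  exact (ShortComplex.moduleCat_exact_iff _).1 hexact z hz

lemma pOpcycles_d (z : (realSingularComplex M).X 2) :
    ((realSingularComplex M).pOpcycles 1).hom (((realSingularComplex M).d 2 1).hom z) = 0 := by
  rw [← LinearMap.comp_apply, ← ModuleCat.hom_comp, HomologicalComplex.d_pOpcycles]
  rfl

/-- The inclusion of `H₁(M, ℝ)` in the space of `1`-chains modulo boundaries, where classes of
paths which are not closed make sense. -/
def realH1Incl (M : Type u) [TopologicalSpace M] :
    realH1 M →ₗ[ℝ] (realSingularComplex M).opcycles 1 :=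
  ((realSingularComplex M).homologyι 1).hom

lemma realH1Incl_injective : Function.Injective (realH1Incl M) :=
  (ModuleCat.mono_iff_injective _).1 inferInstance

lemma realH1Incl_cycleClass (z : (realSingularComplex M).cycles 1) :
    realH1Incl M (cycleClass z) =
      ((realSingularComplex M).pOpcycles 1).hom (((realSingularComplex M).iCycles 1).hom z) := by
  change ((realSingularComplex M).homologyι 1).hom (((realSingularComplex M).homologyπ 1).hom z) = _
  rw [← LinearMap.comp_apply, ← ModuleCat.hom_comp, HomologicalComplex.homology_π_ι]
  rfl

lemma IsIntegralClass.exists_chain {v : realH1 M} (hv : IsIntegralClass v) :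
    ∃ z ∈ AddSubgroup.closure (range (simplexChain (M := M))),
      ((realSingularComplex M).d 1 0).hom z = 0 ∧
      realH1Incl M v = ((realSingularComplex M).pOpcycles 1).hom z := by
  obtain ⟨z, hz, rfl⟩ := hv
  refine ⟨_, hz, ?_, realH1Incl_cycleClass z⟩
  rw [← LinearMap.comp_apply, ← ModuleCat.hom_comp, HomologicalComplex.iCycles_d]
  rfl

lemma IsIntegralClass.neg {v : realH1 M} (hv : IsIntegralClass v) : IsIntegralClass (-v) := by
  obtain ⟨z, hz, rfl⟩ := hv
  exact ⟨-z, by rw [map_neg]; exact neg_mem hz, map_neg ((realSingularComplex M).homologyπ 1).hom z⟩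

lemma HasRationalDirection.exists_pos_smul {s : realH1 M} (h : HasRationalDirection s)
    (hs : s ≠ 0) : ∃ (w : realH1 M) (c : ℝ), IsIntegralClass w ∧ 0 < c ∧ s = c • w := by
  obtain ⟨w, hw, hsw⟩ := h
  obtain ⟨c, rfl⟩ := Submodule.mem_span_singleton.1 hsw
  rcases lt_trichotomy c 0 with hc | rfl | hc
  · exact ⟨-w, -c, hw.neg, neg_pos.2 hc, by rw [neg_smul_neg]⟩
  · exact absurd (zero_smul ℝ w) hs
  · exact ⟨w, c, hw, hc, rfl⟩

end SingularChains

/-! ### Rationality of relations between integral classes -/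

section IntegralRelations

variable {M : Type u} [TopologicalSpace M]

/-- The additive endomorphism of the chains which applies `ρ` to the coefficients. -/
def mapCoeff (ρ : ℝ →+ ℝ) (n : ℕ) : (realSingularComplex M).X n →+ (realSingularComplex M).X n :=
  (chainEquiv n).toAddEquiv.toAddMonoidHom.comp
    ((Finsupp.mapRange.addMonoidHom ρ).comp (chainEquiv n).symm.toAddEquiv.toAddMonoidHom)

lemma mapCoeff_chainSingle (ρ : ℝ →+ ℝ) {n : ℕ} (σ : (TopCat.toSSet.obj (TopCat.of M)) _⦋n⦌)
    (a : ℝ) : mapCoeff ρ n (chainSingle σ a) = chainSingle σ (ρ a) := by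
  change chainEquiv n (Finsupp.mapRange ρ ρ.map_zero ((chainEquiv n).symm (chainSingle σ a))) = _
  rw [chainEquiv_symm_chainSingle, Finsupp.mapRange_single, chainEquiv_single]

lemma mapCoeff_d (ρ : ℝ →+ ℝ) (n : ℕ) (z : (realSingularComplex M).X (n + 1)) :
    mapCoeff ρ n (((realSingularComplex M).d (n + 1) n).hom z) =
      ((realSingularComplex M).d (n + 1) n).hom (mapCoeff ρ (n + 1) z) := by
  induction z using chain_induction with
  | add x y hx hy => simp only [map_add, hx, hy]
  | zero => simp only [map_zero]
  | single σ a =>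
    simp only [mapCoeff_chainSingle, d_chainSingle, map_sum, map_zsmul]

lemma mapCoeff_smul (ρ : ℝ →+ ℝ) {z : (realSingularComplex M).X 1}
    (hz : z ∈ AddSubgroup.closure (range (simplexChain (M := M)))) (a : ℝ) :
    mapCoeff ρ 1 (a • z) = ρ a • z := by
  induction hz using AddSubgroup.closure_induction with
  | mem x hx =>
    obtain ⟨σ, rfl⟩ := hx
    rw [simplexChain_eq_chainSingle, ← map_smul, mapCoeff_chainSingle, ← map_smul,
      smul_eq_mul, mul_one, smul_eq_mul, mul_one]
  | zero => simp only [smul_zero, map_zero]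
  | add x y _ _ hx hy => rw [smul_add, map_add, hx, hy, smul_add]
  | neg x _ hx => rw [smul_neg, map_neg, hx, smul_neg]

-- A relation is witnessed by a `2`-chain, and changing its coefficients by `ρ` commutes with `d`.
lemma IsIntegralClass.sum_smul_map_eq {ι : Type*} {s : Finset ι} {a : ι → ℝ} {w : ι → realH1 M}
    (hw : ∀ i, IsIntegralClass (w i)) (hv : IsIntegralClass (∑ i ∈ s, a i • w i)) {ρ : ℝ →+ ℝ}
    (hρ : ρ 1 = 1) : ∑ i ∈ s, ρ (a i) • w i = ∑ i ∈ s, a i • w i := by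
  obtain ⟨z, hz, -, hzv⟩ := hv.exists_chain
  choose y hy _ hyw using fun i ↦ (hw i).exists_chain
  have hrel : ((realSingularComplex M).pOpcycles 1).hom (z - ∑ i ∈ s, a i • y i) = 0 := by
    simp only [map_sub, map_sum, map_smul, ← hyw, ← hzv, sub_self]
  obtain ⟨c, hc⟩ := exists_d_eq_of_pOpcycles_eq_zero hrel
  have hρc : ((realSingularComplex M).d 2 1).hom (mapCoeff ρ 2 c) =
      z - ∑ i ∈ s, ρ (a i) • y i := by
    rw [← mapCoeff_d, hc, map_sub, map_sum, ← one_smul ℝ z, mapCoeff_smul ρ hz, hρ]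
    simp only [mapCoeff_smul ρ (hy _)]
  have hρrel := pOpcycles_d (mapCoeff ρ 2 c)
  rw [hρc] at hρrel
  simp only [map_sub, map_sum, map_smul, ← hyw, ← hzv, sub_eq_zero] at hρrel
  apply realH1Incl_injective
  simp only [map_sum, map_smul, hρrel]

lemma IsIntegralClass.exists_rat_coeff {ι : Type*} {s : Finset ι} {a : ι → ℝ} {w : ι → realH1 M}
    (hw : ∀ i, IsIntegralClass (w i)) (hind : LinearIndepOn ℝ w s)
    (hv : IsIntegralClass (∑ i ∈ s, a i • w i)) : ∀ i ∈ s, ∃ q : ℚ, a i = q := by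
  obtain ⟨ρ, hρ⟩ := LinearMap.exists_leftInverse_of_injective (Algebra.linearMap ℚ ℝ)
    (LinearMap.ker_eq_bot.2 (algebraMap ℚ ℝ).injective)
  let ρ' : ℝ →+ ℝ := (Rat.castHom ℝ : ℚ →+ ℝ).comp ρ.toAddMonoidHom
  have hρ_one : ρ 1 = 1 := by simpa using LinearMap.congr_fun hρ 1
  have hfix := IsIntegralClass.sum_smul_map_eq hw hv (ρ := ρ') (by simp [ρ', hρ_one])
  have hdiff : ∑ i ∈ s, (a i - ρ' (a i)) • w i = 0 := by
    simp only [sub_smul, Finset.sum_sub_distrib, hfix, sub_self]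
  exact fun i hi ↦ ⟨ρ (a i), sub_eq_zero.1 (linearIndepOn_finset_iff.1 hind _ hdiff i hi)⟩

end IntegralRelations

/-! ### Path cocycles -/

/-- The straight segment from `A` to `B` in the plane, parametrized by the unit interval. -/
def planeSeg (A B : ℝ × ℝ) : C(unitInterval, ℝ × ℝ) :=
  ⟨fun t ↦ (1 - (t : ℝ)) • A + (t : ℝ) • B, by fun_prop⟩

lemma planeSeg_vertical (s : ℝ) (t : unitInterval) : planeSeg (s, 0) (s, 1) t = (s, (t : ℝ)) := by
  ext
  · change (1 - (t : ℝ)) * s + t * s = s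
    ring
  · change (1 - (t : ℝ)) * 0 + t * 1 = t
    ring

lemma planeSeg_horizontal (s : ℝ) (t : unitInterval) :
    planeSeg (0, s) (1, s) t = ((t : ℝ), s) := by
  ext
  · change (1 - (t : ℝ)) * 0 + t * 1 = t
    ring
  · change (1 - (t : ℝ)) * s + t * s = s
    ring

section PathCocycle

variable {M : Type*} [TopologicalSpace M] {A : Type*} [AddCommGroup A]

/-- A function on paths is a cocycle if it is additive on the sides of every singular triangle.
Real cocycles play the role of closed `1`-forms, integrated along paths. -/
def IsPathCocycle (Ψ : C(unitInterval, M) → A) : Prop :=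
  ∀ (H : C(ℝ × ℝ, M)) (P Q R : ℝ × ℝ),
    Ψ (H.comp (planeSeg P Q)) + Ψ (H.comp (planeSeg Q R)) = Ψ (H.comp (planeSeg P R))

/-- The restriction of a curve to the segment from `a` to `b`, reparametrized by `[0, 1]`. -/
def arc (c : C(ℝ, M)) (a b : ℝ) : C(unitInterval, M) :=
  c.comp ⟨fun t ↦ (1 - (t : ℝ)) * a + t * b, by fun_prop⟩

lemma arc_apply (c : C(ℝ, M)) (a b : ℝ) (t : unitInterval) :
    arc c a b t = c ((1 - (t : ℝ)) * a + t * b) := rfl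

lemma arc_zero_one_apply (c : C(ℝ, M)) (t : unitInterval) : arc c 0 1 t = c t := by
  simp only [arc_apply, mul_zero, mul_one, zero_add]

lemma exists_arc_apply_eq (c : C(ℝ, M)) {a b : ℝ} (hab : a ≤ b) (t : unitInterval) :
    ∃ s ∈ Icc a b, arc c a b t = c s :=
  ⟨(1 - (t : ℝ)) * a + t * b,
    ⟨by nlinarith [t.2.1, t.2.2], by nlinarith [t.2.1, t.2.2]⟩, rfl⟩

/-- The extension of a path to the real line which is constant on both sides of `[0, 1]`. -/
def pathCurve {x y : M} (γ : Path x y) : C(ℝ, M) := ⟨γ.extend, γ.continuous_extend⟩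

lemma arc_pathCurve {x y : M} (γ : Path x y) : arc (pathCurve γ) 0 1 = γ.toContinuousMap := by
  ext t
  rw [arc_zero_one_apply]
  exact γ.extend_extends' t

namespace IsPathCocycle

variable {Ψ : C(unitInterval, M) → A} (hΨ : IsPathCocycle Ψ)
include hΨ

lemma arc_add (c : C(ℝ, M)) (a b d : ℝ) : Ψ (arc c a b) + Ψ (arc c b d) = Ψ (arc c a d) :=
  hΨ (c.comp ⟨Prod.fst, continuous_fst⟩) (a, 0) (b, 0) (d, 0)

lemma arc_self (c : C(ℝ, M)) (a : ℝ) : Ψ (arc c a a) = 0 := by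
  simpa using hΨ.arc_add c a a a

lemma arc_swap (c : C(ℝ, M)) (a b : ℝ) : Ψ (arc c b a) = -Ψ (arc c a b) := by
  rw [eq_neg_iff_add_eq_zero, hΨ.arc_add, hΨ.arc_self]

lemma const (x : M) : Ψ (ContinuousMap.const _ x) = 0 :=
  hΨ.arc_self (ContinuousMap.const _ x) 0

lemma trans {x y z : M} (γ : Path x y) (δ : Path y z) :
    Ψ (γ.trans δ).toContinuousMap = Ψ γ.toContinuousMap + Ψ δ.toContinuousMap := by
  have left : arc (pathCurve (γ.trans δ)) 0 (1 / 2) = γ.toContinuousMap := by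
    ext t
    have ht : (1 - (t : ℝ)) * 0 + t * (1 / 2) ≤ 1 / 2 := by linarith [t.2.2]
    refine (γ.extend_trans_of_le_half δ ht).trans ?_
    rw [show 2 * ((1 - (t : ℝ)) * 0 + t * (1 / 2)) = t by ring]
    exact γ.extend_extends' t
  have right : arc (pathCurve (γ.trans δ)) (1 / 2) 1 = δ.toContinuousMap := by
    ext t
    have ht : 1 / 2 ≤ (1 - (t : ℝ)) * (1 / 2) + t * 1 := by linarith [t.2.1]
    refine (γ.extend_trans_of_half_le δ ht).trans ?_
    rw [show 2 * ((1 - (t : ℝ)) * (1 / 2) + t * 1) - 1 = t by ring]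
    exact δ.extend_extends' t
  rw [← arc_pathCurve, ← left, ← right, hΨ.arc_add]

lemma symm {x y : M} (γ : Path x y) : Ψ γ.symm.toContinuousMap = -Ψ γ.toContinuousMap := by
  have reverse : arc (pathCurve γ) 1 0 = γ.symm.toContinuousMap := by
    ext t
    rw [← arc_pathCurve, arc_zero_one_apply, arc_apply, mul_one, mul_zero, add_zero]
    exact (γ.extend_symm_apply t).symm
  rw [← reverse, hΨ.arc_swap, arc_pathCurve]

lemma eq_of_freeHomotopy (H : C(ℝ × ℝ, M)) (h : ∀ s, H (s, 0) = H (s, 1)) :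
    Ψ (H.comp (planeSeg (0, 0) (0, 1))) = Ψ (H.comp (planeSeg (1, 0) (1, 1))) := by
  have upper := hΨ H (0, 0) (0, 1) (1, 1)
  have lower := hΨ H (0, 0) (1, 0) (1, 1)
  have hsides : H.comp (planeSeg (0, 1) (1, 1)) = H.comp (planeSeg (0, 0) (1, 0)) := by
    ext t
    simp only [ContinuousMap.comp_apply, planeSeg_horizontal, h]
  rw [hsides, ← lower, add_comm] at upper
  exact add_left_cancel upper

lemma eq_of_homotopy (H : C(ℝ × ℝ, M)) (h0 : ∀ s, H (s, 0) = H (0, 0))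
    (h1 : ∀ s, H (s, 1) = H (0, 1)) :
    Ψ (H.comp (planeSeg (0, 0) (0, 1))) = Ψ (H.comp (planeSeg (1, 0) (1, 1))) := by
  have upper := hΨ H (0, 0) (0, 1) (1, 1)
  have lower := hΨ H (0, 0) (1, 0) (1, 1)
  have htop : H.comp (planeSeg (0, 1) (1, 1)) = ContinuousMap.const _ (H (0, 1)) := by
    ext t
    simp only [ContinuousMap.comp_apply, planeSeg_horizontal, h1, ContinuousMap.const_apply]
  have hbot : H.comp (planeSeg (0, 0) (1, 0)) = ContinuousMap.const _ (H (0, 0)) := by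
    ext t
    simp only [ContinuousMap.comp_apply, planeSeg_horizontal, h0, ContinuousMap.const_apply]
  rw [htop, hΨ.const, add_zero] at upper
  rw [hbot, hΨ.const, zero_add] at lower
  rw [upper, lower]

end IsPathCocycle

end PathCocycle

/-! ### The universal path cocycle -/

section EdgeClass

variable {M : Type u} [TopologicalSpace M]

/-- A continuous map on the unit interval, as a singular `1`-simplex. -/
def edgeSimplex (p : C(unitInterval, M)) : (TopCat.toSSet.obj (TopCat.of M)) _⦋1⦌ :=
  (TopCat.toSSetObjEquiv (TopCat.of M) (.op ⦋1⦌)).symm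
    (p.comp (toContinuousMap stdSimplexHomeomorphUnitInterval))

lemma edgeSimplex_surjective : Function.Surjective (edgeSimplex (M := M)) := by
  intro σ
  refine ⟨(TopCat.toSSetObjEquiv (TopCat.of M) (.op ⦋1⦌) σ).comp
    (toContinuousMap stdSimplexHomeomorphUnitInterval.symm), ?_⟩
  unfold edgeSimplex
  rw [Equiv.symm_apply_eq]
  ext x
  simp

/-- The affine map from the standard triangle to the plane with given vertices. -/
def planeTriangle (A B C : ℝ × ℝ) : C(stdSimplex ℝ (Fin 3), ℝ × ℝ) where
  toFun s := s.1 0 • A + s.1 1 • B + s.1 2 • C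
  continuous_toFun := by
    have h : ∀ i : Fin 3, Continuous fun s : stdSimplex ℝ (Fin 3) ↦ s.1 i := fun i ↦
      (continuous_apply i).comp continuous_subtype_val
    exact (((h 0).smul continuous_const).add ((h 1).smul continuous_const)).add
      ((h 2).smul continuous_const)

lemma planeTriangle_map (A B C : ℝ × ℝ) (f : Fin 2 → Fin 3) (s : stdSimplex ℝ (Fin 2)) :
    planeTriangle A B C (stdSimplex.map f s) =
      s.1 0 • (![A, B, C] (f 0)) + s.1 1 • (![A, B, C] (f 1)) := by
  calc planeTriangle A B C (stdSimplex.map f s)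
      = ∑ j : Fin 3, (stdSimplex.map f s : Fin 3 → ℝ) j • (![A, B, C] j) := by
        rw [Fin.sum_univ_three]; rfl
    _ = ∑ i : Fin 2, s.1 i • (![A, B, C] (f i)) := by
        simp only [stdSimplex.map_coe, FunOnFinite.linearMap_apply_apply, Finset.sum_smul]
        rw [← Finset.sum_fiberwise Finset.univ f (fun i ↦ s.1 i • (![A, B, C] (f i)))]
        refine Finset.sum_congr rfl fun j _ ↦ Finset.sum_congr rfl fun i hi ↦ ?_
        rw [(Finset.mem_filter.1 hi).2]
        rfl
    _ = _ := Fin.sum_univ_two _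

/-- The singular `2`-simplex obtained by restricting `H` to an affine triangle. -/
def triangleSimplex (H : C(ℝ × ℝ, M)) (A B C : ℝ × ℝ) :
    (TopCat.toSSet.obj (TopCat.of M)) _⦋2⦌ :=
  (TopCat.toSSetObjEquiv (TopCat.of M) (.op ⦋2⦌)).symm (H.comp (planeTriangle A B C))

lemma triangleSimplex_δ (H : C(ℝ × ℝ, M)) (A B C : ℝ × ℝ) (i : Fin 3) :
    (TopCat.toSSet.obj (TopCat.of M)).δ i (triangleSimplex H A B C) =
      edgeSimplex (H.comp
        (planeSeg (![A, B, C] (i.succAbove 0)) (![A, B, C] (i.succAbove 1)))) := by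
  apply (TopCat.toSSetObjEquiv (TopCat.of M) (.op ⦋1⦌)).injective
  ext s
  change H (planeTriangle A B C (stdSimplex.map (SimplexCategory.δ i) s)) =
    H (planeSeg _ _ (stdSimplexHomeomorphUnitInterval s))
  rw [planeTriangle_map, show s.1 0 = 1 - s.1 1 from eq_sub_of_add_eq (stdSimplex.add_eq_one s)]
  rfl

/-- The class of a path modulo boundaries. -/
def edgeClass (p : C(unitInterval, M)) : (realSingularComplex M).opcycles 1 :=
  ((realSingularComplex M).pOpcycles 1).hom (simplexChain (edgeSimplex p))

lemma isPathCocycle_edgeClass : IsPathCocycle (edgeClass (M := M)) := by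
  intro H A B C
  have h := pOpcycles_d (chainSingle (triangleSimplex H A B C) 1)
  rw [d_chainSingle, Fin.sum_univ_three, triangleSimplex_δ, triangleSimplex_δ,
    triangleSimplex_δ] at h
  simp only [map_add, map_zsmul] at h
  replace h : (-1 : ℤ) ^ 0 • edgeClass (H.comp (planeSeg B C)) +
      (-1 : ℤ) ^ 1 • edgeClass (H.comp (planeSeg A C)) +
      (-1 : ℤ) ^ 2 • edgeClass (H.comp (planeSeg A B)) = 0 := h
  simp only [pow_zero, one_smul, pow_one, neg_smul, even_two, Even.neg_pow, one_pow] at h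
  rw [← sub_eq_zero, ← h]
  abel

lemma realH1Incl_loopClass {x : M} (γ : Path x x) :
    realH1Incl M (loopClass γ) = edgeClass γ.toContinuousMap := by
  refine (realH1Incl_cycleClass _).trans (congrArg _ ?_)
  unfold loopCycle
  rw [← LinearMap.comp_apply, ← ModuleCat.hom_comp, HomologicalComplex.liftCycles_i]
  rfl

theorem exists_isPathCocycle_eq_loopClass :
    ∃ Ψ : C(unitInterval, M) → realH1 M, IsPathCocycle Ψ ∧
      ∀ (x : M) (γ : Path x x), Ψ γ.toContinuousMap = loopClass γ := by
  obtain ⟨r, hr⟩ := LinearMap.exists_leftInverse_of_injective (realH1Incl M)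
    (LinearMap.ker_eq_bot.2 realH1Incl_injective)
  refine ⟨fun p ↦ r (edgeClass p), fun H P Q R ↦ ?_, fun x γ ↦ ?_⟩
  · rw [← map_add, isPathCocycle_edgeClass]
  · change r (edgeClass γ.toContinuousMap) = _
    rw [← realH1Incl_loopClass]
    exact LinearMap.congr_fun hr _

end EdgeClass

/-! ### Integral classes are classes of loops -/

section IntegralLoops

variable {M : Type u} [TopologicalSpace M]

/-- The linear extension to `0`-chains of a function on the points of `M`. -/
def pointLift {V : Type*} [AddCommGroup V] [Module ℝ V] (f : M → V) :
    (realSingularComplex M).X 0 →ₗ[ℝ] V :=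
  (Finsupp.lsum ℝ fun σ ↦ LinearMap.toSpanSingleton ℝ V (f (TopCat.toSSetObj₀Equiv σ))) ∘ₗ
    (chainEquiv 0).symm.toLinearMap

lemma pointLift_chainSingle {V : Type*} [AddCommGroup V] [Module ℝ V] (f : M → V)
    (σ : (TopCat.toSSet.obj (TopCat.of M)) _⦋0⦌) (a : ℝ) :
    pointLift f (chainSingle σ a) = a • f (TopCat.toSSetObj₀Equiv σ) := by
  unfold pointLift
  rw [LinearMap.comp_apply, LinearEquiv.coe_coe, chainEquiv_symm_chainSingle, Finsupp.lsum_single,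
    LinearMap.toSpanSingleton_apply]

lemma pointLift_d_edgeSimplex {V : Type*} [AddCommGroup V] [Module ℝ V] (f : M → V)
    (p : C(unitInterval, M)) :
    pointLift f (((realSingularComplex M).d 1 0).hom (simplexChain (edgeSimplex p))) =
      f (p 1) - f (p 0) := by
  have htarget : TopCat.toSSetObj₀Equiv ((TopCat.toSSet.obj (TopCat.of M)).δ 0 (edgeSimplex p)) =
      p 1 := by
    rw [← TopCat.toSSetObj₁Equiv_apply_one]
    exact (TopCat.pathEquiv (X := TopCat.of M).symm (⟨p, rfl, rfl⟩ : Path (p 0) (p 1))).hom₁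
  have hsource : TopCat.toSSetObj₀Equiv ((TopCat.toSSet.obj (TopCat.of M)).δ 1 (edgeSimplex p)) =
      p 0 := by
    rw [← TopCat.toSSetObj₁Equiv_apply_zero]
    exact (TopCat.pathEquiv (X := TopCat.of M).symm (⟨p, rfl, rfl⟩ : Path (p 0) (p 1))).hom₀
  rw [simplexChain_eq_chainSingle, d_chainSingle, Fin.sum_univ_two, map_add, map_zsmul, map_zsmul,
    pointLift_chainSingle, pointLift_chainSingle, htarget, hsource]
  simp only [Fin.val_zero, pow_zero, one_smul, Fin.val_one, pow_one, neg_smul, sub_eq_add_neg]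

-- Each edge is closed up by the chosen paths from the base point to its ends.
lemma exists_loop_edgeClass_eq {x₀ : M} (δ : ∀ x, Path x₀ x) {z : (realSingularComplex M).X 1}
    (hz : z ∈ AddSubgroup.closure (range (simplexChain (M := M)))) :
    ∃ γ : Path x₀ x₀, edgeClass γ.toContinuousMap =
      ((realSingularComplex M).pOpcycles 1).hom z -
        pointLift (fun x ↦ edgeClass (δ x).toContinuousMap)
          (((realSingularComplex M).d 1 0).hom z) := by
  have hΨ := isPathCocycle_edgeClass (M := M)
  induction hz using AddSubgroup.closure_induction with
  | mem x hx =>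
    obtain ⟨σ, rfl⟩ := hx
    obtain ⟨p, rfl⟩ := edgeSimplex_surjective σ
    let γ : Path (p 0) (p 1) := ⟨p, rfl, rfl⟩
    refine ⟨((δ (p 0)).trans γ).trans (δ (p 1)).symm, ?_⟩
    rw [hΨ.trans, hΨ.trans, hΨ.symm, pointLift_d_edgeSimplex]
    change _ + edgeClass p + _ = edgeClass p - _
    abel
  | zero => exact ⟨Path.refl x₀, (hΨ.const x₀).trans (by simp only [map_zero, sub_zero])⟩
  | add x y _ _ hx hy =>
    obtain ⟨γ, hγ⟩ := hx
    obtain ⟨γ', hγ'⟩ := hy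
    refine ⟨γ.trans γ', ?_⟩
    rw [hΨ.trans, hγ, hγ']
    simp only [map_add]
    abel
  | neg x _ hx =>
    obtain ⟨γ, hγ⟩ := hx
    refine ⟨γ.symm, ?_⟩
    rw [hΨ.symm, hγ]
    simp only [map_neg]
    abel

theorem IsIntegralClass.exists_loop [PathConnectedSpace M] (x₀ : M) {v : realH1 M}
    (hv : IsIntegralClass v) : ∃ γ : Path x₀ x₀, loopClass γ = v := by
  obtain ⟨z, hz, hd, hzv⟩ := hv.exists_chain
  obtain ⟨γ, hγ⟩ := exists_loop_edgeClass_eq (PathConnectedSpace.somePath x₀) hz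
  refine ⟨γ, realH1Incl_injective ?_⟩
  rw [realH1Incl_loopClass, hγ, hd, hzv, map_zero, sub_zero]

end IntegralLoops

/-! ### Smoothing of paths -/

section Smoothing

variable {m : ℕ} {M : Type*} [TopologicalSpace M] [ChartedSpace (EuclideanSpace ℝ (Fin m)) M]

/-- `U` is the open set of points of the chart domain at `x` whose image lies in the convex open
set `B`. Paths in such a set can be deformed along straight lines of the chart. -/
structure IsChartConvex (m : ℕ) {M : Type*} [TopologicalSpace M]
    [ChartedSpace (EuclideanSpace ℝ (Fin m)) M] (U : Set M) (x : M)
    (B : Set (EuclideanSpace ℝ (Fin m))) : Prop where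
  convex : Convex ℝ B
  isOpen : IsOpen B
  subset : B ⊆ (chartAt (EuclideanSpace ℝ (Fin m)) x).target
  eq : U = (chartAt (EuclideanSpace ℝ (Fin m)) x).source ∩
    chartAt (EuclideanSpace ℝ (Fin m)) x ⁻¹' B

lemma IsChartConvex.isOpen_set {U : Set M} {x : M} {B : Set (EuclideanSpace ℝ (Fin m))}
    (h : IsChartConvex m U x B) : IsOpen U := by
  rw [h.eq]
  exact (chartAt (EuclideanSpace ℝ (Fin m)) x).isOpen_inter_preimage h.isOpen

lemma IsChartConvex.symm_mem {U : Set M} {x : M} {B : Set (EuclideanSpace ℝ (Fin m))}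
    (h : IsChartConvex m U x B) {z : EuclideanSpace ℝ (Fin m)} (hz : z ∈ B) :
    (chartAt (EuclideanSpace ℝ (Fin m)) x).symm z ∈ U := by
  rw [h.eq]
  refine ⟨(chartAt _ x).map_target (h.subset hz), ?_⟩
  rw [mem_preimage, (chartAt _ x).right_inv (h.subset hz)]
  exact hz

lemma exists_isChartConvex (m : ℕ) {M : Type*} [TopologicalSpace M]
    [ChartedSpace (EuclideanSpace ℝ (Fin m)) M] (x : M) {W : Set M} (hW : W ∈ 𝓝 x) :
    ∃ U B, IsChartConvex m U x B ∧ x ∈ U ∧ U ⊆ W := by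
  set φ := chartAt (EuclideanSpace ℝ (Fin m)) x
  have hx : x ∈ φ.source := mem_chart_source _ x
  have hnhds : φ.target ∩ φ.symm ⁻¹' W ∈ 𝓝 (φ x) := by
    refine inter_mem (φ.open_target.mem_nhds (φ.map_source hx)) ?_
    refine (φ.continuousAt_symm (φ.map_source hx)).preimage_mem_nhds ?_
    rwa [φ.left_inv hx]
  obtain ⟨r, hr, hball⟩ := Metric.mem_nhds_iff.1 hnhds
  refine ⟨φ.source ∩ φ ⁻¹' Metric.ball (φ x) r, Metric.ball (φ x) r,
    ⟨convex_ball _ _, Metric.isOpen_ball, fun z hz ↦ (hball hz).1, rfl⟩,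
    ⟨hx, Metric.mem_ball_self hr⟩, fun y hy ↦ ?_⟩
  simpa only [mem_preimage, φ.left_inv hy.1] using (hball hy.2).2

/-- The retraction of the line onto the unit interval. -/
def clampI : C(ℝ, unitInterval) := ⟨projIcc 0 1 zero_le_one, continuous_projIcc⟩

lemma clampI_coe (t : unitInterval) : clampI (t : ℝ) = t := projIcc_val zero_le_one t

lemma clampI_zero : clampI 0 = 0 := projIcc_left zero_le_one

lemma clampI_one : clampI 1 = 1 := projIcc_right zero_le_one

lemma IsChartConvex.exists_homotopy {U : Set M} {x : M} {B : Set (EuclideanSpace ℝ (Fin m))}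
    (hU : IsChartConvex m U x B) {p q : C(unitInterval, M)} (hp : ∀ t, p t ∈ U)
    (hq : ∀ t, q t ∈ U) :
    ∃ H : C(ℝ × ℝ, M), (∀ t, H (0, t) = p (clampI t)) ∧ (∀ t, H (1, t) = q (clampI t)) ∧
      ∀ s t, p (clampI t) = q (clampI t) → H (s, t) = p (clampI t) := by
  set φ := chartAt (EuclideanSpace ℝ (Fin m)) x
  rw [hU.eq] at hp hq
  let K : ℝ × ℝ → EuclideanSpace ℝ (Fin m) := fun z ↦
    (1 - (clampI z.1 : ℝ)) • φ (p (clampI z.2)) + (clampI z.1 : ℝ) • φ (q (clampI z.2))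
  have hK : Continuous K := by
    have hφp : Continuous fun z : ℝ × ℝ ↦ φ (p (clampI z.2)) :=
      φ.continuousOn.comp_continuous (by fun_prop) fun z ↦ (hp _).1
    have hφq : Continuous fun z : ℝ × ℝ ↦ φ (q (clampI z.2)) :=
      φ.continuousOn.comp_continuous (by fun_prop) fun z ↦ (hq _).1
    have hs : Continuous fun z : ℝ × ℝ ↦ (clampI z.1 : ℝ) := by fun_prop
    exact ((continuous_const.sub hs).smul hφp).add (hs.smul hφq)
  have hKB : ∀ z, K z ∈ B := fun z ↦
    hU.convex (hp _).2 (hq _).2 (sub_nonneg.2 (clampI z.1).2.2) (clampI z.1).2.1 (by ring)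
  refine ⟨⟨fun z ↦ φ.symm (K z),
    φ.continuousOn_symm.comp_continuous hK fun z ↦ hU.subset (hKB z)⟩,
    fun t ↦ ?_, fun t ↦ ?_, fun s t hst ↦ ?_⟩
  · simp [K, clampI_zero, φ.left_inv (hp _).1]
  · simp [K, clampI_one, φ.left_inv (hq _).1]
  · simp [K, ← hst, ← add_smul, φ.left_inv (hp _).1]

variable {A : Type*} [AddCommGroup A] {Ψ : C(unitInterval, M) → A}

lemma IsPathCocycle.eq_of_isChartConvex (hΨ : IsPathCocycle Ψ) {U : Set M} {x : M}
    {B : Set (EuclideanSpace ℝ (Fin m))} (hU : IsChartConvex m U x B) {p q : C(unitInterval, M)}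
    (hp : ∀ t, p t ∈ U) (hq : ∀ t, q t ∈ U) (h0 : p 0 = q 0) (h1 : p 1 = q 1) : Ψ p = Ψ q := by
  obtain ⟨H, hHp, hHq, hH⟩ := hU.exists_homotopy hp hq
  have left (s : ℝ) : H (s, 0) = p 0 := by rw [hH s 0 (by rwa [clampI_zero]), clampI_zero]
  have right (s : ℝ) : H (s, 1) = p 1 := by rw [hH s 1 (by rwa [clampI_one]), clampI_one]
  convert hΨ.eq_of_homotopy H (fun s ↦ by rw [left, left]) (fun s ↦ by rw [right, right]) using 2
  · ext t
    rw [ContinuousMap.comp_apply, planeSeg_vertical, hHp, clampI_coe]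
  · ext t
    rw [ContinuousMap.comp_apply, planeSeg_vertical, hHq, clampI_coe]

/-- A smooth curve from `x` to `y` which is constant outside of the middle third of the unit
interval, so that such curves can be concatenated smoothly. -/
structure IsFlatCurve (m : ℕ) {M : Type*} [TopologicalSpace M]
    [ChartedSpace (EuclideanSpace ℝ (Fin m)) M] (c : C(ℝ, M)) (x y : M) : Prop where
  smooth : ContMDiff 𝓘(ℝ) (𝓡 m) ∞ c
  left : ∀ t ≤ 1 / 3, c t = x
  right : ∀ t, 2 / 3 ≤ t → c t = y

variable (m) in
/-- There is a flat curve from `x` to `y` on which the path functional `Ψ` is `a`. -/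
def FlatJoin (Ψ : C(unitInterval, M) → A) (x y : M) (a : A) : Prop :=
  ∃ c : C(ℝ, M), IsFlatCurve m c x y ∧ Ψ (arc c 0 1) = a

lemma IsPathCocycle.arc_const (hΨ : IsPathCocycle Ψ) (c : C(ℝ, M)) {a b : ℝ} (hab : a ≤ b) (x : M)
    (h : ∀ t ∈ Icc a b, c t = x) : Ψ (arc c a b) = 0 := by
  rw [← hΨ.const x]
  congr 1
  ext t
  obtain ⟨s, hs, hst⟩ := exists_arc_apply_eq c hab t
  rw [hst, h s hs, ContinuousMap.const_apply]

lemma IsFlatCurve.exists_trans {c d : C(ℝ, M)} {x y z : M} (hc : IsFlatCurve m c x y)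
    (hd : IsFlatCurve m d y z) : ∃ Q : C(ℝ, M), IsFlatCurve m Q x z ∧
      (∀ t < 5 / 9, Q t = c (6 * t - 2)) ∧ ∀ t > 4 / 9, Q t = d (6 * t - 3) := by
  let q : ℝ → M := fun t ↦ if t ≤ 1 / 2 then c (6 * t - 2) else d (6 * t - 3)
  have hqc : ∀ t < 5 / 9, q t = c (6 * t - 2) := by
    intro t ht
    by_cases h : t ≤ 1 / 2
    · exact if_pos h
    · simp only [q, if_neg h]
      rw [hd.left _ (by linarith), hc.right _ (by linarith)]
  have hqd : ∀ t > 4 / 9, q t = d (6 * t - 3) := by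
    intro t ht
    by_cases h : t ≤ 1 / 2
    · simp only [q, if_pos h]
      rw [hd.left _ (by linarith), hc.right _ (by linarith)]
    · exact if_neg h
  have hq : ContMDiff 𝓘(ℝ) (𝓡 m) ∞ q := by
    have hc_smooth : ContMDiff 𝓘(ℝ) (𝓡 m) ∞ fun t : ℝ ↦ c (6 * t - 2) :=
      hc.smooth.comp (ContDiff.contMDiff (by fun_prop))
    have hd_smooth : ContMDiff 𝓘(ℝ) (𝓡 m) ∞ fun t : ℝ ↦ d (6 * t - 3) :=
      hd.smooth.comp (ContDiff.contMDiff (by fun_prop))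
    intro t
    by_cases h : t < 5 / 9
    · refine (hc_smooth t).congr_of_eventuallyEq ?_
      filter_upwards [Iio_mem_nhds h] with s hs using hqc s hs
    · refine (hd_smooth t).congr_of_eventuallyEq ?_
      filter_upwards [Ioi_mem_nhds (show 4 / 9 < t by linarith)] with s hs using hqd s hs
  refine ⟨⟨q, hq.continuous⟩, ⟨hq, fun t ht ↦ ?_, fun t ht ↦ ?_⟩, hqc, hqd⟩
  · exact (hqc t (by linarith)).trans (hc.left _ (by linarith))
  · exact (hqd t (by linarith)).trans (hd.right _ (by linarith))

lemma IsPathCocycle.arc_concat (hΨ : IsPathCocycle Ψ) {c d Q : C(ℝ, M)} {x z : M}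
    (hQ : IsFlatCurve m Q x z) (hQc : ∀ t < 5 / 9, Q t = c (6 * t - 2))
    (hQd : ∀ t > 4 / 9, Q t = d (6 * t - 3)) :
    Ψ (arc Q 0 1) = Ψ (arc c 0 1) + Ψ (arc d 0 1) := by
  have initial : Ψ (arc Q 0 (1 / 3)) = 0 := hΨ.arc_const Q (by norm_num) x fun t ht ↦
    hQ.left t ht.2
  have final : Ψ (arc Q (2 / 3) 1) = 0 := hΨ.arc_const Q (by norm_num) z fun t ht ↦
    hQ.right t ht.1
  have first_half : arc Q (1 / 3) (1 / 2) = arc c 0 1 := by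
    ext t
    rw [arc_apply, arc_apply, hQc _ (by nlinarith [t.2.1, t.2.2])]
    congr 1
    ring
  have second_half : arc Q (1 / 2) (2 / 3) = arc d 0 1 := by
    ext t
    rw [arc_apply, arc_apply, hQd _ (by nlinarith [t.2.1, t.2.2])]
    congr 1
    ring
  rw [← hΨ.arc_add Q 0 (1 / 3) 1, ← hΨ.arc_add Q (1 / 3) (1 / 2) 1,
    ← hΨ.arc_add Q (1 / 2) (2 / 3) 1, initial, final, first_half, second_half, zero_add, add_zero]

lemma FlatJoin.trans (hΨ : IsPathCocycle Ψ) {x y z : M} {a b : A} (hxy : FlatJoin m Ψ x y a)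
    (hyz : FlatJoin m Ψ y z b) : FlatJoin m Ψ x z (a + b) := by
  obtain ⟨c, hc, rfl⟩ := hxy
  obtain ⟨d, hd, rfl⟩ := hyz
  obtain ⟨Q, hQ, hQc, hQd⟩ := hc.exists_trans hd
  exact ⟨Q, hQ, hΨ.arc_concat hQ hQc hQd⟩

lemma FlatJoin.refl (hΨ : IsPathCocycle Ψ) (x : M) : FlatJoin m Ψ x x 0 :=
  ⟨ContinuousMap.const _ x, ⟨contMDiff_const, fun _ _ ↦ rfl, fun _ _ ↦ rfl⟩,
    hΨ.arc_const _ zero_le_one x fun _ _ ↦ rfl⟩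

variable [IsManifold (𝓡 m) ∞ M]

lemma flatJoin_of_isChartConvex (hΨ : IsPathCocycle Ψ) {U : Set M} {x : M}
    {B : Set (EuclideanSpace ℝ (Fin m))} (hU : IsChartConvex m U x B) {p : C(unitInterval, M)}
    (hp : ∀ t, p t ∈ U) : FlatJoin m Ψ (p 0) (p 1) (Ψ p) := by
  set φ := chartAt (EuclideanSpace ℝ (Fin m)) x
  have hpφ := hp
  rw [hU.eq] at hpφ
  let s : ℝ → ℝ := fun t ↦ Real.smoothTransition (3 * t - 1)
  have hs : ContDiff ℝ ∞ s := Real.smoothTransition.contDiff.comp (by fun_prop)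
  let K : ℝ → EuclideanSpace ℝ (Fin m) := fun t ↦ (1 - s t) • φ (p 0) + s t • φ (p 1)
  have hK : ContDiff ℝ ∞ K :=
    ((contDiff_const.sub hs).smul contDiff_const).add (hs.smul contDiff_const)
  have hKB : ∀ t, K t ∈ B := fun t ↦ hU.convex (hpφ 0).2 (hpφ 1).2
    (sub_nonneg.2 (Real.smoothTransition.le_one _)) (Real.smoothTransition.nonneg _) (by ring)
  have hc : ContMDiff 𝓘(ℝ) (𝓡 m) ∞ fun t ↦ φ.symm (K t) := by
    intro t
    have hφ : ContMDiffAt (𝓡 m) (𝓡 m) ∞ φ.symm (K t) :=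
      (contMDiffOn_chart_symm (x := x)).contMDiffAt (φ.open_target.mem_nhds (hU.subset (hKB t)))
    exact hφ.comp t hK.contMDiff.contMDiffAt
  let c : C(ℝ, M) := ⟨_, hc.continuous⟩
  have left : ∀ t ≤ 1 / 3, c t = p 0 := by
    intro t ht
    have hst : s t = 0 := Real.smoothTransition.zero_of_nonpos (by linarith)
    simp [c, K, hst, φ.left_inv (hpφ 0).1]
  have right : ∀ t, 2 / 3 ≤ t → c t = p 1 := by
    intro t ht
    have hst : s t = 1 := Real.smoothTransition.one_of_one_le (by linarith)
    simp [c, K, hst, φ.left_inv (hpφ 1).1]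
  refine ⟨c, ⟨hc, left, right⟩, ?_⟩
  refine hΨ.eq_of_isChartConvex hU (fun t ↦ hU.symm_mem (hKB _)) hp ?_ ?_
  · rw [arc_apply, left _ (by norm_num)]
  · rw [arc_apply, right _ (by norm_num)]

lemma flatJoin_arc_of_isChartConvex (hΨ : IsPathCocycle Ψ) {U : Set M} {x : M}
    {B : Set (EuclideanSpace ℝ (Fin m))} (hU : IsChartConvex m U x B) (c : C(ℝ, M)) {a b : ℝ}
    (hab : a ≤ b) (hc : ∀ t ∈ Icc a b, c t ∈ U) :
    FlatJoin m Ψ (c a) (c b) (Ψ (arc c a b)) := by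
  convert flatJoin_of_isChartConvex hΨ hU (p := arc c a b) fun t ↦ ?_
  · simp [arc_apply]
  · simp [arc_apply]
  · obtain ⟨s, hs, hst⟩ := exists_arc_apply_eq c hab t
    exact hst ▸ hc s hs

theorem flatJoin_of_path (hΨ : IsPathCocycle Ψ) (p : C(unitInterval, M)) :
    FlatJoin m Ψ (p 0) (p 1) (Ψ p) := by
  choose U B hU hxU _ using fun x : M ↦ exists_isChartConvex m x (univ_mem (f := 𝓝 x))
  obtain ⟨t, ht0, ht_mono, ⟨n, hn⟩, hcover⟩ := exists_monotone_Icc_subset_open_cover_unitInterval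
    (c := fun x ↦ p ⁻¹' U x) (fun x ↦ (hU x).isOpen_set.preimage p.continuous)
    (fun s _ ↦ mem_iUnion.2 ⟨p s, hxU _⟩)
  let c : C(ℝ, M) := p.comp clampI
  have hct (s : unitInterval) : c (s : ℝ) = p s := congrArg p (clampI_coe s)
  have hcp : arc c 0 1 = p := by
    ext s
    rw [arc_zero_one_apply, hct]
  have initial (k : ℕ) : FlatJoin m Ψ (c (t 0)) (c (t k)) (Ψ (arc c (t 0) (t k))) := by
    induction k with
    | zero =>
      rw [hΨ.arc_self]
      exact FlatJoin.refl hΨ _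
    | succ k ih =>
      obtain ⟨x, hx⟩ := hcover k
      rw [← hΨ.arc_add c (t 0) (t k) (t (k + 1))]
      refine ih.trans hΨ
        (flatJoin_arc_of_isChartConvex hΨ (hU x) c (ht_mono k.le_succ) fun r hr ↦ ?_)
      have hr_unit : r ∈ Icc (0 : ℝ) 1 := ⟨(t k).2.1.trans hr.1, hr.2.trans (t (k + 1)).2.2⟩
      rw [hct ⟨r, hr_unit⟩]
      exact hx (show (⟨r, hr_unit⟩ : unitInterval) ∈ Icc (t k) (t (k + 1)) from hr)
  have whole := initial n
  rwa [hn n le_rfl, ht0, hct, hct, Icc.coe_zero, Icc.coe_one, hcp] at whole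

lemma fract_extension_eq_sub_int {X : Type*} {d : ℝ → X} {x : X} (hl : ∀ t ≤ 1 / 3, d t = x)
    (hr : ∀ t, 2 / 3 ≤ t → d t = x) (k : ℤ) {t : ℝ} (ht : t ∈ Ioo (k - 1 / 3 : ℝ) (k + 4 / 3)) :
    d (Int.fract t) = d (t - k) := by
  rcases lt_trichotomy ⌊t⌋ k with h | h | h
  · have htk : t < k := Int.floor_lt.1 h
    have hfloor : ⌊t⌋ = k - 1 := by
      rw [Int.floor_eq_iff]; push_cast; constructor <;> linarith [ht.1]
    rw [Int.fract, hfloor, hl (t - k) (by linarith), hr]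
    push_cast
    linarith [ht.1]
  · rw [Int.fract, h]
  · have hkt : ((k + 1 : ℤ) : ℝ) ≤ t := Int.le_floor.1 h
    push_cast at hkt
    have hfloor : ⌊t⌋ = k + 1 := by
      rw [Int.floor_eq_iff]; push_cast; constructor <;> linarith [ht.2]
    rw [Int.fract, hfloor, hr (t - k) (by linarith), hl]
    push_cast
    linarith [ht.2]

theorem exists_periodic_of_loop (hΨ : IsPathCocycle Ψ) {x : M} (γ : Path x x) :
    ∃ c : C(ℝ, M), ContMDiff 𝓘(ℝ) (𝓡 m) ∞ c ∧ Function.Periodic c 1 ∧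
      Ψ (arc c 0 1) = Ψ γ.toContinuousMap := by
  obtain ⟨d, hd, hdΨ⟩ := flatJoin_of_path (m := m) hΨ γ.toContinuousMap
  have eq_sub_int := fract_extension_eq_sub_int (fun t ht ↦ (hd.left t ht).trans γ.source)
    fun t ht ↦ (hd.right t ht).trans γ.target
  have hc : ContMDiff 𝓘(ℝ) (𝓡 m) ∞ fun t : ℝ ↦ d (Int.fract t) := by
    intro t
    have hshift : ContMDiff 𝓘(ℝ) (𝓡 m) ∞ fun s : ℝ ↦ d (s - ⌊t⌋) :=
      hd.smooth.comp (ContDiff.contMDiff (by fun_prop))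
    refine (hshift t).congr_of_eventuallyEq ?_
    filter_upwards [Ioo_mem_nhds (show (⌊t⌋ - 1 / 3 : ℝ) < t by linarith [Int.floor_le t])
      (show t < (⌊t⌋ + 4 / 3 : ℝ) by linarith [Int.lt_floor_add_one t])] with s hs
    exact eq_sub_int _ hs
  refine ⟨⟨_, hc.continuous⟩, hc, fun t ↦ ?_, ?_⟩
  · change d (Int.fract (t + 1)) = d (Int.fract t)
    rw [Int.fract_add_one]
  · rw [← hdΨ]
    congr 1
    ext s
    rw [arc_zero_one_apply, arc_zero_one_apply]
    simpa using eq_sub_int 0 (t := s)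
      ⟨by push_cast; linarith [s.2.1], by push_cast; linarith [s.2.2]⟩

end Smoothing

/-! ### Perturbation of smooth loops -/

section Perturbation

variable {m : ℕ} {M : Type*} [TopologicalSpace M] [ChartedSpace (EuclideanSpace ℝ (Fin m)) M]

/-- A smooth curve of period one. -/
structure IsSmoothLoop (m : ℕ) {M : Type*} [TopologicalSpace M]
    [ChartedSpace (EuclideanSpace ℝ (Fin m)) M] (c : C(ℝ, M)) : Prop where
  smooth : ContMDiff 𝓘(ℝ) (𝓡 m) ∞ c
  periodic : Function.Periodic c 1

lemma IsSmoothLoop.add_int {c : C(ℝ, M)} (hc : IsSmoothLoop m c) (t : ℝ) (k : ℤ) :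
    c (t + k) = c t := by
  simpa using hc.periodic.int_mul k t

variable (m) in
/-- A set of curves is stable if membership persists under small smooth deformations with
`m` parameters. -/
def IsStable (G : Set (ℝ → M)) : Prop :=
  ∀ (K : EuclideanSpace ℝ (Fin m) × ℝ → M) (r : ℝ), 0 < r →
    ContMDiffOn 𝓘(ℝ, EuclideanSpace ℝ (Fin m) × ℝ) (𝓡 m) ∞ K (Metric.ball 0 r ×ˢ univ) →
    (fun t ↦ K (0, t)) ∈ G → ∀ᶠ w in 𝓝 0, (fun t ↦ K (w, t)) ∈ G

lemma IsStable.inter {G G' : Set (ℝ → M)} (h : IsStable m G) (h' : IsStable m G') :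
    IsStable m (G ∩ G') := fun K r hr hK h0 ↦
  (h K r hr hK h0.1).and (h' K r hr hK h0.2)

lemma IsStable.iInter {ι : Type*} [Finite ι] {G : ι → Set (ℝ → M)} (h : ∀ i, IsStable m (G i)) :
    IsStable m (⋂ i, G i) := fun K r hr hK h0 ↦ by
  filter_upwards [eventually_all.2 fun i ↦ h i K r hr hK (mem_iInter.1 h0 i)] with w hw
  exact mem_iInter.2 hw

theorem exists_forall_mem_of_isStable {ι : Type*} [Finite ι] {P : C(ℝ, M) → Prop}
    {G : Set (ℝ → M)} {R : ι → Set (ℝ → M)} (hR : ∀ i, IsStable m (R i))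
    (step : ∀ i, ∀ G' : Set (ℝ → M), IsStable m G' → ∀ c : C(ℝ, M), P c → ⇑c ∈ G → ⇑c ∈ G' →
      ∃ c' : C(ℝ, M), P c' ∧ ⇑c' ∈ G ∩ G' ∧ ⇑c' ∈ R i)
    {c : C(ℝ, M)} (hc : P c) (hcG : ⇑c ∈ G) :
    ∃ c' : C(ℝ, M), P c' ∧ ⇑c' ∈ G ∧ ∀ i, ⇑c' ∈ R i := by
  classical
  have := Fintype.ofFinite ι
  have partial_achieved (s : Finset ι) :
      ∃ c' : C(ℝ, M), P c' ∧ ⇑c' ∈ G ∧ ∀ i ∈ s, ⇑c' ∈ R i := by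
    induction s using Finset.induction_on with
    | empty => exact ⟨c, hc, hcG, by simp⟩
    | insert i s _ ih =>
      obtain ⟨d, hd, hdG, hds⟩ := ih
      obtain ⟨d', hd', hdG', hdR⟩ := step i (⋂ j : s, R j) (IsStable.iInter fun j ↦ hR j) d hd hdG
        (mem_iInter.2 fun j ↦ hds j j.2)
      refine ⟨d', hd', hdG'.1, fun j hj ↦ ?_⟩
      rcases Finset.mem_insert.1 hj with rfl | hj
      · exact hdR
      · exact mem_iInter.1 hdG'.2 ⟨j, hj⟩
  simpa using partial_achieved Finset.univ

lemma contMDiffAt_of_contMDiffOn_ball_prod {K : EuclideanSpace ℝ (Fin m) × ℝ → M} {r : ℝ}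
    (hK : ContMDiffOn 𝓘(ℝ, EuclideanSpace ℝ (Fin m) × ℝ) (𝓡 m) ∞ K (Metric.ball 0 r ×ˢ univ))
    {w : EuclideanSpace ℝ (Fin m)} (hw : w ∈ Metric.ball 0 r) (t : ℝ) :
    ContMDiffAt 𝓘(ℝ, EuclideanSpace ℝ (Fin m) × ℝ) (𝓡 m) ∞ K (w, t) :=
  hK.contMDiffAt (prod_mem_nhds (Metric.isOpen_ball.mem_nhds hw) univ_mem)

lemma isStable_mem {J : Set ℝ} (hJ : IsCompact J) {U : Set M} (hU : IsOpen U) :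
    IsStable m ({c | ∀ t ∈ J, c t ∈ U} : Set (ℝ → M)) := fun K r hr hK h0 ↦ by
  refine hJ.eventually_forall_of_forall_eventually fun t ht ↦ ?_
  exact (contMDiffAt_of_contMDiffOn_ball_prod hK (Metric.mem_ball_self hr) t).continuousAt
    |>.eventually_mem (hU.mem_nhds (h0 t ht))

lemma isStable_ne [T2Space M] {J J' : Set ℝ} (hJ : IsCompact J) (hJ' : IsCompact J') :
    IsStable m ({c | ∀ s ∈ J, ∀ t ∈ J', c s ≠ c t} : Set (ℝ → M)) := fun K r hr hK h0 ↦ by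
  have hne : ∀ᶠ w in 𝓝 (0 : EuclideanSpace ℝ (Fin m)), ∀ p ∈ J ×ˢ J', K (w, p.1) ≠ K (w, p.2) := by
    refine (hJ.prod hJ').eventually_forall_of_forall_eventually fun p hp ↦ ?_
    have hK0 (t : ℝ) : ContinuousAt K (0, t) :=
      (contMDiffAt_of_contMDiffOn_ball_prod hK (Metric.mem_ball_self hr) t).continuousAt
    have hfst : ContinuousAt (fun z : EuclideanSpace ℝ (Fin m) × (ℝ × ℝ) ↦ K (z.1, z.2.1)) (0, p) :=
      ContinuousAt.comp (f := fun z : EuclideanSpace ℝ (Fin m) × (ℝ × ℝ) ↦ (z.1, z.2.1))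
        (hK0 p.1) (by fun_prop)
    have hsnd : ContinuousAt (fun z : EuclideanSpace ℝ (Fin m) × (ℝ × ℝ) ↦ K (z.1, z.2.2)) (0, p) :=
      ContinuousAt.comp (f := fun z : EuclideanSpace ℝ (Fin m) × (ℝ × ℝ) ↦ (z.1, z.2.2))
        (hK0 p.2) (by fun_prop)
    exact (hfst.prodMk hsnd).eventually_mem
      (isClosed_diagonal.isOpen_compl.mem_nhds (h0 _ hp.1 _ hp.2))
  filter_upwards [hne] with w hw s hs t ht using hw (s, t) ⟨hs, ht⟩

lemma IsPathCocycle.arc_eq_of_periodic_deformation {A : Type*} [AddCommGroup A]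
    {Ψ : C(unitInterval, M) → A} (hΨ : IsPathCocycle Ψ) {V : Type*} [AddCommGroup V] [Module ℝ V]
    [TopologicalSpace V] [ContinuousSMul ℝ V] {U : Set V} (hU : StarConvex ℝ 0 U)
    {K : V × ℝ → M} (hK : ContinuousOn K (U ×ˢ univ)) (hKp : ∀ w t, K (w, t + 1) = K (w, t))
    {w : V} (hw : w ∈ U) {c c' : C(ℝ, M)} (hc : ∀ t, K (0, t) = c t) (hc' : ∀ t, K (w, t) = c' t) :
    Ψ (arc c' 0 1) = Ψ (arc c 0 1) := by
  let H : C(ℝ × ℝ, M) := ⟨fun z ↦ K ((clampI z.1 : ℝ) • w, z.2),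
    hK.comp_continuous (by fun_prop) fun z ↦
      ⟨hU.smul_mem hw (clampI z.1).2.1 (clampI z.1).2.2, mem_univ _⟩⟩
  have hH (s : ℝ) : H (s, 0) = H (s, 1) := by
    simpa [H] using (hKp ((clampI s : ℝ) • w) 0).symm
  convert (hΨ.eq_of_freeHomotopy H hH).symm using 2
  · ext t
    rw [ContinuousMap.comp_apply, planeSeg_vertical, arc_zero_one_apply]
    simp [H, clampI_one, hc']
  · ext t
    rw [ContinuousMap.comp_apply, planeSeg_vertical, arc_zero_one_apply]
    simp [H, clampI_zero, hc]

/-- A periodic smooth weight `β` which vanishes outside of a closed periodic set `T` of parameters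
on which the curve `c` stays in the chart domain at `x`. Such a weight makes it possible to
translate `c` in the chart by the vectors `β t • w`. -/
structure IsChartBump (c : C(ℝ, M)) (x : M) (β : ℝ → ℝ) (T : Set ℝ) : Prop where
  smooth : ContDiff ℝ ∞ β
  periodic : Function.Periodic β 1
  isClosed : IsClosed T
  add_int_mem : ∀ t ∈ T, ∀ k : ℤ, t + k ∈ T
  eq_zero : ∀ t ∉ T, β t = 0
  mem_source : ∀ t ∈ T, c t ∈ (chartAt (EuclideanSpace ℝ (Fin m)) x).source

open scoped Classical in
/-- The curve `c`, translated in the chart at `x` by `β t • w` at the parameters `t ∈ T`, as a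
function of `(w, t)`. -/
def chartShift (c : C(ℝ, M)) (x : M) (β : ℝ → ℝ) (T : Set ℝ)
    (z : EuclideanSpace ℝ (Fin m) × ℝ) : M :=
  if z.2 ∈ T then
    (chartAt (EuclideanSpace ℝ (Fin m)) x).symm
      (chartAt (EuclideanSpace ℝ (Fin m)) x (c z.2) + β z.2 • z.1)
  else c z.2

namespace IsChartBump

variable {c : C(ℝ, M)} {x : M} {β : ℝ → ℝ} {T : Set ℝ} (h : IsChartBump (m := m) c x β T)
include h

lemma fract_mem_iff (t : ℝ) : Int.fract t ∈ T ↔ t ∈ T := by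
  refine ⟨fun ht ↦ ?_, fun ht ↦ ?_⟩
  · simpa only [Int.fract_add_floor] using h.add_int_mem _ ht ⌊t⌋
  · simpa only [Int.cast_neg, ← sub_eq_add_neg, Int.self_sub_floor] using h.add_int_mem t ht (-⌊t⌋)

lemma chartShift_eq_of_eq_zero (w : EuclideanSpace ℝ (Fin m)) {t : ℝ} (ht : β t = 0) :
    chartShift c x β T (w, t) = c t := by
  by_cases htT : t ∈ T
  · simp only [chartShift, if_pos htT, ht, zero_smul, add_zero]
    exact (chartAt _ x).left_inv (h.mem_source t htT)
  · simp only [chartShift, if_neg htT]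

lemma chartShift_zero (t : ℝ) : chartShift c x β T ((0 : EuclideanSpace ℝ (Fin m)), t) = c t := by
  by_cases htT : t ∈ T
  · simp only [chartShift, if_pos htT, smul_zero, add_zero]
    exact (chartAt _ x).left_inv (h.mem_source t htT)
  · simp only [chartShift, if_neg htT]

lemma chartShift_add_one (hc : IsSmoothLoop m c) (w : EuclideanSpace ℝ (Fin m)) (t : ℝ) :
    chartShift c x β T (w, t + 1) = chartShift c x β T (w, t) := by
  have hT : t + 1 ∈ T ↔ t ∈ T := by
    rw [← h.fract_mem_iff, Int.fract_add_one, h.fract_mem_iff]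
  by_cases ht : t ∈ T
  · simp only [chartShift, if_pos ht, if_pos (hT.2 ht), h.periodic t, hc.periodic t]
  · simp only [chartShift, if_neg ht, if_neg (mt hT.1 ht), hc.periodic t]

lemma exists_forall_add_mem_target (hc : IsSmoothLoop m c) :
    ∃ r > 0, ∀ w ∈ Metric.ball (0 : EuclideanSpace ℝ (Fin m)) r, ∀ t ∈ T,
      chartAt (EuclideanSpace ℝ (Fin m)) x (c t) + β t • w ∈
        (chartAt (EuclideanSpace ℝ (Fin m)) x).target := by
  set φ := chartAt (EuclideanSpace ℝ (Fin m)) x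
  have hcont : ContinuousOn (fun t ↦ φ (c t)) (T ∩ Icc 0 1) :=
    φ.continuousOn.comp c.continuous.continuousOn fun t ht ↦ h.mem_source t ht.1
  obtain ⟨δ, hδ, hthick⟩ := ((isCompact_Icc.inter_left h.isClosed).image_of_continuousOn hcont)
    |>.exists_thickening_subset_open φ.open_target
      (by rintro _ ⟨t, ht, rfl⟩; exact φ.map_source (h.mem_source t ht.1))
  obtain ⟨b, hb⟩ := (isCompact_Icc (a := (0 : ℝ)) (b := 1)).exists_bound_of_continuousOn
    h.smooth.continuous.continuousOn
  have hb0 : 0 ≤ b := (norm_nonneg _).trans (hb 0 (by simp))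
  refine ⟨δ / (b + 1), by positivity, fun w hw t ht ↦ hthick ?_⟩
  have hfract : Int.fract t ∈ Icc (0 : ℝ) 1 := ⟨Int.fract_nonneg t, (Int.fract_lt_one t).le⟩
  have hc_fract : c (Int.fract t) = c t := by simpa using hc.periodic.sub_int_mul_eq ⌊t⌋ (x := t)
  have hβt : ‖β t‖ ≤ b := by
    rw [← h.periodic.sub_int_mul_eq ⌊t⌋ (x := t), mul_one]
    exact hb _ hfract
  rw [Metric.mem_thickening_iff]
  refine ⟨φ (c t), ⟨Int.fract t, ⟨(h.fract_mem_iff t).2 ht, hfract⟩, congrArg φ hc_fract⟩, ?_⟩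
  rw [dist_eq_norm, add_sub_cancel_left, norm_smul]
  rw [mem_ball_zero_iff, lt_div_iff₀ (by positivity)] at hw
  nlinarith [norm_nonneg w, norm_nonneg (β t)]

end IsChartBump

variable [IsManifold (𝓡 m) ∞ M]

lemma contMDiffAt_chartAt {x y : M}
    (hy : y ∈ (chartAt (EuclideanSpace ℝ (Fin m)) x).source) :
    ContMDiffAt (𝓡 m) 𝓘(ℝ, EuclideanSpace ℝ (Fin m)) ∞
      (chartAt (EuclideanSpace ℝ (Fin m)) x) y :=
  (contMDiffOn_chart (x := x)).contMDiffAt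
    ((chartAt (EuclideanSpace ℝ (Fin m)) x).open_source.mem_nhds hy)

lemma contMDiffAt_chartAt_symm {x : M} {z : EuclideanSpace ℝ (Fin m)}
    (hz : z ∈ (chartAt (EuclideanSpace ℝ (Fin m)) x).target) :
    ContMDiffAt 𝓘(ℝ, EuclideanSpace ℝ (Fin m)) (𝓡 m) ∞
      (chartAt (EuclideanSpace ℝ (Fin m)) x).symm z :=
  (contMDiffOn_chart_symm (x := x)).contMDiffAt
    ((chartAt (EuclideanSpace ℝ (Fin m)) x).open_target.mem_nhds hz)

lemma isStable_deriv {J : Set ℝ} (hJ : IsCompact J) (x : M)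
    {O : Set (EuclideanSpace ℝ (Fin m))} (hO : IsOpen O) :
    IsStable m ({c |
      ∀ t ∈ J, c t ∈ (chartAt (EuclideanSpace ℝ (Fin m)) x).source ∧
        deriv (fun s ↦ chartAt (EuclideanSpace ℝ (Fin m)) x (c s)) t ∈ O} : Set (ℝ → M)) := by
  intro K r hr hK h0
  set φ := chartAt (EuclideanSpace ℝ (Fin m)) x
  refine hJ.eventually_forall_of_forall_eventually fun t ht ↦ ?_
  have hKt := contMDiffAt_of_contMDiffOn_ball_prod hK (Metric.mem_ball_self hr) t
  have hφK : ContDiffAt ℝ ∞ (fun z ↦ φ (K z)) ((0 : EuclideanSpace ℝ (Fin m)), t) :=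
    ((contMDiffAt_chartAt (h0 t ht).1).comp _ hKt).contDiffAt
  have hderiv : ∀ᶠ z in 𝓝 ((0 : EuclideanSpace ℝ (Fin m)), t),
      deriv (fun s ↦ φ (K (z.1, s))) z.2 = fderiv ℝ (fun z ↦ φ (K z)) z (0, 1) := by
    filter_upwards [(hφK.of_le (m := 1) (by exact_mod_cast le_top)).eventually (by simp)] with z hz
    have hpair : HasDerivAt (fun s : ℝ ↦ (z.1, s)) ((0 : EuclideanSpace ℝ (Fin m)), (1 : ℝ)) z.2 :=
      (hasDerivAt_const _ _).prodMk (hasDerivAt_id _)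
    exact ((hz.differentiableAt (by simp)).hasFDerivAt.comp_hasDerivAt z.2 hpair).deriv
  have hcont : ContinuousAt (fun z ↦ fderiv ℝ (fun z ↦ φ (K z)) z (0, 1))
      ((0 : EuclideanSpace ℝ (Fin m)), t) :=
    (hφK.fderiv_right (m := 0) (by simp)).continuousAt.clm_apply continuousAt_const
  filter_upwards [hKt.continuousAt.eventually_mem (φ.open_source.mem_nhds (h0 t ht).1), hderiv,
    hcont.eventually_mem (hO.mem_nhds (hderiv.self_of_nhds ▸ (h0 t ht).2))] with z hsource heq hO
  exact ⟨hsource, heq ▸ hO⟩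

lemma IsChartBump.contMDiffOn_chartShift {c : C(ℝ, M)} {x : M} {β : ℝ → ℝ} {T : Set ℝ}
    (h : IsChartBump (m := m) c x β T) (hc : ContMDiff 𝓘(ℝ) (𝓡 m) ∞ c)
    {U : Set (EuclideanSpace ℝ (Fin m))} (hU : ∀ w ∈ U, ∀ t ∈ T,
      chartAt (EuclideanSpace ℝ (Fin m)) x (c t) + β t • w ∈
        (chartAt (EuclideanSpace ℝ (Fin m)) x).target) :
    ContMDiffOn 𝓘(ℝ, EuclideanSpace ℝ (Fin m) × ℝ) (𝓡 m) ∞ (chartShift c x β T)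
      (U ×ˢ univ) := by
  set φ := chartAt (EuclideanSpace ℝ (Fin m)) x
  rintro ⟨w, t⟩ ⟨hw, -⟩
  apply ContMDiffAt.contMDiffWithinAt
  have hsnd : ContMDiffAt 𝓘(ℝ, EuclideanSpace ℝ (Fin m) × ℝ) (𝓡 m) ∞
      (fun z : EuclideanSpace ℝ (Fin m) × ℝ ↦ c z.2) (w, t) :=
    (hc t).comp (w, t) contDiff_snd.contMDiff.contMDiffAt
  by_cases ht : t ∈ T
  · have hφc : ContMDiffAt 𝓘(ℝ, EuclideanSpace ℝ (Fin m) × ℝ) 𝓘(ℝ, EuclideanSpace ℝ (Fin m)) ∞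
        (fun z : EuclideanSpace ℝ (Fin m) × ℝ ↦ φ (c z.2)) (w, t) :=
      (contMDiffAt_chartAt (h.mem_source t ht)).comp (w, t) hsnd
    have hβw : ContDiff ℝ ∞ (fun z : EuclideanSpace ℝ (Fin m) × ℝ ↦ β z.2 • z.1) :=
      (h.smooth.comp contDiff_snd).smul contDiff_fst
    have hshift : ContMDiffAt 𝓘(ℝ, EuclideanSpace ℝ (Fin m) × ℝ) (𝓡 m) ∞
        (fun z : EuclideanSpace ℝ (Fin m) × ℝ ↦ φ.symm (φ (c z.2) + β z.2 • z.1)) (w, t) :=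
      ContMDiffAt.comp (w, t) (contMDiffAt_chartAt_symm (hU w hw t ht))
        (hφc.contDiffAt.add hβw.contDiffAt).contMDiffAt
    refine hshift.congr_of_eventuallyEq ?_
    filter_upwards [hsnd.continuousAt.eventually_mem (φ.open_source.mem_nhds (h.mem_source t ht))]
      with z hz
    by_cases hzT : z.2 ∈ T
    · exact if_pos hzT
    · rw [h.eq_zero _ hzT, zero_smul, add_zero, φ.left_inv hz]
      exact if_neg hzT
  · refine hsnd.congr_of_eventuallyEq ?_
    filter_upwards [(h.isClosed.isOpen_compl.preimage continuous_snd).mem_nhds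
      (show (w, t) ∈ Prod.snd ⁻¹' Tᶜ from ht)] with z hz
    exact if_neg hz

theorem IsChartBump.exists_perturbation {A : Type*} [AddCommGroup A] {Ψ : C(unitInterval, M) → A}
    (hΨ : IsPathCocycle Ψ) {c : C(ℝ, M)} (hc : IsSmoothLoop m c) {x : M} {β : ℝ → ℝ} {T : Set ℝ}
    (h : IsChartBump (m := m) c x β T) {G : Set (ℝ → M)} (hG : IsStable m G) (hcG : ⇑c ∈ G)
    {W : Set (EuclideanSpace ℝ (Fin m))} (hW : Dense W) :
    ∃ c' : C(ℝ, M), IsSmoothLoop m c' ∧ ⇑c' ∈ G ∧ Ψ (arc c' 0 1) = Ψ (arc c 0 1) ∧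
      (∀ t, β t = 0 → c' t = c t) ∧
      ∃ w ∈ W, ∀ t ∈ T, c' t ∈ (chartAt (EuclideanSpace ℝ (Fin m)) x).source ∧
        chartAt (EuclideanSpace ℝ (Fin m)) x (c' t) =
          chartAt (EuclideanSpace ℝ (Fin m)) x (c t) + β t • w := by
  set φ := chartAt (EuclideanSpace ℝ (Fin m)) x
  obtain ⟨r, hr, htarget⟩ := h.exists_forall_add_mem_target hc
  have hK := h.contMDiffOn_chartShift hc.smooth htarget
  have hGw : ∀ᶠ w in 𝓝 0, (fun t ↦ chartShift c x β T (w, t)) ∈ G :=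
    hG _ r hr hK (by rwa [funext h.chartShift_zero])
  obtain ⟨w, hwW, hwG, hwr⟩ :=
    hW.inter_nhds_nonempty (hGw.and (Metric.ball_mem_nhds (0 : EuclideanSpace ℝ (Fin m)) hr))
  have hs : ContMDiff 𝓘(ℝ) (𝓡 m) ∞ fun t ↦ chartShift c x β T (w, t) := fun t ↦
    (contMDiffAt_of_contMDiffOn_ball_prod hK hwr t).comp t
      (ContDiff.contMDiff (contDiff_prodMk_right w)).contMDiffAt
  refine ⟨⟨_, hs.continuous⟩, ⟨hs, h.chartShift_add_one hc w⟩, hwG, ?_,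
    fun t ht ↦ h.chartShift_eq_of_eq_zero w ht, w, hwW, fun t ht ↦ ?_⟩
  · exact hΨ.arc_eq_of_periodic_deformation ((convex_ball _ _).starConvex (Metric.mem_ball_self hr))
      hK.continuousOn (h.chartShift_add_one hc) hwr h.chartShift_zero fun _ ↦ rfl
  · have hct : chartShift c x β T (w, t) = φ.symm (φ (c t) + β t • w) := if_pos ht
    change chartShift c x β T (w, t) ∈ φ.source ∧ φ (chartShift c x β T (w, t)) = _
    rw [hct]
    exact ⟨φ.map_target (htarget w hwr t ht), φ.right_inv (htarget w hwr t ht)⟩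

end Perturbation

/-! ### General position -/

section PeriodicBump

lemma cos_two_pi_mul_le_iff {x y : ℝ} (hx : |x| ≤ 1 / 2) (hy : |y| ≤ 1 / 2) :
    Real.cos (2 * Real.pi * x) ≤ Real.cos (2 * Real.pi * y) ↔ |y| ≤ |x| := by
  have hpos : (0 : ℝ) < 2 * Real.pi := by positivity
  have hmem {z : ℝ} (hz : |z| ≤ 1 / 2) : 2 * Real.pi * |z| ∈ Icc 0 Real.pi :=
    ⟨by positivity, by nlinarith⟩
  have hcos_abs (z : ℝ) : Real.cos (2 * Real.pi * z) = Real.cos (2 * Real.pi * |z|) := by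
    rw [← Real.cos_abs, abs_mul, abs_of_pos hpos]
  rw [hcos_abs x, hcos_abs y, Real.strictAntiOn_cos.le_iff_ge (hmem hx) (hmem hy),
    mul_le_mul_iff_right₀ hpos]

lemma cos_two_pi_mul_add_int (y : ℝ) (k : ℤ) :
    Real.cos (2 * Real.pi * (y + k)) = Real.cos (2 * Real.pi * y) := by
  rw [← Real.cos_add_int_mul_two_pi (2 * Real.pi * y) k]
  congr 1
  ring

/-- The integer translates of the closed interval of radius `R ≤ 1 / 2` around `a`. -/
def periodicArc (a R : ℝ) : Set ℝ :=
  {t | Real.cos (2 * Real.pi * R) ≤ Real.cos (2 * Real.pi * (t - a))}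

/-- A smooth function of period one which is `1` on the interval of radius `r` around `a` and
vanishes outside of `periodicArc a R`, for `0 ≤ r < R ≤ 1 / 2`. -/
def periodicBump (a r R t : ℝ) : ℝ :=
  Real.smoothTransition
    ((Real.cos (2 * Real.pi * (t - a)) - Real.cos (2 * Real.pi * R)) /
      (Real.cos (2 * Real.pi * r) - Real.cos (2 * Real.pi * R)))

variable {a r R : ℝ}

lemma isClosed_periodicArc : IsClosed (periodicArc a R) :=
  isClosed_le (by fun_prop) (by fun_prop)

lemma add_int_mem_periodicArc {t : ℝ} (ht : t ∈ periodicArc a R) (k : ℤ) :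
    t + k ∈ periodicArc a R := by
  change _ ≤ Real.cos (2 * Real.pi * (t + k - a))
  rwa [add_sub_right_comm, cos_two_pi_mul_add_int]

lemma exists_add_int_mem_closedBall (hR0 : 0 ≤ R) (hR : R ≤ 1 / 2) {t : ℝ}
    (ht : t ∈ periodicArc a R) : ∃ k : ℤ, t + k ∈ Metric.closedBall a R := by
  refine ⟨-round (t - a), ?_⟩
  have hround : Real.cos (2 * Real.pi * R) ≤
      Real.cos (2 * Real.pi * (t - a + (-round (t - a) : ℤ))) := by
    rwa [cos_two_pi_mul_add_int]
  rw [Int.cast_neg, ← sub_eq_add_neg, cos_two_pi_mul_le_iff (by rwa [abs_of_nonneg hR0])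
    (abs_sub_round _), abs_of_nonneg hR0] at hround
  rw [Metric.mem_closedBall, Real.dist_eq]
  convert hround using 2
  push_cast
  ring

lemma contDiff_periodicBump : ContDiff ℝ ∞ (periodicBump a r R) := by
  refine Real.smoothTransition.contDiff.comp (((Real.contDiff_cos.comp ?_).sub
    contDiff_const).div_const _)
  fun_prop

lemma periodic_periodicBump : Function.Periodic (periodicBump a r R) 1 := fun t ↦ by
  have hcos := cos_two_pi_mul_add_int (t - a) 1
  rw [Int.cast_one, ← add_sub_right_comm] at hcos
  simp only [periodicBump, hcos]

lemma cos_two_pi_mul_lt (hr : 0 ≤ r) (hrR : r < R) (hR : R ≤ 1 / 2) :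
    Real.cos (2 * Real.pi * R) < Real.cos (2 * Real.pi * r) :=
  Real.cos_lt_cos_of_nonneg_of_le_pi (by positivity) (by nlinarith [Real.pi_pos])
    (by nlinarith [Real.pi_pos])

lemma periodicBump_eq_one (hr : 0 ≤ r) (hrR : r < R) (hR : R ≤ 1 / 2) {t : ℝ}
    (ht : t ∈ Metric.closedBall a r) : periodicBump a r R t = 1 := by
  rw [Metric.mem_closedBall, Real.dist_eq] at ht
  refine Real.smoothTransition.one_of_one_le ?_
  rw [one_le_div (sub_pos.2 (cos_two_pi_mul_lt hr hrR hR)), sub_le_sub_iff_right,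
    cos_two_pi_mul_le_iff (by rw [abs_of_nonneg hr]; linarith) (by linarith), abs_of_nonneg hr]
  exact ht

lemma periodicBump_eq_zero_of_cos_le (hr : 0 ≤ r) (hrR : r < R) (hR : R ≤ 1 / 2) {t : ℝ}
    (ht : Real.cos (2 * Real.pi * (t - a)) ≤ Real.cos (2 * Real.pi * R)) :
    periodicBump a r R t = 0 :=
  Real.smoothTransition.zero_of_nonpos (div_nonpos_of_nonpos_of_nonneg (sub_nonpos.2 ht)
    (sub_pos.2 (cos_two_pi_mul_lt hr hrR hR)).le)

lemma periodicBump_eq_zero_of_mem_Icc (hr : 0 ≤ r) (hrR : r < R) (hR : R ≤ 1 / 2) {t : ℝ}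
    (ht : t ∈ Icc (a + R) (a + 1 - R)) : periodicBump a r R t = 0 := by
  have hR' : |R| = R := abs_of_nonneg (hr.trans hrR.le)
  refine periodicBump_eq_zero_of_cos_le hr hrR hR ?_
  rcases le_total (t - a) (1 / 2) with hta | hta
  · rw [cos_two_pi_mul_le_iff (abs_le.2 ⟨by linarith [ht.1], hta⟩) (hR'.trans_le hR), hR']
    exact le_abs.2 (.inl (by linarith [ht.1]))
  · rw [← cos_two_pi_mul_add_int _ (-1), Int.cast_neg, Int.cast_one,
      cos_two_pi_mul_le_iff (abs_le.2 ⟨by linarith, by linarith [ht.2]⟩) (hR'.trans_le hR), hR']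
    exact le_abs.2 (.inr (by linarith [ht.2]))

lemma mem_periodicArc_of_mem_closedBall (hr : 0 ≤ r) (hrR : r < R) (hR : R ≤ 1 / 2) {t : ℝ}
    (ht : t ∈ Metric.closedBall a r) : t ∈ periodicArc a R := by
  by_contra hT
  exact one_ne_zero ((periodicBump_eq_one hr hrR hR ht).symm.trans
    (periodicBump_eq_zero_of_cos_le hr hrR hR (not_le.1 hT).le))

lemma hasDerivAt_sin_two_pi_mul_sub (a t : ℝ) :
    HasDerivAt (fun t ↦ Real.sin (2 * Real.pi * (t - a)))
      (Real.cos (2 * Real.pi * (t - a)) * (2 * Real.pi)) t := by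
  have hlin : HasDerivAt (fun t ↦ 2 * Real.pi * (t - a)) (2 * Real.pi) t := by
    simpa using ((hasDerivAt_id t).sub_const a).const_mul (2 * Real.pi)
  exact (Real.hasDerivAt_sin _).comp t hlin

lemma periodic_sin_two_pi_mul_sub (a : ℝ) :
    Function.Periodic (fun t ↦ Real.sin (2 * Real.pi * (t - a))) 1 := fun t ↦ by
  dsimp only
  rw [← Real.sin_add_two_pi (2 * Real.pi * (t - a))]
  congr 1
  ring

lemma cos_two_pi_mul_pos {x : ℝ} (hx : |x| < 1 / 4) : 0 < Real.cos (2 * Real.pi * x) := by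
  have hlt := abs_lt.1 hx
  exact Real.cos_pos_of_mem_Ioo ⟨by nlinarith [Real.pi_pos], by nlinarith [Real.pi_pos]⟩

end PeriodicBump

section Arcs

/-- The midpoint of the `l`-th of `n` consecutive intervals of equal length in `[0, 1]`. -/
def arcCenter (n : ℕ) (l : Fin n) : ℝ := (2 * l + 1) / (2 * n)

/-- Half of the length of one of `n` consecutive intervals of equal length in `[0, 1]`. -/
def arcRadius (n : ℕ) : ℝ := 1 / (2 * n)

lemma arcRadius_pos {n : ℕ} (hn : 4 ≤ n) : 0 < arcRadius n := by
  have : 0 < n := by omega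
  unfold arcRadius
  positivity

lemma arcRadius_le {n : ℕ} (hn : 4 ≤ n) : arcRadius n ≤ 1 / 8 := by
  have hn' : (4 : ℝ) ≤ n := by exact_mod_cast hn
  rw [arcRadius, div_le_div_iff₀ (by positivity) (by norm_num)]
  linarith

lemma exists_arc_cover {ι : Type*} {O : ι → Set ℝ} (hO : ∀ i, IsOpen (O i))
    (hcov : ∀ t, ∃ i, t ∈ O i) :
    ∃ n : ℕ, 4 ≤ n ∧ ∀ l : Fin n, ∃ i,
      Metric.closedBall (arcCenter n l) (3 * arcRadius n) ⊆ O i := by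
  obtain ⟨δ, hδ, hball⟩ := lebesgue_number_lemma_of_metric (isCompact_Icc (a := (0 : ℝ)) (b := 1))
    hO fun t _ ↦ mem_iUnion.2 (hcov t)
  obtain ⟨n, hn⟩ := exists_nat_gt (2 / δ)
  refine ⟨n + 4, by omega, fun l ↦ ?_⟩
  have hl : (l : ℝ) + 1 ≤ (n + 4 : ℕ) := by exact_mod_cast l.2
  obtain ⟨i, hi⟩ := hball (arcCenter (n + 4) l) ⟨by unfold arcCenter; positivity, by
    rw [arcCenter, div_le_one (by positivity)]; linarith⟩
  refine ⟨i, (Metric.closedBall_subset_ball ?_).trans hi⟩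
  rw [div_lt_iff₀ hδ] at hn
  rw [arcRadius, mul_one_div, div_lt_iff₀ (by positivity)]
  push_cast
  nlinarith

lemma exists_arc_mem {n : ℕ} (hn : 0 < n) (t : ℝ) :
    ∃ (k : ℤ) (l : Fin n), t + k ∈ Metric.closedBall (arcCenter n l) (arcRadius n) := by
  have hn' : (0 : ℝ) < n := by exact_mod_cast hn
  have hlt : ⌊n * Int.fract t⌋₊ < n := by
    rw [Nat.floor_lt (mul_nonneg hn'.le (Int.fract_nonneg t))]
    nlinarith [Int.fract_lt_one t]
  refine ⟨-⌊t⌋, ⟨⌊n * Int.fract t⌋₊, hlt⟩, ?_⟩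
  have hfloor_le := Nat.floor_le (mul_nonneg hn'.le (Int.fract_nonneg t))
  have hlt_floor := Nat.lt_floor_add_one (n * Int.fract t)
  rw [Int.cast_neg, ← sub_eq_add_neg, Int.self_sub_floor, Metric.mem_closedBall, Real.dist_eq]
  change abs (Int.fract t - (2 * (⌊n * Int.fract t⌋₊ : ℝ) + 1) / (2 * n)) ≤ 1 / (2 * n)
  set q : ℝ := (⌊n * Int.fract t⌋₊ : ℝ)
  have hsub : Int.fract t - (2 * q + 1) / (2 * n) =
      (2 * (n * Int.fract t - q) - 1) / (2 * n) := by
    field_simp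
    ring
  rw [hsub, abs_div, abs_of_pos (by positivity : (0 : ℝ) < 2 * n)]
  gcongr
  rw [abs_le]
  constructor <;> linarith

end Arcs

section GeneralPosition

lemma dense_compl_image_of_contDiffAt {F E : Type*} [NormedAddCommGroup F] [NormedSpace ℝ F]
    [FiniteDimensional ℝ F] [NormedAddCommGroup E] [NormedSpace ℝ E] [FiniteDimensional ℝ E]
    (h : Module.finrank ℝ F < Module.finrank ℝ E) {f : F → E} {O : Set F}
    (hf : ∀ z ∈ O, ContDiffAt ℝ 1 f z) : Dense (f '' O)ᶜ := by
  refine dense_compl_of_dimH_lt_finrank ?_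
  have hle : dimH (f '' O) ≤ dimH O := by
    refine dimH_image_le_of_locally_lipschitzOn fun z hz ↦ ?_
    obtain ⟨K, t, ht, hK⟩ := (hf z hz).exists_lipschitzOnWith
    exact ⟨K, t, nhdsWithin_le_nhds ht, hK⟩
  refine (hle.trans (dimH_mono (subset_univ O))).trans_lt ?_
  rw [Real.dimH_univ_eq_finrank]
  exact_mod_cast h

lemma contDiffAt_deriv {E : Type*} [NormedAddCommGroup E] [NormedSpace ℝ E]
    {f : ℝ → E} {t : ℝ} (hf : ContDiffAt ℝ ∞ f t) : ContDiffAt ℝ ∞ (deriv f) t :=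
  (hf.fderiv_right (m := ∞) (by simp)).clm_apply contDiffAt_const

variable {m : ℕ} {M : Type*} [TopologicalSpace M] [ChartedSpace (EuclideanSpace ℝ (Fin m)) M]

/-- A curve with nowhere vanishing derivative. -/
def IsImmersedCurve (m : ℕ) {M : Type*} [TopologicalSpace M]
    [ChartedSpace (EuclideanSpace ℝ (Fin m)) M] (c : ℝ → M) : Prop :=
  ∀ t, ∃ x, c t ∈ (chartAt (EuclideanSpace ℝ (Fin m)) x).source ∧
    deriv (fun s ↦ chartAt (EuclideanSpace ℝ (Fin m)) x (c s)) t ≠ 0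

/-- A smoothly embedded circle, parametrized with period one. -/
structure IsEmbeddedLoop (m : ℕ) {M : Type*} [TopologicalSpace M]
    [ChartedSpace (EuclideanSpace ℝ (Fin m)) M] (c : C(ℝ, M)) : Prop extends
    IsSmoothLoop m c where
  immersed : IsImmersedCurve m c
  injective : ∀ s t, c s = c t → ∃ k : ℤ, s = t + k

lemma IsSmoothLoop.deriv_chartAt_add_int {c : C(ℝ, M)} (hc : IsSmoothLoop m c) (x : M) (t : ℝ)
    (k : ℤ) : deriv (fun s ↦ chartAt (EuclideanSpace ℝ (Fin m)) x (c s)) (t + k) =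
      deriv (fun s ↦ chartAt (EuclideanSpace ℝ (Fin m)) x (c s)) t := by
  rw [← deriv_comp_add_const (fun s ↦ chartAt (EuclideanSpace ℝ (Fin m)) x (c s))]
  simp only [hc.add_int]

lemma isImmersedCurve_of_forall_arc {c : C(ℝ, M)} (hc : IsSmoothLoop m c) {n : ℕ} (hn : 0 < n)
    {x : Fin n → M} (h : ∀ l, ∀ t ∈ Metric.closedBall (arcCenter n l) (arcRadius n),
      c t ∈ (chartAt (EuclideanSpace ℝ (Fin m)) (x l)).source ∧
        deriv (fun s ↦ chartAt (EuclideanSpace ℝ (Fin m)) (x l) (c s)) t ≠ 0) :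
    IsImmersedCurve m c := by
  intro t
  obtain ⟨k, l, hkl⟩ := exists_arc_mem hn t
  have hl := h l _ hkl
  rw [hc.add_int, hc.deriv_chartAt_add_int] at hl
  exact ⟨x l, hl⟩

lemma isChartBump_periodicBump {c : C(ℝ, M)} (hc : IsSmoothLoop m c) {x : M} {a r R : ℝ}
    (hr : 0 ≤ r) (hrR : r < R) (hR : R ≤ 1 / 2)
    (hx : ∀ t ∈ Metric.closedBall a R, c t ∈ (chartAt (EuclideanSpace ℝ (Fin m)) x).source) :
    IsChartBump (m := m) c x (periodicBump a r R) (periodicArc a R) where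
  smooth := contDiff_periodicBump
  periodic := periodic_periodicBump
  isClosed := isClosed_periodicArc
  add_int_mem _ ht k := add_int_mem_periodicArc ht k
  eq_zero _ ht := periodicBump_eq_zero_of_cos_le hr hrR hR (not_le.1 ht).le
  mem_source t ht := by
    obtain ⟨k, hk⟩ := exists_add_int_mem_closedBall (hr.trans hrR.le) hR ht
    simpa only [hc.add_int] using hx _ hk

lemma IsChartBump.mul {c : C(ℝ, M)} {x : M} {β σ : ℝ → ℝ} {T : Set ℝ}
    (h : IsChartBump (m := m) c x β T) (hσ : ContDiff ℝ ∞ σ) (hσp : Function.Periodic σ 1) :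
    IsChartBump (m := m) c x (fun t ↦ β t * σ t) T where
  smooth := h.smooth.mul hσ
  periodic := h.periodic.mul hσp
  isClosed := h.isClosed
  add_int_mem := h.add_int_mem
  eq_zero t ht := by rw [h.eq_zero t ht, zero_mul]
  mem_source := h.mem_source

lemma IsSmoothLoop.isCompact_range {c : C(ℝ, M)} (hc : IsSmoothLoop m c) :
    IsCompact (range c) := by
  rw [← hc.periodic.image_Icc one_pos 0]
  exact isCompact_Icc.image c.continuous

variable [IsManifold (𝓡 m) ∞ M]

lemma contDiffAt_chartAt_comp {c : ℝ → M} (hc : ContMDiff 𝓘(ℝ) (𝓡 m) ∞ c) {x : M} {t : ℝ}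
    (ht : c t ∈ (chartAt (EuclideanSpace ℝ (Fin m)) x).source) :
    ContDiffAt ℝ ∞ (fun s ↦ chartAt (EuclideanSpace ℝ (Fin m)) x (c s)) t :=
  ((contMDiffAt_chartAt ht).comp t (hc t)).contDiffAt

lemma dense_translate_ne (hm : 3 ≤ m) {c d : ℝ → M} (hc : ContMDiff 𝓘(ℝ) (𝓡 m) ∞ c)
    (hd : ContMDiff 𝓘(ℝ) (𝓡 m) ∞ d) (x : M) :
    Dense ({w | ∀ s t,
      c s ∈ (chartAt (EuclideanSpace ℝ (Fin m)) x).source →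
      d t ∈ (chartAt (EuclideanSpace ℝ (Fin m)) x).source →
      chartAt (EuclideanSpace ℝ (Fin m)) x (c s) + w ≠
        chartAt (EuclideanSpace ℝ (Fin m)) x (d t)} : Set (EuclideanSpace ℝ (Fin m))) := by
  set φ := chartAt (EuclideanSpace ℝ (Fin m)) x
  have hdiff : ∀ z ∈ ({z | c z.1 ∈ φ.source ∧ d z.2 ∈ φ.source} : Set (ℝ × ℝ)),
      ContDiffAt ℝ 1 (fun z ↦ φ (d z.2) - φ (c z.1)) z := fun z hz ↦
    (((contDiffAt_chartAt_comp hd hz.2).comp z contDiffAt_snd).sub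
      ((contDiffAt_chartAt_comp hc hz.1).comp z contDiffAt_fst)).of_le (by exact_mod_cast le_top)
  refine (dense_compl_image_of_contDiffAt (by simp; omega) hdiff).mono ?_
  intro w hw s t hs ht heq
  exact hw ⟨(s, t), ⟨hs, ht⟩, sub_eq_iff_eq_add'.2 heq.symm⟩

lemma dense_deriv_add_ne (hm : 2 ≤ m) {c : ℝ → M} (hc : ContMDiff 𝓘(ℝ) (𝓡 m) ∞ c) (x : M)
    {κ : ℝ → ℝ} (hκ : ContDiff ℝ ∞ κ) :
    Dense ({w | ∀ t,
      c t ∈ (chartAt (EuclideanSpace ℝ (Fin m)) x).source → κ t ≠ 0 →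
      deriv (fun s ↦ chartAt (EuclideanSpace ℝ (Fin m)) x (c s)) t + κ t • w ≠ 0} :
        Set (EuclideanSpace ℝ (Fin m))) := by
  set φ := chartAt (EuclideanSpace ℝ (Fin m)) x
  have hdiff : ∀ t ∈ {t | c t ∈ φ.source ∧ κ t ≠ 0},
      ContDiffAt ℝ 1 (fun t ↦ -((κ t)⁻¹ • deriv (fun s ↦ φ (c s)) t)) t := fun t ht ↦
    ((hκ.contDiffAt.inv ht.2).smul
      (contDiffAt_deriv (contDiffAt_chartAt_comp hc ht.1))).neg.of_le (by exact_mod_cast le_top)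
  refine (dense_compl_image_of_contDiffAt (by simp; omega) hdiff).mono ?_
  intro w hw t ht hκt heq
  refine hw ⟨t, ⟨ht, hκt⟩, ?_⟩
  dsimp only
  rw [eq_neg_of_add_eq_zero_left heq, smul_neg, neg_neg, smul_smul, inv_mul_cancel₀ hκt, one_smul]

variable {A : Type*} [AddCommGroup A] {Ψ : C(unitInterval, M) → A}

/- The weight is a bump times `sin (2 π (t - a))`, whose derivative does not vanish near `a`. -/
lemma exists_perturbation_immersed_on_arc (hm : 2 ≤ m) (hΨ : IsPathCocycle Ψ) {c : C(ℝ, M)}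
    (hc : IsSmoothLoop m c) {x : M} {a r R : ℝ} (hr : r < 1 / 4) (hr0 : 0 ≤ r) (hrR : r < R)
    (hR : R ≤ 1 / 2)
    (hx : ∀ t ∈ Metric.closedBall a R, c t ∈ (chartAt (EuclideanSpace ℝ (Fin m)) x).source)
    {G : Set (ℝ → M)} (hG : IsStable m G) (hcG : ⇑c ∈ G) :
    ∃ c' : C(ℝ, M), IsSmoothLoop m c' ∧ ⇑c' ∈ G ∧ Ψ (arc c' 0 1) = Ψ (arc c 0 1) ∧
      ∀ t ∈ Metric.closedBall a r, c' t ∈ (chartAt (EuclideanSpace ℝ (Fin m)) x).source ∧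
        deriv (fun s ↦ chartAt (EuclideanSpace ℝ (Fin m)) x (c' s)) t ≠ 0 := by
  set φ := chartAt (EuclideanSpace ℝ (Fin m)) x
  let σ : ℝ → ℝ := fun t ↦ Real.sin (2 * Real.pi * (t - a))
  let κ : ℝ → ℝ := fun t ↦ Real.cos (2 * Real.pi * (t - a)) * (2 * Real.pi)
  have hlin : ContDiff ℝ ∞ fun t : ℝ ↦ 2 * Real.pi * (t - a) := by fun_prop
  have hσ : ContDiff ℝ ∞ σ := Real.contDiff_sin.comp hlin
  have hκ : ContDiff ℝ ∞ κ := (Real.contDiff_cos.comp hlin).mul contDiff_const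
  have hbump := (isChartBump_periodicBump hc (r := (r + R) / 2) (by linarith) (by linarith) hR
    hx).mul hσ (periodic_sin_two_pi_mul_sub a)
  obtain ⟨c', hc', hc'G, hc'Ψ, -, w, hw, hc'w⟩ := hbump.exists_perturbation hΨ hc hG hcG
    (dense_deriv_add_ne hm hc.smooth x hκ)
  have hone : ∀ t ∈ Metric.ball a ((r + R) / 2), c' t ∈ φ.source ∧
      φ (c' t) = φ (c t) + σ t • w := fun t ht ↦ by
    have hbt := periodicBump_eq_one (by linarith) (by linarith) hR
      (Metric.ball_subset_closedBall ht)
    have htT : t ∈ periodicArc a R := mem_periodicArc_of_mem_closedBall (by linarith)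
      (by linarith) hR (Metric.ball_subset_closedBall ht)
    simpa only [hbt, one_mul] using hc'w t htT
  refine ⟨c', hc', hc'G, hc'Ψ, fun t ht ↦ ?_⟩
  have htball : t ∈ Metric.ball a ((r + R) / 2) :=
    Metric.closedBall_subset_ball (by linarith) ht
  have hct : c t ∈ φ.source := hx t (Metric.closedBall_subset_closedBall hrR.le ht)
  have hev : (fun s ↦ φ (c' s)) =ᶠ[𝓝 t] fun s ↦ φ (c s) + σ s • w := by
    filter_upwards [Metric.isOpen_ball.mem_nhds htball] with s hs using (hone s hs).2
  have hderiv : HasDerivAt (fun s ↦ φ (c s) + σ s • w)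
      (deriv (fun s ↦ φ (c s)) t + κ t • w) t :=
    ((contDiffAt_chartAt_comp hc.smooth hct).differentiableAt (by simp)).hasDerivAt.add
      ((hasDerivAt_sin_two_pi_mul_sub a t).smul_const w)
  refine ⟨(hone t htball).1, ?_⟩
  rw [hev.deriv_eq, hderiv.deriv]
  rw [Metric.mem_closedBall, Real.dist_eq] at ht
  exact hw t hct (mul_ne_zero (cos_two_pi_mul_pos (ht.trans_lt hr)).ne' (by positivity))

theorem exists_immersed (hm : 2 ≤ m) (hΨ : IsPathCocycle Ψ) {c₀ : C(ℝ, M)}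
    (hc₀ : IsSmoothLoop m c₀) :
    ∃ c : C(ℝ, M), IsSmoothLoop m c ∧ Ψ (arc c 0 1) = Ψ (arc c₀ 0 1) ∧ IsImmersedCurve m c := by
  obtain ⟨n, hn, hcov⟩ := exists_arc_cover
    (O := fun x : M ↦ c₀ ⁻¹' (chartAt (EuclideanSpace ℝ (Fin m)) x).source)
    (fun x ↦ (chartAt _ x).open_source.preimage c₀.continuous)
    (fun t ↦ ⟨c₀ t, mem_chart_source _ _⟩)
  choose x hx using hcov
  have hρ0 := arcRadius_pos hn
  have hρ := arcRadius_le hn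
  let G (l : Fin n) : Set (ℝ → M) := {c | ∀ t ∈ Metric.closedBall (arcCenter n l)
    (3 * arcRadius n), c t ∈ (chartAt (EuclideanSpace ℝ (Fin m)) (x l)).source}
  have hG : IsStable m (⋂ l, G l) := IsStable.iInter fun l ↦
    isStable_mem (isCompact_closedBall _ _) (chartAt _ (x l)).open_source
  obtain ⟨c, ⟨hc, hcΨ⟩, -, hcR⟩ := exists_forall_mem_of_isStable
    (P := fun c ↦ IsSmoothLoop m c ∧ Ψ (arc c 0 1) = Ψ (arc c₀ 0 1)) (G := ⋂ l, G l)
    (fun l ↦ isStable_deriv (isCompact_closedBall (arcCenter n l) (arcRadius n)) (x l)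
      isOpen_compl_singleton)
    (fun l G' hG' c hc hcG hcG' ↦ by
      obtain ⟨c', hc', hc'G, hc'Ψ, himm⟩ := exists_perturbation_immersed_on_arc hm hΨ hc.1
        (by linarith) hρ0.le (by linarith) (by linarith) (mem_iInter.1 hcG l) (hG.inter hG')
        ⟨hcG, hcG'⟩
      exact ⟨c', ⟨hc', hc'Ψ.trans hc.2⟩, hc'G, himm⟩)
    ⟨hc₀, rfl⟩ (mem_iInter.2 hx)
  exact ⟨c, hc, hcΨ, isImmersedCurve_of_forall_arc hc (by omega) hcR⟩

lemma exists_perturbation_disjoint_on_arc (hm : 3 ≤ m) (hΨ : IsPathCocycle Ψ) {c : C(ℝ, M)}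
    (hc : IsSmoothLoop m c) {x : M} {a r R : ℝ} (hr : 0 ≤ r) (hrR : r < R) (hR : R ≤ 1 / 2)
    (hx : ∀ t ∈ Metric.closedBall a R, c t ∈ (chartAt (EuclideanSpace ℝ (Fin m)) x).source)
    {G : Set (ℝ → M)} (hG : IsStable m G) (hcG : ⇑c ∈ G) {d : C(ℝ, M)}
    (hd : ContMDiff 𝓘(ℝ) (𝓡 m) ∞ d) :
    ∃ c' : C(ℝ, M), IsSmoothLoop m c' ∧ ⇑c' ∈ G ∧ Ψ (arc c' 0 1) = Ψ (arc c 0 1) ∧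
      (∀ t ∈ Icc (a + R) (a + 1 - R), c' t = c t) ∧
      ∀ s ∈ Metric.closedBall a r, ∀ t, c' s ≠ d t := by
  obtain ⟨c', hc', hc'G, hc'Ψ, hc'c, w, hw, hc'w⟩ :=
    (isChartBump_periodicBump hc hr hrR hR hx).exists_perturbation hΨ hc hG hcG
      (dense_translate_ne hm hc.smooth hd x)
  refine ⟨c', hc', hc'G, hc'Ψ,
    fun t ht ↦ hc'c t (periodicBump_eq_zero_of_mem_Icc hr hrR hR ht), fun s hs t heq ↦ ?_⟩
  have hbs := periodicBump_eq_one hr hrR hR hs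
  obtain ⟨hsource, hshift⟩ := hc'w s (mem_periodicArc_of_mem_closedBall hr hrR hR hs)
  rw [hbs, one_smul, heq] at hshift
  exact hw s t (hx s (Metric.closedBall_subset_closedBall hrR.le hs)) (heq ▸ hsource) hshift.symm

lemma exists_monotone_arc_cover {c : C(ℝ, M)} (hc : ContMDiff 𝓘(ℝ) (𝓡 m) ∞ c)
    (himm : IsImmersedCurve m c) :
    ∃ n : ℕ, 4 ≤ n ∧ ∃ (x : Fin n → M) (v : Fin n → EuclideanSpace ℝ (Fin m)),
      ∀ l, ∀ t ∈ Metric.closedBall (arcCenter n l) (3 * arcRadius n),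
        c t ∈ (chartAt (EuclideanSpace ℝ (Fin m)) (x l)).source ∧
          deriv (fun s ↦ chartAt (EuclideanSpace ℝ (Fin m)) (x l) (c s)) t ∈
            {z | 0 < inner ℝ (v l) z} := by
  obtain ⟨n, hn, hcov⟩ := exists_arc_cover
    (O := fun i : M × EuclideanSpace ℝ (Fin m) ↦ {t |
      c t ∈ (chartAt (EuclideanSpace ℝ (Fin m)) i.1).source ∧
      deriv (fun s ↦ chartAt (EuclideanSpace ℝ (Fin m)) i.1 (c s)) t ∈ {z | 0 < inner ℝ i.2 z}})
    (fun i ↦ by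
      rw [isOpen_iff_mem_nhds]
      rintro t ⟨hsource, hpos⟩
      have hO : IsOpen {z | 0 < inner ℝ i.2 z} := isOpen_lt continuous_const (by fun_prop)
      filter_upwards [c.continuous.continuousAt.eventually_mem
        ((chartAt (EuclideanSpace ℝ (Fin m)) i.1).open_source.mem_nhds hsource),
        (contDiffAt_deriv (contDiffAt_chartAt_comp hc hsource)).continuousAt.eventually_mem
          (hO.mem_nhds hpos)] with s hs hs' using ⟨hs, hs'⟩)
    (fun t ↦ by
      obtain ⟨x, hx, hne⟩ := himm t
      exact ⟨(x, deriv (fun s ↦ chartAt (EuclideanSpace ℝ (Fin m)) x (c s)) t), hx,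
        real_inner_self_pos.2 hne⟩)
  choose i hi using hcov
  exact ⟨n, hn, fun l ↦ (i l).1, fun l ↦ (i l).2, fun l t ht ↦ hi l ht⟩

lemma injOn_of_inner_deriv_pos {c : ℝ → M} (hc : ContMDiff 𝓘(ℝ) (𝓡 m) ∞ c) {x : M}
    {v : EuclideanSpace ℝ (Fin m)} {S : Set ℝ} (hS : Convex ℝ S)
    (h : ∀ t ∈ S, c t ∈ (chartAt (EuclideanSpace ℝ (Fin m)) x).source ∧
      0 < inner ℝ v (deriv (fun s ↦ chartAt (EuclideanSpace ℝ (Fin m)) x (c s)) t)) :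
    InjOn c S := by
  let f : ℝ → ℝ := fun t ↦ inner ℝ v (chartAt (EuclideanSpace ℝ (Fin m)) x (c t))
  have hf : ∀ t ∈ S, HasDerivAt f
      (inner ℝ v (deriv (fun s ↦ chartAt (EuclideanSpace ℝ (Fin m)) x (c s)) t)) t := fun t ht ↦
    (innerSL ℝ v).hasFDerivAt.comp_hasDerivAt t
      ((contDiffAt_chartAt_comp hc (h t ht).1).differentiableAt (by simp)).hasDerivAt
  have hmono : StrictMonoOn f S :=
    strictMonoOn_of_deriv_pos hS (fun t ht ↦ (hf t ht).continuousAt.continuousWithinAt)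
      fun t ht ↦ (hf t (interior_subset ht)).deriv ▸ (h t (interior_subset ht)).2
  exact fun s hs t ht hst ↦ hmono.injOn hs ht (by simp only [f, hst])

omit [IsManifold (𝓡 m) ∞ M] in
lemma IsSmoothLoop.exists_eq_add_int {c : C(ℝ, M)} (hc : IsSmoothLoop m c) {n : ℕ} (hn : 4 ≤ n)
    (hinj : ∀ l, InjOn c (Metric.closedBall (arcCenter n l) (3 * arcRadius n)))
    (hne : ∀ l, ∀ s ∈ Metric.closedBall (arcCenter n l) (arcRadius n),
      ∀ t ∈ Icc (arcCenter n l + 3 * arcRadius n) (arcCenter n l + 1 - 3 * arcRadius n),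
        c s ≠ c t) {s t : ℝ} (hst : c s = c t) : ∃ k : ℤ, s = t + k := by
  obtain ⟨k, l, hs⟩ := exists_arc_mem (show 0 < n by omega) s
  have hρ0 := arcRadius_pos hn
  set a := arcCenter n l
  set ρ := arcRadius n
  set j : ℤ := -⌊t - (a - 3 * ρ)⌋
  have hj : (j : ℝ) = -(⌊t - (a - 3 * ρ)⌋ : ℝ) := by simp [j]
  have hfloor_le := Int.floor_le (t - (a - 3 * ρ))
  have hlt_floor := Int.lt_floor_add_one (t - (a - 3 * ρ))
  have hst' : c (s + k) = c (t + j) := by rw [hc.add_int, hc.add_int, hst]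
  rcases le_total (t + j) (a + 3 * ρ) with h | h
  · have ht : t + j ∈ Metric.closedBall a (3 * ρ) := by
      rw [Metric.mem_closedBall, Real.dist_eq, abs_le]
      constructor <;> linarith
    have heq := hinj l (Metric.closedBall_subset_closedBall (by linarith) hs) ht hst'
    exact ⟨j - k, by push_cast; linarith⟩
  · exact absurd hst' (hne l _ hs _ ⟨h, by linarith⟩)

lemma IsSmoothLoop.isEmbeddedLoop {c : C(ℝ, M)} (hc : IsSmoothLoop m c) {n : ℕ} (hn : 4 ≤ n)
    {x : Fin n → M} {v : Fin n → EuclideanSpace ℝ (Fin m)}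
    (hxv : ∀ l, ∀ t ∈ Metric.closedBall (arcCenter n l) (3 * arcRadius n),
      c t ∈ (chartAt (EuclideanSpace ℝ (Fin m)) (x l)).source ∧
        deriv (fun s ↦ chartAt (EuclideanSpace ℝ (Fin m)) (x l) (c s)) t ∈
          {z | 0 < inner ℝ (v l) z})
    (hne : ∀ l, ∀ s ∈ Metric.closedBall (arcCenter n l) (arcRadius n),
      ∀ t ∈ Icc (arcCenter n l + 3 * arcRadius n) (arcCenter n l + 1 - 3 * arcRadius n),
        c s ≠ c t) : IsEmbeddedLoop m c where
  toIsSmoothLoop := hc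
  immersed := by
    refine isImmersedCurve_of_forall_arc (x := x) hc (show 0 < n by omega) fun l t ht ↦ ?_
    obtain ⟨hsource, hpos⟩ := hxv l t
      (Metric.closedBall_subset_closedBall (by linarith [arcRadius_pos hn]) ht)
    exact ⟨hsource, fun h0 ↦ by simp [h0] at hpos⟩
  injective _ _ hst := hc.exists_eq_add_int hn
    (fun l ↦ injOn_of_inner_deriv_pos hc.smooth (convex_closedBall _ _) (hxv l)) hne hst

/- Each arc of the loop is moved off the rest of the loop and off the loops `d j` in turn. It stays
injective on slightly longer arcs, since there its derivative keeps a positive component along a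
fixed vector. -/
theorem exists_embedded [T2Space M] (hm : 3 ≤ m) (hΨ : IsPathCocycle Ψ) {c₀ : C(ℝ, M)}
    (hc₀ : IsSmoothLoop m c₀) (himm : IsImmersedCurve m c₀) {κ : Type*} [Finite κ]
    (d : κ → C(ℝ, M)) (hd : ∀ j, IsSmoothLoop m (d j)) :
    ∃ c : C(ℝ, M), IsEmbeddedLoop m c ∧ Ψ (arc c 0 1) = Ψ (arc c₀ 0 1) ∧
      ∀ j s t, c s ≠ d j t := by
  obtain ⟨n, hn, x, v, hxv⟩ := exists_monotone_arc_cover hc₀.smooth himm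
  have hρ0 := arcRadius_pos hn
  have hρ := arcRadius_le hn
  set ρ := arcRadius n
  let B (l : Fin n) (r : ℝ) : Set ℝ := Metric.closedBall (arcCenter n l) r
  let G : Set (ℝ → M) := ⋂ l, {c | ∀ t ∈ B l (3 * ρ),
    c t ∈ (chartAt (EuclideanSpace ℝ (Fin m)) (x l)).source ∧
    deriv (fun s ↦ chartAt (EuclideanSpace ℝ (Fin m)) (x l) (c s)) t ∈ {z | 0 < inner ℝ (v l) z}}
  have hG : IsStable m G := IsStable.iInter fun l ↦
    isStable_deriv (isCompact_closedBall _ _) _ (isOpen_lt continuous_const (by fun_prop))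
  let R : Fin n × Option κ → Set (ℝ → M) := fun i ↦ i.2.elim
    {c | ∀ s ∈ B i.1 ρ, ∀ t ∈ Icc (arcCenter n i.1 + 3 * ρ) (arcCenter n i.1 + 1 - 3 * ρ),
      c s ≠ c t}
    fun j ↦ {c | ∀ s ∈ B i.1 ρ, c s ∈ (range (d j))ᶜ}
  have hR : ∀ i, IsStable m (R i) := by
    rintro ⟨l, _ | j⟩
    · exact isStable_ne (isCompact_closedBall _ _) isCompact_Icc
    · exact isStable_mem (isCompact_closedBall _ _)
        (hd j).isCompact_range.isClosed.isOpen_compl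
  obtain ⟨c, ⟨hc, hcΨ⟩, hcG, hcR⟩ := exists_forall_mem_of_isStable
    (P := fun c ↦ IsSmoothLoop m c ∧ Ψ (arc c 0 1) = Ψ (arc c₀ 0 1)) (G := G) hR
    (by
      rintro ⟨l, o⟩ G' hG' c ⟨hc, hcΨ⟩ hcG hcG'
      have hsmooth : IsSmoothLoop m (o.elim c d) := by
        cases o with
        | none => exact hc
        | some j => exact hd j
      obtain ⟨c', hc', hc'G, hc'Ψ, hc'c, hne⟩ := exists_perturbation_disjoint_on_arc hm hΨ hc
        hρ0.le (by linarith) (by linarith) (fun t ht ↦ (mem_iInter.1 hcG l t ht).1)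
        (hG.inter hG') ⟨hcG, hcG'⟩ hsmooth.smooth
      refine ⟨c', ⟨hc', hc'Ψ.trans hcΨ⟩, hc'G, ?_⟩
      cases o with
      | none => exact fun s hs t ht ↦ (hc'c t ht).symm ▸ hne s hs t
      | some j => exact fun s hs ⟨t, ht⟩ ↦ hne s hs t ht.symm)
    ⟨hc₀, rfl⟩ (mem_iInter.2 hxv)
  refine ⟨c, hc.isEmbeddedLoop hn (mem_iInter.1 hcG) fun l ↦ hcR (l, none), hcΨ,
    fun j s t hst ↦ ?_⟩
  obtain ⟨k, l, hs⟩ := exists_arc_mem (show 0 < n by omega) s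
  exact hcR (l, some j) _ hs ⟨t, by rw [hc.add_int, hst]⟩

theorem exists_disjoint_embedded [T2Space M] (hm : 3 ≤ m) (hΨ : IsPathCocycle Ψ) {ι : Type*}
    [Finite ι] {x : M} (p : ι → Path x x) :
    ∃ γ : ι → C(ℝ, M), (∀ i, IsEmbeddedLoop m (γ i)) ∧
      (∀ i, Ψ (arc (γ i) 0 1) = Ψ (p i).toContinuousMap) ∧
      ∀ i j, i ≠ j → ∀ s t, γ i s ≠ γ j t := by
  induction ι using Finite.induction_empty_option with
  | of_equiv e ih =>
    obtain ⟨γ, hγ, hγΨ, hdisj⟩ := ih (p ∘ e)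
    exact ⟨γ ∘ e.symm, fun i ↦ hγ _, fun i ↦ by simp [hγΨ],
      fun i j hij ↦ hdisj _ _ (e.symm.injective.ne hij)⟩
  | h_empty => exact ⟨fun i ↦ i.elim, fun i ↦ i.elim, fun i ↦ i.elim, fun i ↦ i.elim⟩
  | h_option ih =>
    obtain ⟨γ, hγ, hγΨ, hdisj⟩ := ih (p ∘ some)
    obtain ⟨c, hc, hcp, hcΨ⟩ := exists_periodic_of_loop (m := m) hΨ (p none)
    obtain ⟨c', hc', hc'Ψ, himm⟩ := exists_immersed (by omega) hΨ ⟨hc, hcp⟩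
    obtain ⟨e, he, heΨ, hed⟩ := exists_embedded hm hΨ hc' himm γ fun j ↦ (hγ j).toIsSmoothLoop
    refine ⟨fun i ↦ i.elim e γ, ?_, ?_, ?_⟩
    · rintro (_ | i)
      exacts [he, hγ i]
    · rintro (_ | i)
      exacts [heΨ.trans (hc'Ψ.trans hcΨ), hγΨ i]
    · rintro (_ | i) (_ | j) hij s t
      · exact absurd rfl hij
      · exact hed j s t
      · exact (hed i t s).symm
      · exact hdisj i j (fun h ↦ hij (congrArg some h)) s t

end GeneralPosition

/-! ### The metric in charts -/

section RiemannianMetric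

variable {EB HB B F : Type*} [NormedAddCommGroup EB]
  [NormedSpace ℝ EB] [TopologicalSpace HB] {IB : ModelWithCorners ℝ EB HB} {n : ℕ∞ω}
  [TopologicalSpace B] [ChartedSpace HB B] [NormedAddCommGroup F] [NormedSpace ℝ F]
  {V : B → Type*} [TopologicalSpace (TotalSpace F V)] [∀ b, TopologicalSpace (V b)]
  [∀ b, AddCommGroup (V b)] [∀ b, Module ℝ (V b)] [FiberBundle F V] [VectorBundle ℝ F V]

lemma contMDiffAt_riemannianMetric_inner
    (g : ContMDiffRiemannianMetric IB n F V) {X Y : ∀ x, V x} {x : B}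
    (hX : ContMDiffAt IB (IB.prod 𝓘(ℝ, F)) n (fun b ↦ TotalSpace.mk' F b (X b)) x)
    (hY : ContMDiffAt IB (IB.prod 𝓘(ℝ, F)) n (fun b ↦ TotalSpace.mk' F b (Y b)) x) :
    ContMDiffAt IB 𝓘(ℝ) n (fun b ↦ g.inner b (X b) (Y b)) x := by
  have h : ContMDiffAt IB (IB.prod 𝓘(ℝ)) n
      (fun b ↦ TotalSpace.mk' ℝ (E := Bundle.Trivial B ℝ) b (g.inner b (X b) (Y b))) x :=
    ContMDiffAt.clm_bundle_apply₂ (F₁ := F) (F₂ := F) (g.contMDiff x) hX hY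
  exact (contMDiffAt_totalSpace.1 h).2

/-- A Riemannian metric multiplied by a positive smooth function. -/
def conformalMetric [∀ b, IsTopologicalAddGroup (V b)]
    [∀ b, ContinuousConstSMul ℝ (V b)] (g : ContMDiffRiemannianMetric IB n F V) (f : B → ℝ)
    (hf : ContMDiff IB 𝓘(ℝ) n f) (hpos : ∀ x, 0 < f x) : ContMDiffRiemannianMetric IB n F V where
  inner b := f b • g.inner b
  symm b v w := by simp [g.symm b v w]
  pos b v hv := by simpa using mul_pos (hpos b) (g.pos b v hv)
  isVonNBounded b := by
    refine ((g.isVonNBounded b).image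
      ((Real.sqrt (f b))⁻¹ • ContinuousLinearMap.id ℝ (V b))).subset fun v hv ↦ ?_
    refine (Set.mem_image _ _ _).2 ⟨Real.sqrt (f b) • v, ?_, ?_⟩
    · simp only [map_smul, smul_apply, smul_eq_mul, mem_ofPred_eq]
      rw [← mul_assoc, Real.mul_self_sqrt (hpos b).le]
      exact hv
    · simp [smul_smul, (Real.sqrt_pos.2 (hpos b)).ne']
  contMDiff := hf.smul_section g.contMDiff

end RiemannianMetric

section ChartMetric

variable {m : ℕ} {M : Type*} [TopologicalSpace M] [ChartedSpace (EuclideanSpace ℝ (Fin m)) M]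
  [IsManifold (𝓡 m) ∞ M]

variable (m) in
/-- The differential of the preferred chart at `x`, at the point `y`. -/
def chartDeriv (x y : M) : TangentSpace (𝓡 m) y →L[ℝ] EuclideanSpace ℝ (Fin m) :=
  mfderiv (𝓡 m) 𝓘(ℝ, EuclideanSpace ℝ (Fin m)) (chartAt (EuclideanSpace ℝ (Fin m)) x) y

lemma hasMFDerivAt_chartAt {x y : M}
    (hy : y ∈ (chartAt (EuclideanSpace ℝ (Fin m)) x).source) :
    HasMFDerivAt (𝓡 m) 𝓘(ℝ, EuclideanSpace ℝ (Fin m))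
      (chartAt (EuclideanSpace ℝ (Fin m)) x) y (chartDeriv m x y) :=
  ((contMDiffAt_chartAt hy).mdifferentiableAt (by simp)).hasMFDerivAt

lemma chartDeriv_isInvertible {x y : M}
    (hy : y ∈ (chartAt (EuclideanSpace ℝ (Fin m)) x).source) : (chartDeriv m x y).IsInvertible :=
  isInvertible_mfderiv_extChartAt (I := 𝓡 m) (x := x) (by simpa using hy)

lemma chartDeriv_surjective {x y : M}
    (hy : y ∈ (chartAt (EuclideanSpace ℝ (Fin m)) x).source) :
    Function.Surjective (chartDeriv m x y) := (chartDeriv_isInvertible hy).surjective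

variable (m) in
/-- The coordinate vector field `∂ᵢ` of the preferred chart at `x`, at the point `y`. -/
def chartFrame (x : M) (i : Fin m) (y : M) : TangentSpace (𝓡 m) y :=
  (trivializationAt (EuclideanSpace ℝ (Fin m)) (TangentSpace (𝓡 m)) x).symmL ℝ y
    (EuclideanSpace.single i 1)

lemma contMDiffAt_chartFrame (x : M) (i : Fin m) {y : M}
    (hy : y ∈ (chartAt (EuclideanSpace ℝ (Fin m)) x).source) :
    ContMDiffAt (𝓡 m) ((𝓡 m).prod 𝓘(ℝ, EuclideanSpace ℝ (Fin m))) ∞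
      (fun b ↦ TotalSpace.mk' (EuclideanSpace ℝ (Fin m)) b (chartFrame m x i b)) y := by
  let e := trivializationAt (EuclideanSpace ℝ (Fin m)) (TangentSpace (𝓡 m) (M := M)) x
  let v : EuclideanSpace ℝ (Fin m) := EuclideanSpace.single i 1
  have hmem : (y, v) ∈ e.target := e.mem_target.2 hy
  have hsymm : ContMDiffAt _ _ ∞ e.toOpenPartialHomeomorph.symm (y, v) :=
    (e.contMDiffOn_symm (n := ∞) (IB := 𝓡 m)).contMDiffAt (e.open_target.mem_nhds hmem)
  refine (hsymm.comp y (contMDiffAt_id.prodMk contMDiffAt_const)).congr_of_eventuallyEq ?_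
  filter_upwards [(chartAt (EuclideanSpace ℝ (Fin m)) x).open_source.mem_nhds hy] with b hb
  have hb : b ∈ e.baseSet := hb
  change TotalSpace.mk' _ b (e.symmL ℝ b v) = e.toOpenPartialHomeomorph.symm (b, v)
  rw [Trivialization.symmL_apply _ hb]
  exact Trivialization.mk_symm _ hb v

lemma sum_chartDeriv_smul_chartFrame (x : M) {y : M}
    (hy : y ∈ (chartAt (EuclideanSpace ℝ (Fin m)) x).source) (v : TangentSpace (𝓡 m) y) :
    ∑ i, chartDeriv m x y v i • chartFrame m x i y = v := by
  let e := trivializationAt (EuclideanSpace ℝ (Fin m)) (TangentSpace (𝓡 m)) x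
  have hchart : e.continuousLinearMapAt ℝ y = chartDeriv m x y :=
    TangentBundle.continuousLinearMapAt_trivializationAt (I := 𝓡 m) (x₀ := x) hy
  have hsymm : e.symmL ℝ y (chartDeriv m x y v) = v :=
    hchart ▸ e.symmL_continuousLinearMapAt (R := ℝ) hy v
  have hsum : chartDeriv m x y v =
      ∑ i, chartDeriv m x y v i • EuclideanSpace.single i (1 : ℝ) := by
    ext k
    simp [Pi.single_apply]
  conv_rhs => rw [← hsymm, hsum, map_sum]
  exact Finset.sum_congr rfl fun i _ ↦ ((e.symmL ℝ y).map_smul _ _).symm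

theorem SmoothMetric.exists_chart_form (g : SmoothMetric m M) (x : M) :
    ∃ G : M → EuclideanSpace ℝ (Fin m) →L[ℝ] EuclideanSpace ℝ (Fin m) →L[ℝ] ℝ,
      ∀ y ∈ (chartAt (EuclideanSpace ℝ (Fin m)) x).source,
        ContMDiffAt (𝓡 m) 𝓘(ℝ, EuclideanSpace ℝ (Fin m) →L[ℝ] EuclideanSpace ℝ (Fin m) →L[ℝ] ℝ) ∞
          G y ∧
        ∀ v w : TangentSpace (𝓡 m) y,
          g.inner y v w = G y (chartDeriv m x y v) (chartDeriv m x y w) := by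
  let B (i j : Fin m) : EuclideanSpace ℝ (Fin m) →L[ℝ] EuclideanSpace ℝ (Fin m) →L[ℝ] ℝ :=
    (EuclideanSpace.proj i : EuclideanSpace ℝ (Fin m) →L[ℝ] ℝ).smulRight
      (EuclideanSpace.proj j : EuclideanSpace ℝ (Fin m) →L[ℝ] ℝ)
  refine ⟨fun y ↦ ∑ i, ∑ j, g.inner y (chartFrame m x i y) (chartFrame m x j y) • B i j,
    fun y hy ↦ ⟨?_, fun v w ↦ ?_⟩⟩
  · refine contMDiffAt_finsetSum fun i _ ↦ contMDiffAt_finsetSum fun j _ ↦ ?_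
    exact (contMDiffAt_riemannianMetric_inner g (contMDiffAt_chartFrame x i hy)
      (contMDiffAt_chartFrame x j hy)).smul contMDiffAt_const
  · conv_lhs =>
      rw [← sum_chartDeriv_smul_chartFrame x hy v, ← sum_chartDeriv_smul_chartFrame x hy w]
    simp only [map_sum, map_smul, sum_apply, smul_apply,
      smul_eq_mul, B, ContinuousLinearMap.smulRight_apply, Finset.mul_sum]
    rw [Finset.sum_comm]
    refine Finset.sum_congr rfl fun i _ ↦ Finset.sum_congr rfl fun j _ ↦ ?_
    change _ = g.inner y (chartFrame m x i y) (chartFrame m x j y) *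
      (chartDeriv m x y v i * chartDeriv m x y w j)
    ring

end ChartMetric

/-! ### A time function near an embedded curve -/

section TimeFunction

variable {E : Type*} [NormedAddCommGroup E] [NormedSpace ℝ E] {c : ℝ → E} {t₀ : ℝ}

lemma exists_contDiffAt_symm_of_deriv_ne_zero {φ : ℝ → ℝ}
    (hφ : ∀ᶠ t in 𝓝 t₀, ContDiffAt ℝ ∞ φ t) (hne : deriv φ t₀ ≠ 0) :
    ∃ ψ : ℝ → ℝ, (∀ᶠ s in 𝓝 (φ t₀), ContDiffAt ℝ ∞ ψ s) ∧ ∀ᶠ t in 𝓝 t₀, ψ (φ t) = t := by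
  have hderiv {t} (ht : ContDiffAt ℝ ∞ φ t) : HasDerivAt φ (deriv φ t) t :=
    (ht.differentiableAt (by simp)).hasDerivAt
  have hne : ∀ᶠ t in 𝓝 t₀, deriv φ t ≠ 0 :=
    (contDiffAt_deriv hφ.self_of_nhds).continuousAt.eventually_ne hne
  have hstrict := hφ.self_of_nhds.hasStrictDerivAt' (hderiv hφ.self_of_nhds) (by simp)
  let e := (hstrict.hasStrictFDerivAt_equiv hne.self_of_nhds).toOpenPartialHomeomorph _
  have hes : t₀ ∈ e.source := HasStrictFDerivAt.mem_toOpenPartialHomeomorph_source _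
  have hsymm : Tendsto e.symm (𝓝 (e t₀)) (𝓝 t₀) := by
    have h := e.continuousAt_symm (e.map_source hes)
    rwa [ContinuousAt, e.left_inv hes] at h
  refine ⟨e.symm, ?_, ?_⟩
  · filter_upwards [hsymm.eventually hφ, hsymm.eventually hne,
      e.open_target.mem_nhds (e.map_source hes)] with s hs hs0 hst
    exact e.contDiffAt_symm_deriv hs0 hst (hderiv hs) hs
  · filter_upwards [e.open_source.mem_nhds hes] with t ht using e.left_inv ht

lemma exists_contDiffAt_leftInverse {l : E →L[ℝ] ℝ} (hc : ∀ᶠ t in 𝓝 t₀, ContDiffAt ℝ ∞ c t)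
    (hl : l (deriv c t₀) ≠ 0) :
    ∃ τ : E → ℝ, (∀ᶠ z in 𝓝 (c t₀), ContDiffAt ℝ ∞ τ z) ∧ ∀ᶠ t in 𝓝 t₀, τ (c t) = t := by
  have hderiv : deriv (fun t ↦ l (c t)) t₀ = l (deriv c t₀) :=
    (l.hasFDerivAt.comp_hasDerivAt t₀
      (hc.self_of_nhds.differentiableAt (by simp)).hasDerivAt).deriv
  obtain ⟨ψ, hψ, hψc⟩ := exists_contDiffAt_symm_of_deriv_ne_zero (φ := fun t ↦ l (c t))
    (hc.mono fun t ht ↦ l.contDiff.contDiffAt.comp t ht) (hderiv ▸ hl)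
  refine ⟨fun z ↦ ψ (l z), ?_, hψc⟩
  filter_upwards [l.continuous.continuousAt.eventually hψ] with z hz
  exact hz.comp z l.contDiff.contDiffAt

/-- Adding to `τ z` the value at `z - c (τ z)` of a form annihilating `c'` up to first order
changes the differential of `τ` along the curve without changing its values there. -/
lemma fderiv_leftInverse_add_apply_sub {L : ℝ → E →L[ℝ] ℝ} {τ : E → ℝ} {t : ℝ}
    (hτ : DifferentiableAt ℝ τ (c t)) (hτc : τ (c t) = t) (hc : DifferentiableAt ℝ c t)
    (hL : DifferentiableAt ℝ L t) (hLc : L t (deriv c t) = 1) :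
    fderiv ℝ (fun z ↦ τ z + L (τ z) (z - c (τ z))) (c t) = L t := by
  have hcτ : HasFDerivAt (fun z ↦ c (τ z))
      ((ContinuousLinearMap.toSpanSingleton ℝ (deriv c t)).comp (fderiv ℝ τ (c t))) (c t) :=
    HasFDerivAt.comp (c t) (hτc.symm ▸ hc.hasDerivAt.hasFDerivAt) hτ.hasFDerivAt
  have hLτ : HasFDerivAt (fun z ↦ L (τ z)) ((fderiv ℝ L t).comp (fderiv ℝ τ (c t))) (c t) :=
    HasFDerivAt.comp (c t) (hτc.symm ▸ hL.hasFDerivAt) hτ.hasFDerivAt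
  refine (hτ.hasFDerivAt.add (hLτ.clm_apply ((hasFDerivAt_id (c t)).sub hcτ))).fderiv.trans ?_
  ext v
  simp [hτc, hLc]

theorem exists_time_function {L : ℝ → E →L[ℝ] ℝ}
    (hc : ∀ᶠ t in 𝓝 t₀, ContDiffAt ℝ ∞ c t) (hL : ∀ᶠ t in 𝓝 t₀, ContDiffAt ℝ ∞ L t)
    (hLc : ∀ᶠ t in 𝓝 t₀, L t (deriv c t) = 1) :
    ∃ h : E → ℝ, (∀ᶠ z in 𝓝 (c t₀), ContDiffAt ℝ ∞ h z) ∧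
      ∀ᶠ t in 𝓝 t₀, h (c t) = t ∧ fderiv ℝ h (c t) = L t := by
  obtain ⟨τ, hτ, hτc⟩ := exists_contDiffAt_leftInverse (l := L t₀) hc
    (by rw [hLc.self_of_nhds]; exact one_ne_zero)
  have hτt : Tendsto τ (𝓝 (c t₀)) (𝓝 t₀) := by
    simpa only [ContinuousAt, hτc.self_of_nhds] using hτ.self_of_nhds.continuousAt
  refine ⟨fun z ↦ τ z + L (τ z) (z - c (τ z)), ?_, ?_⟩
  · filter_upwards [hτ, hτt.eventually hc, hτt.eventually hL] with z hz hcz hLz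
    exact hz.add ((hLz.comp z hz).clm_apply (contDiffAt_id.sub (hcz.comp z hz)))
  · filter_upwards [hτc, hc.self_of_nhds.continuousAt.eventually hτ, hc, hL, hLc]
      with t ht hτt hct hLt hLct
    exact ⟨by simp [ht], fderiv_leftInverse_add_apply_sub (hτt.differentiableAt (by simp)) ht
      (hct.differentiableAt (by simp)) (hLt.differentiableAt (by simp)) hLct⟩

end TimeFunction

/-! ### Local primitives of a path cocycle -/

section Primitive

variable {m : ℕ} {M : Type*} [TopologicalSpace M] {V : Type*} [AddCommGroup V]
  {Ψ : C(unitInterval, M) → V} {k k' : M → V} {x : M}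

/-- `k` is a primitive of the path cocycle `Ψ` near `x`. -/
def IsPrimitiveAt (Ψ : C(unitInterval, M) → V) (k : M → V) (x : M) : Prop :=
  ∃ U ∈ 𝓝 x, ∀ p : C(unitInterval, M), (∀ t, p t ∈ U) → Ψ p = k (p 1) - k (p 0)

lemma IsPrimitiveAt.eventually (hk : IsPrimitiveAt Ψ k x) :
    ∀ᶠ y in 𝓝 x, IsPrimitiveAt Ψ k y := by
  obtain ⟨U, hU, h⟩ := hk
  filter_upwards [eventually_mem_nhds_iff.2 hU] with y hy using ⟨U, hy, h⟩

lemma IsPrimitiveAt.sub_const (hk : IsPrimitiveAt Ψ k x) (v : V) :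
    IsPrimitiveAt Ψ (fun y ↦ k y - v) x := by
  obtain ⟨U, hU, h⟩ := hk
  exact ⟨U, hU, fun p hp ↦ by simp [h p hp]⟩

lemma IsPrimitiveAt.arc_eq {c : C(ℝ, M)} {t₀ : ℝ} (hk : IsPrimitiveAt Ψ k (c t₀)) :
    ∀ᶠ t in 𝓝 t₀, Ψ (arc c t₀ t) = k (c t) - k (c t₀) := by
  obtain ⟨U, hU, h⟩ := hk
  obtain ⟨r, hr, hrU⟩ := Metric.mem_nhds_iff.1 (c.continuous.continuousAt.preimage_mem_nhds hU)
  filter_upwards [Metric.ball_mem_nhds t₀ hr] with t ht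
  rw [h]
  · simp [arc_apply]
  · intro s
    rw [arc_apply]
    refine hrU ((convex_ball t₀ r) (Metric.mem_ball_self hr) ht (sub_nonneg.2 s.2.2) s.2.1 ?_)
    ring

variable [ChartedSpace (EuclideanSpace ℝ (Fin m)) M]

lemma IsChartConvex.exists_path {U : Set M} {x : M} {B : Set (EuclideanSpace ℝ (Fin m))}
    (hU : IsChartConvex m U x B) {y z : M} (hy : y ∈ U) (hz : z ∈ U) :
    ∃ p : Path y z, ∀ t, p t ∈ U := by
  set φ := chartAt (EuclideanSpace ℝ (Fin m)) x
  obtain ⟨hyφ, hyB⟩ := hU.eq ▸ hy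
  obtain ⟨hzφ, hzB⟩ := hU.eq ▸ hz
  let K : unitInterval → EuclideanSpace ℝ (Fin m) := fun t ↦ (1 - (t : ℝ)) • φ y + (t : ℝ) • φ z
  have hK : Continuous K := by fun_prop
  have hKB : ∀ t, K t ∈ B := fun t ↦
    hU.convex hyB hzB (sub_nonneg.2 t.2.2) t.2.1 (by ring)
  refine ⟨⟨⟨fun t ↦ φ.symm (K t),
    φ.continuousOn_symm.comp_continuous hK fun z ↦ hU.subset (hKB z)⟩, ?_, ?_⟩, fun t ↦
    hU.symm_mem (hKB t)⟩
  · simp [K, φ.left_inv hyφ]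
  · simp [K, φ.left_inv hzφ]

lemma IsPathCocycle.exists_isPrimitiveAt (m : ℕ) [ChartedSpace (EuclideanSpace ℝ (Fin m)) M]
    (hΨ : IsPathCocycle Ψ) (x : M) : ∃ k : M → V, IsPrimitiveAt Ψ k x := by
  classical
  obtain ⟨U, B, hU, hxU, -⟩ := exists_isChartConvex m x univ_mem
  choose p hp using fun (y : M) (hy : y ∈ U) ↦ hU.exists_path hxU hy
  refine ⟨fun y ↦ if hy : y ∈ U then Ψ (p y hy).toContinuousMap else 0, U,
    hU.isOpen_set.mem_nhds hxU, fun q hq ↦ ?_⟩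
  let q' : Path (q 0) (q 1) := ⟨q, rfl, rfl⟩
  have htrans : ∀ t, (p (q 0) (hq 0)).trans q' t ∈ U := by
    rw [← range_subset_iff, Path.trans_range]
    exact union_subset (range_subset_iff.2 (hp _ (hq 0))) (range_subset_iff.2 hq)
  simp only [hq, dite_true]
  rw [eq_sub_iff_add_eq, add_comm]
  exact (hΨ.trans (p (q 0) (hq 0)) q').symm.trans
    (hΨ.eq_of_isChartConvex hU htrans (hp _ (hq 1)) (by simp) (by simp))

lemma IsPrimitiveAt.sub_eq_sub (m : ℕ) [ChartedSpace (EuclideanSpace ℝ (Fin m)) M]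
    (hk : IsPrimitiveAt Ψ k x)
    (hk' : IsPrimitiveAt Ψ k' x) : ∀ᶠ y in 𝓝 x, k y - k x = k' y - k' x := by
  obtain ⟨W, hW, h⟩ := hk
  obtain ⟨W', hW', h'⟩ := hk'
  obtain ⟨U, B, hU, hxU, hUW⟩ := exists_isChartConvex m x (inter_mem hW hW')
  filter_upwards [hU.isOpen_set.mem_nhds hxU] with y hy
  obtain ⟨p, hp⟩ := hU.exists_path hxU hy
  simpa using (h p.toContinuousMap fun t ↦ (hUW (hp t)).1).symm.trans
    (h' p.toContinuousMap fun t ↦ (hUW (hp t)).2)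

end Primitive

/-! ### Position of finitely many disjoint embedded curves -/

section Curves

variable {m : ℕ} {M : Type*} [TopologicalSpace M] [T2Space M]
  [ChartedSpace (EuclideanSpace ℝ (Fin m)) M] {ι : Type*} [Finite ι] {γ : ι → C(ℝ, M)}

lemma IsSmoothLoop.eventually_forall_ne {c : C(ℝ, M)} (hc : IsSmoothLoop m c) {x : M}
    (hx : ∀ t, c t ≠ x) : ∀ᶠ y in 𝓝 x, ∀ t, c t ≠ y := by
  have hclosed : IsClosed (range c) :=
    (hc.periodic.compact_of_continuous one_ne_zero c.continuous).isClosed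
  filter_upwards [hclosed.isOpen_compl.mem_nhds fun ⟨t, ht⟩ ↦ hx t ht] with y hy t ht
  exact hy ⟨t, ht⟩

lemma IsEmbeddedLoop.eventually_exists_add_int_mem {c : C(ℝ, M)} (hc : IsEmbeddedLoop m c)
    {t₀ : ℝ} {S : Set ℝ} (hS : S ∈ 𝓝 t₀) :
    ∀ᶠ y in 𝓝 (c t₀), ∀ t, c t = y → ∃ n : ℤ, t + n ∈ S := by
  let T : Set ℝ := ⋂ n : ℤ, (fun t : ℝ ↦ t + n) ⁻¹' (interior S)ᶜ
  have hT : IsClosed T := isClosed_iInter fun n ↦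
    isOpen_interior.isClosed_compl.preimage (by fun_prop)
  have hclosed : IsClosed (c '' (Icc 0 1 ∩ T)) :=
    ((isCompact_Icc.inter_right hT).image c.continuous).isClosed
  have ht₀ : c t₀ ∉ c '' (Icc 0 1 ∩ T) := by
    rintro ⟨s, ⟨-, hsT⟩, hs⟩
    obtain ⟨n, hn⟩ := hc.injective _ _ hs.symm
    exact mem_iInter.1 hsT n (show s + n ∈ interior S from hn ▸ mem_interior_iff_mem_nhds.2 hS)
  filter_upwards [hclosed.isOpen_compl.mem_nhds ht₀] with y hy t ht
  by_contra! hn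
  refine hy ⟨Int.fract t, ⟨⟨Int.fract_nonneg t, (Int.fract_lt_one t).le⟩,
    mem_iInter.2 fun n h ↦ hn (n - ⌊t⌋) (interior_subset ?_)⟩, ?_⟩
  · have heq : t + ((n - ⌊t⌋ : ℤ) : ℝ) = Int.fract t + n := by
      push_cast
      rw [Int.fract]
      ring
    rwa [heq]
  · rw [← ht, ← hc.add_int (Int.fract t) ⌊t⌋, Int.fract_add_floor]

lemma eventually_forall_ne_curve (hγ : ∀ i, IsEmbeddedLoop m (γ i)) {x : M}
    (hx : ∀ i t, γ i t ≠ x) : ∀ᶠ y in 𝓝 x, ∀ i t, γ i t ≠ y :=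
  eventually_all.2 fun i ↦ (hγ i).eventually_forall_ne (hx i)

lemma eventually_curve_eq (hγ : ∀ i, IsEmbeddedLoop m (γ i))
    (hdisj : ∀ i j, i ≠ j → ∀ s t, γ i s ≠ γ j t) (i : ι) (t₀ : ℝ) {S : Set ℝ} (hS : S ∈ 𝓝 t₀) :
    ∀ᶠ y in 𝓝 (γ i t₀), ∀ j t, γ j t = y → j = i ∧ ∃ n : ℤ, t + n ∈ S := by
  refine eventually_all.2 fun j ↦ ?_
  rcases eq_or_ne j i with rfl | hji
  · simpa using (hγ j).eventually_exists_add_int_mem hS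
  · filter_upwards [(hγ j).eventually_forall_ne fun t ↦ hdisj j i hji t t₀] with y hy t ht
    exact (hy t ht).elim

end Curves

/-! ### Differentials of functions and velocities of curves -/

section Differential

variable {m : ℕ} {M : Type*} [TopologicalSpace M] [ChartedSpace (EuclideanSpace ℝ (Fin m)) M]
  {W : Type*} [NormedAddCommGroup W] [NormedSpace ℝ W] {f f' : M → W} {x y : M}

variable (m) in
/-- The differential of a vector-valued function on a manifold. -/
def mdiff (f : M → W) (y : M) : TangentSpace (𝓡 m) y →L[ℝ] W :=
  mfderiv (𝓡 m) 𝓘(ℝ, W) f y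

variable (m) in
/-- The velocity of a curve. -/
def velocity (c : ℝ → M) (t : ℝ) : TangentSpace (𝓡 m) (c t) :=
  mfderiv 𝓘(ℝ) (𝓡 m) c t (1 : ℝ)

lemma velocity_comp_add {c : ℝ → M} {t a : ℝ} (hc : MDifferentiableAt 𝓘(ℝ) (𝓡 m) c (t + a)) :
    velocity m (fun s ↦ c (s + a)) t = velocity m c (t + a) := by
  have hadd : HasMFDerivAt 𝓘(ℝ) 𝓘(ℝ) (fun s : ℝ ↦ s + a) t (ContinuousLinearMap.id ℝ ℝ) :=
    ((hasFDerivAt_id t).add_const a).hasMFDerivAt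
  exact congrArg (fun L ↦ L (1 : ℝ))
    (HasMFDerivAt.comp (f := fun s : ℝ ↦ s + a) t hc.hasMFDerivAt hadd).mfderiv

lemma mdiff_congr (h : f =ᶠ[𝓝 y] f') : mdiff m f y = mdiff m f' y := h.mfderiv_eq

lemma mdiff_eq_of_eq_add_const {a : W} (hf : MDifferentiableAt (𝓡 m) 𝓘(ℝ, W) f y)
    (h : ∀ᶠ z in 𝓝 y, f' z = f z + a) : mdiff m f' y = mdiff m f y := by
  rw [mdiff_congr h]
  exact (hf.hasMFDerivAt.add (hasMFDerivAt_const a y)).mfderiv.trans (add_zero _)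

/-- `HasMFDerivAt.sum` without its restriction to index types in `Type`. -/
lemma hasMFDerivAt_finset_sum {β : Type*} {T : Finset β} {φ : β → M → W}
    {φ' : β → TangentSpace (𝓡 m) y →L[ℝ] W}
    (h : ∀ b ∈ T, HasMFDerivAt (𝓡 m) 𝓘(ℝ, W) (φ b) y (φ' b)) :
    HasMFDerivAt (𝓡 m) 𝓘(ℝ, W) (fun z ↦ ∑ b ∈ T, φ b z) y (∑ b ∈ T, φ' b) :=
  ⟨tendsto_finsetSum T fun b hb ↦ (h b hb).1, HasFDerivWithinAt.fun_sum fun b hb ↦ (h b hb).2⟩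

lemma mdiff_sum_mul {β : Type*} {T : Finset β} {χ θ : β → M → ℝ} {a : ℝ}
    (hχ : ∀ b ∈ T, MDifferentiableAt (𝓡 m) 𝓘(ℝ) (χ b) y)
    (hθ : ∀ b ∈ T, MDifferentiableAt (𝓡 m) 𝓘(ℝ) (θ b) y)
    (hsum : ∀ᶠ z in 𝓝 y, ∑ b ∈ T, χ b z = 1) (ha : ∀ b ∈ T, θ b y = a)
    (v : TangentSpace (𝓡 m) y) :
    mdiff m (fun z ↦ ∑ b ∈ T, χ b z * θ b z) y v = ∑ b ∈ T, χ b y * mdiff m (θ b) y v := by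
  have hprod : HasMFDerivAt (𝓡 m) 𝓘(ℝ) (fun z ↦ ∑ b ∈ T, χ b z * θ b z) y
      (∑ b ∈ T, (χ b y • mdiff m (θ b) y + θ b y • mdiff m (χ b) y)) :=
    hasMFDerivAt_finset_sum fun b hb ↦ (hχ b hb).hasMFDerivAt.mul (hθ b hb).hasMFDerivAt
  have hone : HasMFDerivAt (𝓡 m) 𝓘(ℝ) (fun z ↦ ∑ b ∈ T, χ b z) y (∑ b ∈ T, mdiff m (χ b) y) :=
    hasMFDerivAt_finset_sum fun b hb ↦ (hχ b hb).hasMFDerivAt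
  have hzero : ∑ b ∈ T, mdiff m (χ b) y = 0 :=
    hasMFDerivAt_unique hone
      ((hasMFDerivAt_const (1 : ℝ) y).congr_of_eventuallyEq hsum)
  have hχθ : ∑ b ∈ T, θ b y • mdiff m (χ b) y = 0 := by
    rw [Finset.sum_congr rfl fun b hb ↦ by rw [ha b hb], ← Finset.smul_sum, hzero, smul_zero]
  have hsum_add : ∑ b ∈ T, (χ b y • mdiff m (θ b) y + θ b y • mdiff m (χ b) y) =
      ∑ b ∈ T, χ b y • mdiff m (θ b) y := by
    rw [Finset.sum_add_distrib, hχθ, add_zero]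
  exact (congrArg (fun L ↦ L v) (hprod.mfderiv.trans hsum_add)).trans
    (sum_apply T (fun b ↦ χ b y • mdiff m (θ b) y) v)

variable [IsManifold (𝓡 m) ∞ M]

lemma contDiffAt_comp_chartAt_symm (hy : y ∈ (chartAt (EuclideanSpace ℝ (Fin m)) x).source)
    (hf : ContMDiffAt (𝓡 m) 𝓘(ℝ, W) ∞ f y) :
    ContDiffAt ℝ ∞ (fun z ↦ f ((chartAt (EuclideanSpace ℝ (Fin m)) x).symm z))
      (chartAt (EuclideanSpace ℝ (Fin m)) x y) := by
  refine ContMDiffAt.contDiffAt (ContMDiffAt.comp _ ?_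
    (contMDiffAt_chartAt_symm ((chartAt (EuclideanSpace ℝ (Fin m)) x).map_source hy)))
  rwa [(chartAt (EuclideanSpace ℝ (Fin m)) x).left_inv hy]

lemma mdiff_comp_chartAt (hy : y ∈ (chartAt (EuclideanSpace ℝ (Fin m)) x).source)
    {h : EuclideanSpace ℝ (Fin m) → W}
    (hh : DifferentiableAt ℝ h (chartAt (EuclideanSpace ℝ (Fin m)) x y))
    (v : TangentSpace (𝓡 m) y) :
    mdiff m (fun z ↦ h (chartAt (EuclideanSpace ℝ (Fin m)) x z)) y v =
      fderiv ℝ h (chartAt (EuclideanSpace ℝ (Fin m)) x y) (chartDeriv m x y v) :=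
  congrArg (fun L ↦ L v)
    (HasMFDerivAt.comp y hh.hasFDerivAt.hasMFDerivAt (hasMFDerivAt_chartAt hy)).mfderiv

lemma mdiff_apply_eq (hy : y ∈ (chartAt (EuclideanSpace ℝ (Fin m)) x).source)
    (hf : ContMDiffAt (𝓡 m) 𝓘(ℝ, W) ∞ f y) (v : TangentSpace (𝓡 m) y) :
    mdiff m f y v = fderiv ℝ (fun z ↦ f ((chartAt (EuclideanSpace ℝ (Fin m)) x).symm z))
      (chartAt (EuclideanSpace ℝ (Fin m)) x y) (chartDeriv m x y v) := by
  rw [← mdiff_comp_chartAt hy ((contDiffAt_comp_chartAt_symm hy hf).differentiableAt (by simp))]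
  have hcongr : f =ᶠ[𝓝 y] fun z ↦ f ((chartAt (EuclideanSpace ℝ (Fin m)) x).symm
      (chartAt (EuclideanSpace ℝ (Fin m)) x z)) := by
    filter_upwards [(chartAt (EuclideanSpace ℝ (Fin m)) x).open_source.mem_nhds hy] with z hz
    rw [(chartAt (EuclideanSpace ℝ (Fin m)) x).left_inv hz]
  rw [mdiff_congr hcongr]

lemma chartDeriv_velocity {c : ℝ → M} {t : ℝ}
    (ht : c t ∈ (chartAt (EuclideanSpace ℝ (Fin m)) x).source)
    (hc : MDifferentiableAt 𝓘(ℝ) (𝓡 m) c t) :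
    chartDeriv m x (c t) (velocity m c t) =
      deriv (fun s ↦ chartAt (EuclideanSpace ℝ (Fin m)) x (c s)) t := by
  have hcomp : HasFDerivAt (fun s ↦ chartAt (EuclideanSpace ℝ (Fin m)) x (c s))
      (ContinuousLinearMap.comp (M₂ := EuclideanSpace ℝ (Fin m)) (chartDeriv m x (c t))
        (mfderiv 𝓘(ℝ) (𝓡 m) c t) : ℝ →L[ℝ] EuclideanSpace ℝ (Fin m)) t :=
    (HasMFDerivAt.comp t (hasMFDerivAt_chartAt ht) hc.hasMFDerivAt).hasFDerivAt
  exact hcomp.hasDerivAt.deriv.symm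

lemma IsEmbeddedLoop.velocity_ne_zero {c : C(ℝ, M)} (hc : IsEmbeddedLoop m c) (t : ℝ) :
    velocity m c t ≠ 0 := by
  intro h
  obtain ⟨x, hx, hderiv⟩ := hc.immersed t
  apply hderiv
  rw [← chartDeriv_velocity hx (hc.smooth.mdifferentiableAt (by simp)), h, map_zero]

end Differential

/-! ### Forms adapted to curves -/

section Adapted

lemma exists_dual_time_function {E : Type*} [NormedAddCommGroup E] [NormedSpace ℝ E] {q : ℝ → E}
    {G : ℝ → E →L[ℝ] E →L[ℝ] ℝ} {t₀ : ℝ} (hq : ∀ᶠ t in 𝓝 t₀, ContDiffAt ℝ ∞ q t)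
    (hG : ∀ᶠ t in 𝓝 t₀, ContDiffAt ℝ ∞ G t)
    (hpos : ∀ᶠ t in 𝓝 t₀, 0 < G t (deriv q t) (deriv q t)) :
    ∃ h : E → ℝ, (∀ᶠ z in 𝓝 (q t₀), ContDiffAt ℝ ∞ h z) ∧ ∀ᶠ t in 𝓝 t₀, h (q t) = t ∧
      ∀ v, fderiv ℝ h (q t) v * G t (deriv q t) (deriv q t) = G t (deriv q t) v := by
  let L : ℝ → E →L[ℝ] ℝ := fun t ↦ (G t (deriv q t) (deriv q t))⁻¹ • G t (deriv q t)
  have hL : ∀ᶠ t in 𝓝 t₀, ContDiffAt ℝ ∞ L t := by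
    filter_upwards [hq, hG, hpos] with t hq hG hpos
    have hGq := hG.clm_apply (contDiffAt_deriv hq)
    exact ((hGq.clm_apply (contDiffAt_deriv hq)).inv hpos.ne').smul hGq
  have hLq : ∀ᶠ t in 𝓝 t₀, L t (deriv q t) = 1 := by
    filter_upwards [hpos] with t hpos
    simp [L, hpos.ne']
  obtain ⟨h, hsmooth, hh⟩ := exists_time_function hq hL hLq
  refine ⟨h, hsmooth, ?_⟩
  filter_upwards [hh, hpos] with t ⟨ht, hfderiv⟩ hpos
  refine ⟨ht, fun v ↦ ?_⟩
  rw [hfderiv, smul_apply, smul_eq_mul]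
  field_simp

variable {m : ℕ} {M : Type*} [TopologicalSpace M] [ChartedSpace (EuclideanSpace ℝ (Fin m)) M]
  [IsManifold (𝓡 m) ∞ M]

/-- Along `c`, the differential of `θ` is the form dual to the velocity of `c`. -/
def IsDualForm (g : SmoothMetric m M) (c : ℝ → M) (θ : M → ℝ) (t : ℝ) : Prop :=
  ∀ v : TangentSpace (𝓡 m) (c t),
    mdiff m θ (c t) v * g.inner (c t) (velocity m c t) (velocity m c t) =
      g.inner (c t) (velocity m c t) v

lemma IsDualForm.of_add_int {g : SmoothMetric m M} {c : C(ℝ, M)} (hc : IsSmoothLoop m c)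
    {θ : M → ℝ} {t : ℝ} {n : ℤ} (h : IsDualForm g c θ (t + n)) : IsDualForm g c θ t := by
  have hshift : IsDualForm g (fun s ↦ c (s + n)) θ t := by
    intro v
    rw [velocity_comp_add (hc.smooth.mdifferentiableAt (by simp) (x := t + n))]
    exact h v
  rwa [show (fun s ↦ c (s + n)) = c from funext fun s ↦ hc.add_int s n] at hshift

lemma IsEmbeddedLoop.exists_time_function (g : SmoothMetric m M) {c : C(ℝ, M)}
    (hc : IsEmbeddedLoop m c) (t₀ : ℝ) :
    ∃ θ : M → ℝ, (∀ᶠ y in 𝓝 (c t₀), ContMDiffAt (𝓡 m) 𝓘(ℝ) ∞ θ y) ∧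
      ∀ᶠ t in 𝓝 t₀, θ (c t) = t ∧ IsDualForm g c θ t := by
  set φ := chartAt (EuclideanSpace ℝ (Fin m)) (c t₀)
  have hx : c t₀ ∈ φ.source := mem_chart_source _ _
  obtain ⟨G, hG⟩ := g.exists_chart_form (c t₀)
  have hsource : ∀ᶠ t in 𝓝 t₀, c t ∈ φ.source :=
    c.continuous.continuousAt.eventually (φ.open_source.mem_nhds hx)
  have hinner (t : ℝ) (ht : c t ∈ φ.source) (v : TangentSpace (𝓡 m) (c t)) :
      g.inner (c t) (velocity m c t) v =
        G (c t) (deriv (fun s ↦ φ (c s)) t) (chartDeriv m (c t₀) (c t) v) := by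
    rw [(hG _ ht).2, chartDeriv_velocity ht (hc.smooth.mdifferentiableAt (by simp))]
  have hspeed (t : ℝ) (ht : c t ∈ φ.source) :
      g.inner (c t) (velocity m c t) (velocity m c t) =
        G (c t) (deriv (fun s ↦ φ (c s)) t) (deriv (fun s ↦ φ (c s)) t) := by
    rw [hinner t ht, chartDeriv_velocity ht (hc.smooth.mdifferentiableAt (by simp))]
  obtain ⟨h, hsmooth, hh⟩ := exists_dual_time_function
    (q := fun t ↦ φ (c t)) (G := fun t ↦ G (c t)) (t₀ := t₀)
    (hsource.mono fun t ht ↦ contDiffAt_chartAt_comp hc.smooth ht)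
    (hsource.mono fun t ht ↦ ((hG _ ht).1.comp t (hc.smooth t)).contDiffAt)
    (hsource.mono fun t ht ↦ hspeed t ht ▸ g.pos _ _ (hc.velocity_ne_zero t))
  refine ⟨fun y ↦ h (φ y), ?_, ?_⟩
  · filter_upwards [φ.open_source.mem_nhds hx, (φ.continuousAt hx).eventually hsmooth] with y hy hh
    exact hh.contMDiffAt.comp y (contMDiffAt_chartAt hy)
  · filter_upwards [hsource, hh,
      ((φ.continuousAt hx).comp c.continuous.continuousAt).eventually hsmooth]
      with t ht ⟨hht, hdual⟩ hsmooth
    refine ⟨hht, fun v ↦ ?_⟩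
    rw [mdiff_comp_chartAt ht (hsmooth.differentiableAt (by simp)), hspeed t ht, hinner t ht]
    exact hdual _

variable {V : Type*} [NormedAddCommGroup V] [NormedSpace ℝ V] {ι : Type*}

/-- The function `F` is adapted at `x`: subtracted from a primitive of `Ψ` it leaves a smooth
function, and at a point of the curve `γ i` this function is `θ • w`, where `w` is the period along
`γ i` and `θ` is a time function whose differential is dual to the velocity. -/
structure IsAdaptedAt (g : SmoothMetric m M) (Ψ : C(unitInterval, M) → V) (γ : ι → C(ℝ, M))
    (F : M → V) (x : M) : Prop where
  smooth : ∀ k, IsPrimitiveAt Ψ k x →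
    ∀ᶠ y in 𝓝 x, ContMDiffAt (𝓡 m) 𝓘(ℝ, V) ∞ (fun z ↦ k z - F z) y
  curve : ∀ i t₀, γ i t₀ = x → ∃ θ : M → ℝ, (∀ᶠ y in 𝓝 x, ContMDiffAt (𝓡 m) 𝓘(ℝ) ∞ θ y) ∧
    (∀ k, IsPrimitiveAt Ψ k x → k x = Ψ (arc (γ i) 0 t₀) →
      ∀ᶠ y in 𝓝 x, k y - F y = θ y • Ψ (arc (γ i) 0 1)) ∧
    ∀ᶠ t in 𝓝 t₀, θ (γ i t) = t ∧ IsDualForm g (γ i) θ t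

end Adapted

section Periods

variable {M : Type*} [TopologicalSpace M] {A : Type*} [AddCommGroup A]
  {Ψ : C(unitInterval, M) → A} {c : C(ℝ, M)}

lemma arc_add_of_periodic (hc : Function.Periodic c 1) (a b : ℝ) (n : ℤ) :
    arc c (a + n) (b + n) = arc c a b := by
  ext t
  rw [arc_apply, arc_apply, show (1 - (t : ℝ)) * (a + n) + t * (b + n) =
    (1 - (t : ℝ)) * a + t * b + n by ring]
  simpa only [mul_one] using hc.int_mul n ((1 - (t : ℝ)) * a + t * b)

lemma IsPathCocycle.arc_int (hΨ : IsPathCocycle Ψ) (hc : Function.Periodic c 1) (n : ℤ) :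
    Ψ (arc c 0 n) = n • Ψ (arc c 0 1) := by
  have hsucc (k : ℤ) : Ψ (arc c 0 ((k + 1 : ℤ) : ℝ)) = Ψ (arc c 0 k) + Ψ (arc c 0 1) := by
    rw [← hΨ.arc_add c 0 k, ← arc_add_of_periodic hc 0 1 k]
    push_cast
    rw [zero_add, add_comm (1 : ℝ)]
  induction n with
  | zero => simp [hΨ.arc_self]
  | succ k ih => rw [add_zsmul, one_zsmul, ← ih]; exact hsucc k
  | pred k ih =>
    have hpred := hsucc (-k - 1)
    rw [sub_add_cancel, ih] at hpred
    rw [sub_zsmul, one_zsmul, hpred, ← sub_eq_add_neg, add_sub_cancel_right]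

lemma IsPathCocycle.arc_add_int (hΨ : IsPathCocycle Ψ) (hc : Function.Periodic c 1)
    (t : ℝ) (n : ℤ) : Ψ (arc c 0 (t + n)) = Ψ (arc c 0 t) + n • Ψ (arc c 0 1) := by
  have hshift : arc c n (t + n) = arc c 0 t := by
    simpa only [zero_add] using arc_add_of_periodic hc 0 t n
  rw [← hΨ.arc_add c 0 n, hΨ.arc_int hc, hshift, add_comm]

end Periods

section Local

variable {m : ℕ} {M : Type*} [TopologicalSpace M] [ChartedSpace (EuclideanSpace ℝ (Fin m)) M]
  {V : Type*} [NormedAddCommGroup V] [NormedSpace ℝ V] {ι : Type*}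
  {Ψ : C(unitInterval, M) → V} {γ : ι → C(ℝ, M)} {k : M → V} {y : M}

lemma IsPrimitiveAt.eventually_contMDiffAt_sub {k' s : M → V}
    (hk : IsPrimitiveAt Ψ k y) (hk' : IsPrimitiveAt Ψ k' y)
    (hs : ∀ᶠ z in 𝓝 y, ContMDiffAt (𝓡 m) 𝓘(ℝ, V) ∞ s z) :
    ∀ᶠ z in 𝓝 y, ContMDiffAt (𝓡 m) 𝓘(ℝ, V) ∞ (fun z ↦ k' z - (k z - s z)) z := by
  filter_upwards [eventually_eventually_nhds.2 (hk.sub_eq_sub m hk'), hs] with z hz hsz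
  have hconst : ContMDiffAt (𝓡 m) 𝓘(ℝ, V) ∞ (fun z ↦ (k' y - k y) + s z) z :=
    contMDiffAt_const.add hsz
  refine hconst.congr_of_eventuallyEq (hz.mono fun u hu ↦ ?_)
  have hu' : k' u - k u = k' y - k y := by
    rw [sub_eq_sub_iff_add_eq_add, add_comm (k' y)]
    exact (sub_eq_sub_iff_add_eq_add.1 hu).symm
  change k' u - (k u - s u) = k' y - k y + s u
  rw [← hu']
  abel

variable [IsManifold (𝓡 m) ∞ M] {g : SmoothMetric m M}

lemma IsPrimitiveAt.isAdaptedAt (hk : IsPrimitiveAt Ψ k y) (hy : ∀ i t, γ i t ≠ y) :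
    IsAdaptedAt g Ψ γ k y where
  smooth k' hk' := by
    simpa only [sub_zero] using hk.eventually_contMDiffAt_sub hk'
      (Eventually.of_forall fun z ↦ contMDiffAt_const (c := (0 : V)))
  curve i t h := (hy i t h).elim

lemma IsSmoothLoop.eventually_time_sub_int {c : C(ℝ, M)} (hc : IsSmoothLoop m c) {θ : M → ℝ}
    {t : ℝ} {n : ℤ} (hθ : ∀ᶠ z in 𝓝 (c t), ContMDiffAt (𝓡 m) 𝓘(ℝ) ∞ θ z)
    (h : ∀ᶠ s in 𝓝 (t + n), θ (c s) = s ∧ IsDualForm g c θ s) :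
    ∀ᶠ s in 𝓝 t, θ (c s) - n = s ∧ IsDualForm g c (fun z ↦ θ z - n) s := by
  filter_upwards [((continuous_add_const (n : ℝ)).tendsto t).eventually h,
    c.continuous.continuousAt.eventually hθ] with s ⟨htime, hdual⟩ hsmooth
  rw [hc.add_int] at htime
  refine ⟨by rw [htime]; ring, fun v ↦ ?_⟩
  rw [mdiff_eq_of_eq_add_const (a := -(n : ℝ)) (hsmooth.mdifferentiableAt (by simp))
    (Eventually.of_forall fun z ↦ sub_eq_add_neg _ _)]
  exact hdual.of_add_int hc v

lemma IsPrimitiveAt.isAdaptedAt_sub_smul (hΨ : IsPathCocycle Ψ)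
    (hγ : ∀ i, IsSmoothLoop m (γ i)) (hk : IsPrimitiveAt Ψ k y) {θ : M → ℝ}
    (hθ : ∀ᶠ z in 𝓝 y, ContMDiffAt (𝓡 m) 𝓘(ℝ) ∞ θ z) {i : ι}
    (hcurve : ∀ j t, γ j t = y → j = i ∧ ∃ n : ℤ, k (γ i (t + n)) = Ψ (arc (γ i) 0 (t + n)) ∧
      ∀ᶠ s in 𝓝 (t + n), θ (γ i s) = s ∧ IsDualForm g (γ i) θ s) :
    IsAdaptedAt g Ψ γ (fun z ↦ k z - θ z • Ψ (arc (γ i) 0 1)) y := by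
  refine ⟨fun k' hk' ↦ hk.eventually_contMDiffAt_sub hk'
    (hθ.mono fun z hz ↦ hz.smul contMDiffAt_const), fun j t hj ↦ ?_⟩
  obtain ⟨rfl, n, hkt, htime⟩ := hcurve j t hj
  refine ⟨fun z ↦ θ z - n, hθ.mono fun z hz ↦ hz.sub contMDiffAt_const, fun k' hk' hk'y ↦ ?_,
    (hγ j).eventually_time_sub_int (hj ▸ hθ) htime⟩
  have hky : k y = k' y + (n : ℝ) • Ψ (arc (γ j) 0 1) := by
    rw [hk'y, Int.cast_smul_eq_zsmul, ← hΨ.arc_add_int (hγ j).periodic, ← hkt,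
      (hγ j).add_int, hj]
  filter_upwards [hk.sub_eq_sub m hk'] with z hz
  have hk'z : k' z = k z - k y + k' y := by rw [hz]; abel
  rw [hk'z, hky, sub_smul]
  abel

lemma exists_isAdaptedAt_local [T2Space M] [Finite ι] (g : SmoothMetric m M)
    (hΨ : IsPathCocycle Ψ) (hγ : ∀ i, IsEmbeddedLoop m (γ i))
    (hdisj : ∀ i j, i ≠ j → ∀ s t, γ i s ≠ γ j t) (x : M) :
    ∃ F : M → V, ∀ᶠ y in 𝓝 x, IsAdaptedAt g Ψ γ F y := by
  obtain ⟨k₀, hk₀⟩ := hΨ.exists_isPrimitiveAt m x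
  by_cases hx : ∀ i t, γ i t ≠ x
  · refine ⟨k₀, ?_⟩
    filter_upwards [hk₀.eventually, eventually_forall_ne_curve hγ hx] with y hky hy
    exact hky.isAdaptedAt hy
  push Not at hx
  obtain ⟨i, t₀, rfl⟩ := hx
  obtain ⟨k, hk, hkx⟩ : ∃ k, IsPrimitiveAt Ψ k (γ i t₀) ∧ k (γ i t₀) = Ψ (arc (γ i) 0 t₀) :=
    ⟨_, hk₀.sub_const (k₀ (γ i t₀) - Ψ (arc (γ i) 0 t₀)), sub_sub_cancel _ _⟩
  obtain ⟨θ, hθ, hθγ⟩ := (hγ i).exists_time_function g t₀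
  have hkγ : ∀ᶠ t in 𝓝 t₀, k (γ i t) = Ψ (arc (γ i) 0 t) := by
    filter_upwards [hk.arc_eq] with t ht
    rw [← hΨ.arc_add (γ i) 0 t₀ t, ht, hkx, add_sub_cancel]
  refine ⟨fun y ↦ k y - θ y • Ψ (arc (γ i) 0 1), ?_⟩
  filter_upwards [hk.eventually, eventually_eventually_nhds.2 hθ,
    eventually_curve_eq hγ hdisj i t₀ (hkγ.and (eventually_eventually_nhds.2 hθγ))]
    with y hky hθy hy
  exact hky.isAdaptedAt_sub_smul hΨ (fun j ↦ (hγ j).toIsSmoothLoop) hθy hy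

end Local

section Gluing

variable {m : ℕ} {M : Type*} [TopologicalSpace M] [ChartedSpace (EuclideanSpace ℝ (Fin m)) M]
  [IsManifold (𝓡 m) ∞ M] {V : Type*} [NormedAddCommGroup V] [NormedSpace ℝ V] {ι : Type*}
  {Ψ : C(unitInterval, M) → V} {γ : ι → C(ℝ, M)}

lemma IsAdaptedAt.sum {g : SmoothMetric m M} {β : Type*} {T : Finset β} {χ : β → M → ℝ}
    {F : β → M → V} {x : M} (hF : ∀ b ∈ T, IsAdaptedAt g Ψ γ (F b) x)
    (hχ : ∀ b ∈ T, ContMDiff (𝓡 m) 𝓘(ℝ) ∞ (χ b)) (hsum : ∀ᶠ z in 𝓝 x, ∑ b ∈ T, χ b z = 1) :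
    IsAdaptedAt g Ψ γ (fun z ↦ ∑ b ∈ T, χ b z • F b z) x := by
  have hsub (k : M → V) (z : M) (hz : ∑ b ∈ T, χ b z = 1) :
      k z - ∑ b ∈ T, χ b z • F b z = ∑ b ∈ T, χ b z • (k z - F b z) := by
    simp only [smul_sub, Finset.sum_sub_distrib, ← Finset.sum_smul, hz, one_smul]
  refine ⟨fun k hk ↦ ?_, fun i t₀ hi ↦ ?_⟩
  · filter_upwards [(eventually_all_finset T).2 fun b hb ↦ (hF b hb).smooth k hk,
      eventually_eventually_nhds.2 hsum] with y hy hsum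
    have hsmooth : ContMDiffAt (𝓡 m) 𝓘(ℝ, V) ∞ (fun z ↦ ∑ b ∈ T, χ b z • (k z - F b z)) y :=
      contMDiffAt_finsetSum fun b hb ↦ (hχ b hb y).smul (hy b hb)
    exact hsmooth.congr_of_eventuallyEq (hsum.mono fun z hz ↦ hsub k z hz)
  · choose! θ hθ hprim htime using fun b hb ↦ (hF b hb).curve i t₀ hi
    have hθT : ∀ᶠ y in 𝓝 x, ∀ b ∈ T, ContMDiffAt (𝓡 m) 𝓘(ℝ) ∞ (θ b) y :=
      (eventually_all_finset T).2 hθ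
    refine ⟨fun z ↦ ∑ b ∈ T, χ b z * θ b z, ?_, fun k hk hkx ↦ ?_, ?_⟩
    · filter_upwards [hθT] with y hy
      exact contMDiffAt_finsetSum fun b hb ↦ (hχ b hb y).mul (hy b hb)
    · filter_upwards [hsum, (eventually_all_finset T).2 fun b hb ↦ hprim b hb k hk hkx]
        with y hy hyb
      rw [hsub k y hy, Finset.sum_smul]
      exact Finset.sum_congr rfl fun b hb ↦ by rw [hyb b hb, smul_smul]
    · have hcont : Tendsto (γ i) (𝓝 t₀) (𝓝 x) := hi ▸ (γ i).continuous.tendsto t₀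
      filter_upwards [(eventually_all_finset T).2 htime, hcont.eventually hθT,
        hcont.eventually (eventually_eventually_nhds.2 hsum)] with t ht hθt hsum
      have hsumt := hsum.self_of_nhds
      refine ⟨?_, fun v ↦ ?_⟩
      · rw [Finset.sum_congr rfl fun b hb ↦ by rw [(ht b hb).1], ← Finset.sum_mul, hsumt, one_mul]
      · rw [mdiff_sum_mul (fun b hb ↦ (hχ b hb _).mdifferentiableAt (by simp))
            (fun b hb ↦ (hθt b hb).mdifferentiableAt (by simp)) hsum fun b hb ↦ (ht b hb).1,
          Finset.sum_mul, Finset.sum_congr rfl fun b hb ↦ by rw [mul_assoc, (ht b hb).2 v],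
          ← Finset.sum_mul, hsumt, one_mul]

lemma IsAdaptedAt.congr {g : SmoothMetric m M} {F F' : M → V} {x : M}
    (h : IsAdaptedAt g Ψ γ F x) (hF' : F' =ᶠ[𝓝 x] F) : IsAdaptedAt g Ψ γ F' x := by
  refine ⟨fun k hk ↦ ?_, fun i t₀ hi ↦ ?_⟩
  · filter_upwards [h.smooth k hk, eventually_eventually_nhds.2 hF'] with y hy hF'y
    exact hy.congr_of_eventuallyEq (hF'y.mono fun z hz ↦ by simp only [hz])
  · obtain ⟨θ, hθ, hprim, htime⟩ := h.curve i t₀ hi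
    refine ⟨θ, hθ, fun k hk hkx ↦ ?_, htime⟩
    filter_upwards [hprim k hk hkx, hF'] with y hy hF'y
    rw [hF'y, hy]

theorem exists_isAdaptedAt [T2Space M] [SigmaCompactSpace M] [Finite ι] (g : SmoothMetric m M)
    (hΨ : IsPathCocycle Ψ) (hγ : ∀ i, IsEmbeddedLoop m (γ i))
    (hdisj : ∀ i j, i ≠ j → ∀ s t, γ i s ≠ γ j t) :
    ∃ F : M → V, ∀ x, IsAdaptedAt g Ψ γ F x := by
  choose F hF using exists_isAdaptedAt_local g hΨ hγ hdisj
  choose U hU hUo hxU using fun x ↦ eventually_nhds_iff.1 (hF x)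
  obtain ⟨χ, hχ⟩ := SmoothPartitionOfUnity.exists_isSubordinate (𝓡 m) isClosed_univ U hUo
    fun x _ ↦ mem_iUnion.2 ⟨x, hxU x⟩
  refine ⟨fun z ↦ ∑ᶠ b, χ b z • F b z, fun x ↦ ?_⟩
  have hsupport := χ.eventually_finsupport_subset x
  have hlocal : IsAdaptedAt g Ψ γ (fun z ↦ ∑ b ∈ χ.fintsupport x, χ b z • F b z) x :=
    IsAdaptedAt.sum (fun b hb ↦ hU b x (hχ b ((χ.mem_fintsupport_iff x b).1 hb)))
      (fun b _ ↦ (χ b).contMDiff)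
      (hsupport.mono fun z hz ↦ χ.sum_finsupport' z (mem_univ z) hz)
  refine hlocal.congr (hsupport.mono fun z hz ↦ ?_)
  refine (χ.sum_finsupport_smul_eq_finsum z F).symm.trans (Finset.sum_subset hz fun b _ hb ↦ ?_)
  rw [Function.notMem_support.1 (mt (χ.mem_finsupport z).2 hb), zero_smul]

end Gluing

/-! ### Conformal factors -/

lemma eventually_norm_sub_lt_of_continuousAt {X V : Type*} [TopologicalSpace X]
    [SeminormedAddCommGroup V] {f : X → V} {x : X} (hf : ContinuousAt f x) {c : ℝ} (hc : 0 < c) :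
    ∀ᶠ y in 𝓝 x, ‖f y - f x‖ < c :=
  (tendsto_iff_norm_sub_tendsto_zero.1 hf).eventually_lt_const hc

section Forms

variable {E : Type*} [NormedAddCommGroup E] [NormedSpace ℝ E] {B : E →L[ℝ] E →L[ℝ] ℝ}

/-- The square of the norm of the linear form `D` dual to the inner product `B`. -/
def dualNormSq (B : E →L[ℝ] E →L[ℝ] ℝ) (D : E →L[ℝ] ℝ) : ℝ :=
  D (B.inverse D)

lemma sq_le_dualNormSq_mul (hsymm : ∀ v w, B v w = B w v) (hpos : ∀ v, v ≠ 0 → 0 < B v v)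
    (hB : B.IsInvertible) (D : E →L[ℝ] ℝ) (v : E) : D v ^ 2 ≤ dualNormSq B D * B v v := by
  have hnonneg (u : E) : 0 ≤ B u u := by
    rcases eq_or_ne u 0 with rfl | hu
    · simp
    · exact (hpos u hu).le
  have hcauchy : B (B.inverse D) v ^ 2 ≤ B (B.inverse D) (B.inverse D) * B v v :=
    LinearMap.BilinForm.apply_sq_le_of_symm B.toLinearMap₁₂ hnonneg ⟨hsymm⟩ (B.inverse D) v
  rwa [hB.self_apply_inverse] at hcauchy

lemma dualNormSq_mul_eq_one (hB : B.IsInvertible) {D : E →L[ℝ] ℝ} {u : E} (hu : B u u ≠ 0)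
    (hD : B u u • D = B u) : dualNormSq B D * B u u = 1 := by
  have hinv : B u u • B.inverse D = u := by rw [← map_smul, hD, hB.inverse_apply_self]
  have hDu : D u = 1 := by
    have := congrArg (fun L ↦ L u) hD
    simp only [smul_apply, smul_eq_mul] at this
    exact mul_left_cancel₀ hu (this.trans (mul_one _).symm)
  rw [← hDu]
  nth_rw 3 [← hinv]
  rw [map_smul, smul_eq_mul, mul_comm, dualNormSq]

variable [FiniteDimensional ℝ E]

lemma exists_pos_mul_sq_le_of_posDef (hpos : ∀ v, v ≠ 0 → 0 < B v v) :
    ∃ c > 0, ∀ v, c * ‖v‖ ^ 2 ≤ B v v := by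
  rcases subsingleton_or_nontrivial E with hE | hE
  · exact ⟨1, one_pos, fun v ↦ by simp [Subsingleton.elim v 0]⟩
  have hcont : Continuous fun v ↦ B v v := B.continuous.clm_apply continuous_id
  obtain ⟨u, hu, hmin⟩ := (isCompact_sphere (0 : E) 1).exists_isMinOn
    (NormedSpace.sphere_nonempty.2 zero_le_one) hcont.continuousOn
  have hu0 : u ≠ 0 := ne_zero_of_mem_unit_sphere ⟨u, hu⟩
  refine ⟨B u u, hpos u hu0, fun v ↦ ?_⟩
  rcases eq_or_ne v 0 with rfl | hv
  · simp
  have hv' : ‖v‖ ≠ 0 := norm_ne_zero_iff.2 hv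
  have hunit : B u u ≤ B (‖v‖⁻¹ • v) (‖v‖⁻¹ • v) :=
    hmin (show ‖v‖⁻¹ • v ∈ Metric.sphere (0 : E) 1 by simp [norm_smul, hv'])
  simp only [map_smul, smul_apply, smul_eq_mul] at hunit
  calc B u u * ‖v‖ ^ 2 ≤ (‖v‖⁻¹ * (‖v‖⁻¹ * B v v)) * ‖v‖ ^ 2 := by gcongr
    _ = B v v := by field_simp

set_option synthInstance.maxHeartbeats 200000 in
-- Instance search on `E →L[ℝ] E →L[ℝ] ℝ` is slow.
lemma exists_pos_eventually_mul_sq_le_of_posDef {X : Type*} [TopologicalSpace X] {x : X}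
    {G : X → E →L[ℝ] E →L[ℝ] ℝ} (hG : ContinuousAt G x) (hpos : ∀ v, v ≠ 0 → 0 < G x v v) :
    ∃ c > 0, ∀ᶠ y in 𝓝 x, ∀ v, c * ‖v‖ ^ 2 ≤ G y v v := by
  obtain ⟨c, hc, hcG⟩ := exists_pos_mul_sq_le_of_posDef hpos
  refine ⟨c / 2, half_pos hc, ?_⟩
  have hnear := eventually_norm_sub_lt_of_continuousAt (V := E →L[ℝ] E →L[ℝ] ℝ) hG (half_pos hc)
  filter_upwards [hnear] with y hy v
  have hdiff : abs ((G y - G x) v v) ≤ c / 2 * ‖v‖ ^ 2 := by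
    calc abs ((G y - G x) v v) ≤ ‖G y - G x‖ * ‖v‖ * ‖v‖ := (G y - G x).le_opNorm₂ v v
      _ ≤ c / 2 * ‖v‖ * ‖v‖ := by gcongr
      _ = c / 2 * ‖v‖ ^ 2 := by ring
  have hlower := (abs_le.1 hdiff).1
  simp only [sub_apply] at hlower
  linarith [hcG v]

lemma isInvertible_of_posDef (hpos : ∀ v, v ≠ 0 → 0 < B v v) : B.IsInvertible := by
  have hinj : Function.Injective (B : E →ₗ[ℝ] E →L[ℝ] ℝ) := by
    refine (injective_iff_map_eq_zero _).2 fun v (hv : B v = 0) ↦ ?_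
    by_contra hv0
    exact (hpos v hv0).ne' (by rw [hv, zero_apply])
  have hdim : Module.finrank ℝ E = Module.finrank ℝ (E →L[ℝ] ℝ) := by
    rw [← (LinearMap.toContinuousLinearMap (𝕜 := ℝ) (E := E) (F' := ℝ)).finrank_eq]
    exact (Subspace.dual_finrank_eq (K := ℝ) (V := E)).symm
  exact ⟨(LinearMap.linearEquivOfInjective _ hinj hdim).toContinuousLinearEquiv, rfl⟩

end Forms

section Factor

variable {m : ℕ} {M : Type*} [TopologicalSpace M] [ChartedSpace (EuclideanSpace ℝ (Fin m)) M]
  [IsManifold (𝓡 m) ∞ M] {V : Type*} [NormedAddCommGroup V] [NormedSpace ℝ V]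

lemma SmoothMetric.exists_posDef_form (g : SmoothMetric m M) (x : M) :
    ∃ G : M → EuclideanSpace ℝ (Fin m) →L[ℝ] EuclideanSpace ℝ (Fin m) →L[ℝ] ℝ,
      ∀ y ∈ (chartAt (EuclideanSpace ℝ (Fin m)) x).source,
        ContMDiffAt (𝓡 m) 𝓘(ℝ, EuclideanSpace ℝ (Fin m) →L[ℝ] EuclideanSpace ℝ (Fin m) →L[ℝ] ℝ) ∞
          G y ∧
        (∀ v w : TangentSpace (𝓡 m) y,
          g.inner y v w = G y (chartDeriv m x y v) (chartDeriv m x y w)) ∧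
        (∀ v w, G y v w = G y w v) ∧ ∀ v, v ≠ 0 → 0 < G y v v := by
  obtain ⟨G, hG⟩ := g.exists_chart_form x
  refine ⟨G, fun y hy ↦ ⟨(hG y hy).1, (hG y hy).2, fun v w ↦ ?_, fun v hv ↦ ?_⟩⟩
  · obtain ⟨v, rfl⟩ := chartDeriv_surjective hy v
    obtain ⟨w, rfl⟩ := chartDeriv_surjective hy w
    rw [← (hG y hy).2, ← (hG y hy).2, g.symm]
  · obtain ⟨v, rfl⟩ := chartDeriv_surjective hy v
    rw [← (hG y hy).2]
    exact g.pos y v fun h ↦ hv (by rw [h, map_zero])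

lemma SmoothMetric.inner_self_nonneg (g : SmoothMetric m M) (y : M) (v : TangentSpace (𝓡 m) y) :
    0 ≤ g.inner y v v := by
  by_cases hv : v = 0
  · rw [hv, map_zero]
  · exact (g.pos y v hv).le

lemma exists_mdiff_bound (g : SmoothMetric m M) {s : M → V} {x : M}
    (hs : ∀ᶠ y in 𝓝 x, ContMDiffAt (𝓡 m) 𝓘(ℝ, V) ∞ s y) :
    ∃ A : ℝ, 0 ≤ A ∧ ∀ᶠ y in 𝓝 x, ∀ v, ‖mdiff m s y v‖ ^ 2 ≤ A * g.inner y v v := by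
  set φ := chartAt (EuclideanSpace ℝ (Fin m)) x
  have hx : x ∈ φ.source := mem_chart_source _ x
  obtain ⟨G, hG⟩ := g.exists_posDef_form x
  obtain ⟨c, hc, hcG⟩ := exists_pos_eventually_mul_sq_le_of_posDef
    (hG x hx).1.continuousAt (hG x hx).2.2.2
  let D : M → EuclideanSpace ℝ (Fin m) →L[ℝ] V :=
    fun y ↦ fderiv ℝ (fun z ↦ s (φ.symm z)) (φ y)
  have hD : ContinuousAt D x := by
    have hfderiv := (contDiffAt_comp_chartAt_symm hx hs.self_of_nhds).fderiv_right (m := ∞)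
      (by simp)
    exact ContinuousAt.comp (g := fun z ↦ fderiv ℝ (fun z ↦ s (φ.symm z)) z)
      hfderiv.continuousAt (φ.continuousAt hx)
  refine ⟨(‖D x‖ + 1) ^ 2 / c, by positivity, ?_⟩
  filter_upwards [hD.norm.eventually_lt_const (lt_add_one _), hcG, φ.open_source.mem_nhds hx, hs]
    with y hDy hcGy hy hsy v
  rw [mdiff_apply_eq (x := x) hy hsy, (hG y hy).2.1]
  set u := chartDeriv m x y v
  have hDu : ‖D y u‖ ≤ (‖D x‖ + 1) * ‖u‖ := ((D y).le_opNorm u).trans (by gcongr)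
  calc ‖D y u‖ ^ 2 ≤ ((‖D x‖ + 1) * ‖u‖) ^ 2 := by gcongr
    _ = (‖D x‖ + 1) ^ 2 / c * (c * ‖u‖ ^ 2) := by field_simp
    _ ≤ _ := by gcongr; exact hcGy u

omit [IsManifold (𝓡 m) ∞ M] in
lemma contMDiffAt_dualNormSq {E : Type*} [NormedAddCommGroup E] [NormedSpace ℝ E]
    [CompleteSpace E] {G : M → E →L[ℝ] E →L[ℝ] ℝ} {D : M → E →L[ℝ] ℝ} {y : M}
    (hG : ContMDiffAt (𝓡 m) 𝓘(ℝ, E →L[ℝ] E →L[ℝ] ℝ) ∞ G y)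
    (hD : ContMDiffAt (𝓡 m) 𝓘(ℝ, E →L[ℝ] ℝ) ∞ D y) (hinv : (G y).IsInvertible) :
    ContMDiffAt (𝓡 m) 𝓘(ℝ) ∞ (fun z ↦ dualNormSq (G z) (D z)) y := by
  have hGinv : ContMDiffAt (𝓡 m) 𝓘(ℝ, (E →L[ℝ] ℝ) →L[ℝ] E) ∞ (fun z ↦ (G z).inverse) y := by
    obtain ⟨e, he⟩ := hinv
    have hinverse := contDiffAt_map_inverse (n := ∞) e
    rw [he] at hinverse
    exact hinverse.contMDiffAt.comp y hG
  exact hD.clm_apply (hGinv.clm_apply hD)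

lemma exists_dual_norm_sq (g : SmoothMetric m M) {θ : M → ℝ} {x : M}
    (hθ : ∀ᶠ y in 𝓝 x, ContMDiffAt (𝓡 m) 𝓘(ℝ) ∞ θ y) :
    ∃ q : M → ℝ, ∀ᶠ y in 𝓝 x, ContMDiffAt (𝓡 m) 𝓘(ℝ) ∞ q y ∧
      (∀ v, mdiff m θ y v ^ 2 ≤ q y * g.inner y v v) ∧
      ∀ u, u ≠ 0 → (∀ v, mdiff m θ y v * g.inner y u u = g.inner y u v) →
        q y * g.inner y u u = 1 := by
  set φ := chartAt (EuclideanSpace ℝ (Fin m)) x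
  obtain ⟨G, hG⟩ := g.exists_posDef_form x
  let D : M → EuclideanSpace ℝ (Fin m) →L[ℝ] ℝ :=
    fun y ↦ fderiv ℝ (fun z ↦ θ (φ.symm z)) (φ y)
  refine ⟨fun y ↦ dualNormSq (G y) (D y), ?_⟩
  filter_upwards [φ.open_source.mem_nhds (mem_chart_source _ x), hθ] with y hy hθy
  obtain ⟨hGs, hGi, hGsymm, hGpos⟩ := hG y hy
  have hinv := isInvertible_of_posDef hGpos
  have hmdiff (v : TangentSpace (𝓡 m) y) : mdiff m θ y v = D y (chartDeriv m x y v) :=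
    mdiff_apply_eq hy hθy v
  refine ⟨contMDiffAt_dualNormSq hGs ?_ hinv, fun v ↦ ?_, fun u hu hdual ↦ ?_⟩
  · exact ((contDiffAt_comp_chartAt_symm hy hθy).fderiv_right (m := ∞) (by simp)).contMDiffAt.comp
      y (contMDiffAt_chartAt hy)
  · rw [hmdiff, hGi]
    exact sq_le_dualNormSq_mul hGsymm hGpos hinv (D y) _
  · rw [hGi]
    refine dualNormSq_mul_eq_one hinv (hGi u u ▸ (g.pos y u hu).ne') ?_
    ext w
    obtain ⟨v, rfl⟩ := chartDeriv_surjective hy w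
    rw [← hGi, ← hGi, ← hdual v, hmdiff, smul_apply, smul_eq_mul, mul_comm]

end Factor

section Conformal

variable {m : ℕ} {M : Type*} [TopologicalSpace M] [ChartedSpace (EuclideanSpace ℝ (Fin m)) M]
  [IsManifold (𝓡 m) ∞ M] {V : Type*} [NormedAddCommGroup V] [NormedSpace ℝ V] {ι : Type*}
  {g : SmoothMetric m M} {N : Seminorm ℝ V} {Ψ : C(unitInterval, M) → V} {γ : ι → C(ℝ, M)}
  {F : M → V}

omit [IsManifold (𝓡 m) ∞ M] in
lemma mdiff_smul_const {θ : M → ℝ} {y : M} (hθ : MDifferentiableAt (𝓡 m) 𝓘(ℝ) θ y) (w : V)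
    (v : TangentSpace (𝓡 m) y) : mdiff m (fun z ↦ θ z • w) y v = mdiff m θ y v • w :=
  congrArg (fun L ↦ L v) (HasMFDerivAt.comp y
    ((ContinuousLinearMap.id ℝ ℝ).smulRight w).hasMFDerivAt hθ.hasMFDerivAt).mfderiv

lemma IsAdaptedAt.mdiff_eq {k k' : M → V} {y : M}
    (hF : IsAdaptedAt g Ψ γ F y) (hk : IsPrimitiveAt Ψ k y) (hk' : IsPrimitiveAt Ψ k' y) :
    mdiff m (fun z ↦ k' z - F z) y = mdiff m (fun z ↦ k z - F z) y := by
  refine mdiff_eq_of_eq_add_const (a := k' y - k y)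
    ((hF.smooth k hk).self_of_nhds.mdifferentiableAt (by simp)) ?_
  filter_upwards [hk.sub_eq_sub m hk'] with z hz
  have hk'z : k' z = k z - k y + k' y := by rw [hz]; abel
  rw [hk'z]
  abel

lemma eventually_forall_mdiff_eq {k : M → V} {x : M}
    (hF : ∀ x, IsAdaptedAt g Ψ γ F x) (hk : IsPrimitiveAt Ψ k x) :
    ∀ᶠ y in 𝓝 x, ∀ k', IsPrimitiveAt Ψ k' y →
      mdiff m (fun z ↦ k' z - F z) y = mdiff m (fun z ↦ k z - F z) y := by
  filter_upwards [hk.eventually] with y hy k₁ hk₁ using (hF y).mdiff_eq hy hk₁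

/-- With respect to the form `a • g` at `x`, the closed form represented by `F` (the differential
of `k - F` for a local primitive `k` of `Ψ`) has comass at most one, where `V` is measured by `N`,
and the curves `γ i` through `x` have speed the size of their period. -/
structure IsCalibratingFactor (g : SmoothMetric m M) (N : Seminorm ℝ V)
    (Ψ : C(unitInterval, M) → V) (γ : ι → C(ℝ, M)) (F : M → V) (x : M) (a : ℝ) : Prop where
  pos : 0 < a
  le : ∀ k, IsPrimitiveAt Ψ k x → ∀ v,
    N (mdiff m (fun z ↦ k z - F z) x v) ^ 2 ≤ a * g.inner x v v
  eq : ∀ i t, γ i t = x → a * g.inner (γ i t) (velocity m (γ i) t) (velocity m (γ i) t) =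
    N (Ψ (arc (γ i) 0 1)) ^ 2

lemma convex_setOf_isCalibratingFactor (x : M) :
    Convex ℝ {a | IsCalibratingFactor g N Ψ γ F x a} := by
  intro a ha b hb r s hr hs hrs
  refine ⟨(convex_Ioi (0 : ℝ)) ha.pos hb.pos hr hs hrs, fun k hk v ↦ ?_, fun i t hit ↦ ?_⟩
  · calc N (mdiff m (fun z ↦ k z - F z) x v) ^ 2
        = r * N (mdiff m (fun z ↦ k z - F z) x v) ^ 2 +
          s * N (mdiff m (fun z ↦ k z - F z) x v) ^ 2 := by rw [← add_mul, hrs, one_mul]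
      _ ≤ r * (a * g.inner x v v) + s * (b * g.inner x v v) :=
          add_le_add (mul_le_mul_of_nonneg_left (ha.le k hk v) hr)
            (mul_le_mul_of_nonneg_left (hb.le k hk v) hs)
      _ = _ := by simp only [smul_eq_mul]; ring
  · simp only [smul_eq_mul]
    rw [add_mul, mul_assoc, mul_assoc, ha.eq i t hit, hb.eq i t hit, ← add_mul, hrs, one_mul]

variable [T2Space M] [Finite ι]

lemma exists_isCalibratingFactor_of_forall_ne {C : ℝ} (hN : ∀ v, N v ≤ C * ‖v‖)
    (hγ : ∀ i, IsEmbeddedLoop m (γ i)) (hF : ∀ x, IsAdaptedAt g Ψ γ F x) {x : M} {k : M → V}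
    (hk : IsPrimitiveAt Ψ k x) (hx : ∀ i t, γ i t ≠ x) :
    ∃ a : ℝ, ∀ᶠ y in 𝓝 x, IsCalibratingFactor g N Ψ γ F y a := by
  obtain ⟨A, hA, hbound⟩ := exists_mdiff_bound g ((hF x).smooth k hk)
  refine ⟨C ^ 2 * A + 1, ?_⟩
  filter_upwards [hbound, eventually_forall_mdiff_eq hF hk, eventually_forall_ne_curve hγ hx] with
    y hAy hky hy
  refine ⟨by positivity, fun k' hk' v ↦ ?_, fun i t h ↦ (hy i t h).elim⟩
  rw [hky k' hk']
  set u := mdiff m (fun z ↦ k z - F z) y v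
  calc N u ^ 2 ≤ (C * ‖u‖) ^ 2 := by gcongr; exact hN u
    _ = C ^ 2 * ‖u‖ ^ 2 := by ring
    _ ≤ C ^ 2 * (A * g.inner y v v) := by gcongr; exact hAy v
    _ ≤ (C ^ 2 * A + 1) * g.inner y v v := by linarith [g.inner_self_nonneg y v]

lemma exists_isCalibratingFactor_curve (hγ : ∀ i, IsEmbeddedLoop m (γ i))
    (hdisj : ∀ i j, i ≠ j → ∀ s t, γ i s ≠ γ j t) (hF : ∀ x, IsAdaptedAt g Ψ γ F x)
    {i : ι} (hw : 0 < N (Ψ (arc (γ i) 0 1))) {t₀ : ℝ} {k : M → V}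
    (hk : IsPrimitiveAt Ψ k (γ i t₀)) (hkt₀ : k (γ i t₀) = Ψ (arc (γ i) 0 t₀)) :
    ∃ f : M → ℝ, ∀ᶠ y in 𝓝 (γ i t₀),
      ContMDiffAt (𝓡 m) 𝓘(ℝ) ∞ f y ∧ IsCalibratingFactor g N Ψ γ F y (f y) := by
  obtain ⟨θ, hθ, hkθ, hθγ⟩ := (hF _).curve i t₀ rfl
  obtain ⟨q, hq⟩ := exists_dual_norm_sq g hθ
  set w := Ψ (arc (γ i) 0 1)
  have hqpos : 0 < q (γ i t₀) := by
    refine pos_of_mul_pos_left ?_ (g.inner_self_nonneg _ (velocity m (γ i) t₀))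
    rw [hq.self_of_nhds.2.2 _ ((hγ i).velocity_ne_zero t₀) hθγ.self_of_nhds.2]
    exact one_pos
  refine ⟨fun y ↦ N w ^ 2 * q y, ?_⟩
  filter_upwards [hq, eventually_forall_mdiff_eq hF hk, hθ,
    hq.self_of_nhds.1.continuousAt.eventually_const_lt hqpos,
    eventually_eventually_nhds.2 (hkθ k hk hkt₀), eventually_curve_eq hγ hdisj i t₀ hθγ]
    with y ⟨hqsmooth, hqle, hqeq⟩ hky hθy hpos hkθy hy
  refine ⟨contMDiffAt_const.mul hqsmooth, mul_pos (pow_pos hw 2) hpos, fun k' hk' v ↦ ?_,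
    fun j t hj ↦ ?_⟩
  · rw [hky k' hk', mdiff_congr hkθy, mdiff_smul_const (hθy.mdifferentiableAt (by simp)),
      map_smul_eq_mul, mul_pow, Real.norm_eq_abs, sq_abs, mul_comm, mul_assoc]
    exact mul_le_mul_of_nonneg_left (hqle v) (sq_nonneg (N w))
  · obtain ⟨rfl, n, -, hdual⟩ := hy j t hj
    subst hj
    rw [mul_assoc, hqeq _ ((hγ j).velocity_ne_zero t)
      (hdual.of_add_int (hγ j).toIsSmoothLoop), mul_one]

theorem exists_conformal_factor [SigmaCompactSpace M] (hΨ : IsPathCocycle Ψ) {C : ℝ}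
    (hN : ∀ v, N v ≤ C * ‖v‖) (hγ : ∀ i, IsEmbeddedLoop m (γ i))
    (hdisj : ∀ i j, i ≠ j → ∀ s t, γ i s ≠ γ j t) (hF : ∀ x, IsAdaptedAt g Ψ γ F x)
    (hw : ∀ i, 0 < N (Ψ (arc (γ i) 0 1))) :
    ∃ f : M → ℝ, ContMDiff (𝓡 m) 𝓘(ℝ) ∞ f ∧ ∀ x, IsCalibratingFactor g N Ψ γ F x (f x) := by
  have hlocal (x : M) : ∃ f : M → ℝ, ∀ᶠ y in 𝓝 x,
      ContMDiffAt (𝓡 m) 𝓘(ℝ) ∞ f y ∧ IsCalibratingFactor g N Ψ γ F y (f y) := by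
    obtain ⟨k, hk⟩ := hΨ.exists_isPrimitiveAt m x
    by_cases hx : ∀ i t, γ i t ≠ x
    · obtain ⟨a, ha⟩ := exists_isCalibratingFactor_of_forall_ne hN hγ hF hk hx
      exact ⟨fun _ ↦ a, ha.mono fun y hy ↦ ⟨contMDiffAt_const, hy⟩⟩
    push Not at hx
    obtain ⟨i, t₀, rfl⟩ := hx
    exact exists_isCalibratingFactor_curve hγ hdisj hF (hw i)
      (hk.sub_const (k (γ i t₀) - Ψ (arc (γ i) 0 t₀))) (sub_sub_cancel _ _)
  obtain ⟨f, hf⟩ := exists_contMDiffMap_forall_mem_convex_of_local (𝓡 m)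
    (t := fun x ↦ {a | IsCalibratingFactor g N Ψ γ F x a})
    (fun x ↦ convex_setOf_isCalibratingFactor x) fun x ↦
      let ⟨f, hf⟩ := hlocal x
      ⟨_, hf, f, fun y hy ↦ hy.1.contMDiffWithinAt, fun y hy ↦ hy.2⟩
  exact ⟨f, f.contMDiff, hf⟩

end Conformal

/-! ### Lengths -/

section Length

variable {m : ℕ} {M : Type*} [TopologicalSpace M] [ChartedSpace (EuclideanSpace ℝ (Fin m)) M]
  [IsManifold (𝓡 m) ∞ M] {g : SmoothMetric m M}

/-- The length of the curve `c` on `[a, b]` with respect to `g`. -/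
def segLength (g : SmoothMetric m M) (c : ℝ → M) (a b : ℝ) : ℝ≥0∞ :=
  letI : RiemannianBundle (fun x : M ↦ TangentSpace (𝓡 m) x) := ⟨g.toRiemannianMetric⟩
  pathELength (𝓡 m) c a b

lemma segLength_eq_lintegral (g : SmoothMetric m M) (c : ℝ → M) (a b : ℝ) :
    segLength g c a b = ∫⁻ t in Ioo a b,
      ENNReal.ofReal (Real.sqrt (g.inner (c t) (velocity m c t) (velocity m c t))) := by
  let _ : RiemannianBundle (fun x : M ↦ TangentSpace (𝓡 m) x) := ⟨g.toRiemannianMetric⟩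
  unfold segLength
  rw [pathELength_eq_lintegral_mfderiv_Ioo]
  refine lintegral_congr fun t ↦ ?_
  rw [← ofReal_norm, norm_eq_sqrt_real_inner]
  rfl

lemma segLength_congr {c d : ℝ → M} {a b : ℝ} (h : EqOn c d (Ioo a b)) :
    segLength g c a b = segLength g d a b := by
  let _ : RiemannianBundle (fun x : M ↦ TangentSpace (𝓡 m) x) := ⟨g.toRiemannianMetric⟩
  exact pathELength_congr_Ioo h

lemma segLength_add {c : ℝ → M} {a b d : ℝ} (hab : a ≤ b) (hbd : b ≤ d) :
    segLength g c a b + segLength g c b d = segLength g c a d := by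
  let _ : RiemannianBundle (fun x : M ↦ TangentSpace (𝓡 m) x) := ⟨g.toRiemannianMetric⟩
  exact pathELength_add hab hbd

lemma segLength_eq_zero_of_eq_const {c : ℝ → M} {a b : ℝ} {x : M} (h : ∀ t ∈ Ioo a b, c t = x) :
    segLength g c a b = 0 := by
  have hvelocity (t : ℝ) : velocity m (fun _ : ℝ ↦ x) t = 0 := by
    unfold velocity
    rw [mfderiv_const]
    rfl
  rw [segLength_congr (d := fun _ ↦ x) h, segLength_eq_lintegral]
  simp [hvelocity]

lemma segLength_comp {c : ℝ → M} {a b : ℝ} {f : ℝ → ℝ} (hab : a ≤ b) (hmono : Monotone f)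
    (hf : Differentiable ℝ f) (hc : MDifferentiable 𝓘(ℝ) (𝓡 m) c) :
    segLength g (c ∘ f) a b = segLength g c (f a) (f b) := by
  let _ : RiemannianBundle (fun x : M ↦ TangentSpace (𝓡 m) x) := ⟨g.toRiemannianMetric⟩
  exact pathELength_comp_of_monotoneOn hab (hmono.monotoneOn _) hf.differentiableOn
    hc.mdifferentiableOn

lemma continuous_inner_velocity (g : SmoothMetric m M) {c : ℝ → M}
    (hc : ContMDiff 𝓘(ℝ) (𝓡 m) ∞ c) :
    Continuous fun t ↦ g.inner (c t) (velocity m c t) (velocity m c t) := by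
  refine continuous_iff_continuousAt.2 fun t₀ ↦ ?_
  obtain ⟨G, hG⟩ := g.exists_chart_form (c t₀)
  set φ := chartAt (EuclideanSpace ℝ (Fin m)) (c t₀)
  have hsource : ∀ᶠ t in 𝓝 t₀, c t ∈ φ.source :=
    hc.continuous.continuousAt.eventually (φ.open_source.mem_nhds (mem_chart_source _ _))
  have hform : ContDiffAt ℝ ∞ (fun t ↦ G (c t)) t₀ :=
    ((hG _ hsource.self_of_nhds).1.comp t₀ (hc t₀)).contDiffAt
  have hderiv := contDiffAt_deriv (contDiffAt_chartAt_comp hc hsource.self_of_nhds)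
  refine ((hform.clm_apply hderiv).clm_apply hderiv).continuousAt.congr ?_
  filter_upwards [hsource] with t ht
  rw [(hG _ ht).2, chartDeriv_velocity ht (hc.mdifferentiableAt (by simp))]

lemma segLength_lt_top (g : SmoothMetric m M) {c : ℝ → M} (hc : ContMDiff 𝓘(ℝ) (𝓡 m) ∞ c)
    (a b : ℝ) : segLength g c a b < ⊤ := by
  obtain ⟨B, hB⟩ := isCompact_Icc.exists_bound_of_continuousOn (s := Icc a b)
    (Real.continuous_sqrt.comp (continuous_inner_velocity g hc)).continuousOn
  rw [segLength_eq_lintegral]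
  calc _ ≤ ∫⁻ _ in Ioo a b, ENNReal.ofReal B :=
        setLIntegral_mono' measurableSet_Ioo fun _ ht ↦ ENNReal.ofReal_le_ofReal
          ((le_abs_self _).trans (hB _ ⟨ht.1.le, ht.2.le⟩))
    _ < ⊤ := by
        rw [setLIntegral_const]
        exact ENNReal.mul_lt_top ENNReal.ofReal_lt_top (by simp)

lemma segLength_of_inner_velocity_eq {c : ℝ → M} {r : ℝ} (hr : 0 ≤ r)
    (h : ∀ t, g.inner (c t) (velocity m c t) (velocity m c t) = r ^ 2) (a b : ℝ) :
    segLength g c a b = ENNReal.ofReal r * ENNReal.ofReal (b - a) := by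
  simp only [segLength_eq_lintegral, h, Real.sqrt_sq hr]
  rw [setLIntegral_const, Real.volume_Ioo]

end Length

section Calibration

variable {m : ℕ} {M : Type*} [TopologicalSpace M] [ChartedSpace (EuclideanSpace ℝ (Fin m)) M]
  {V : Type*} [NormedAddCommGroup V] [NormedSpace ℝ V] {Ψ : C(unitInterval, M) → V} {F k : M → V}

lemma hasDerivAt_comp_curve {s : M → V} {c : ℝ → M} {t : ℝ}
    (hs : MDifferentiableAt (𝓡 m) 𝓘(ℝ, V) s (c t)) (hc : MDifferentiableAt 𝓘(ℝ) (𝓡 m) c t) :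
    HasDerivAt (fun t ↦ s (c t)) (mdiff m s (c t) (velocity m c t)) t := by
  have hcomp : HasFDerivAt (fun t ↦ s (c t))
      (ContinuousLinearMap.comp (M₂ := EuclideanSpace ℝ (Fin m)) (mdiff m s (c t))
        (mfderiv 𝓘(ℝ) (𝓡 m) c t) : ℝ →L[ℝ] V) t :=
    (HasMFDerivAt.comp t hs.hasMFDerivAt hc.hasMFDerivAt).hasFDerivAt
  exact hcomp.hasDerivAt

omit [NormedSpace ℝ V] [ChartedSpace (EuclideanSpace ℝ (Fin m)) M] in
lemma IsPrimitiveAt.eventually_arc_sub_eq (hΨ : IsPathCocycle Ψ) {c : C(ℝ, M)} {t₀ : ℝ}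
    (hk : IsPrimitiveAt Ψ k (c t₀)) (F : M → V) (a : ℝ) :
    ∀ᶠ t in 𝓝 t₀, Ψ (arc c a t) - F (c t) =
      (fun z ↦ k z - F z) (c t) + (Ψ (arc c a t₀) - k (c t₀)) := by
  filter_upwards [hk.arc_eq] with t ht
  rw [← hΨ.arc_add c a t₀ t, ht]
  abel

lemma IsPathCocycle.contDiffOn_arc_sub (hΨ : IsPathCocycle Ψ) (hsmooth : ∀ x k,
      IsPrimitiveAt Ψ k x → ContMDiffAt (𝓡 m) 𝓘(ℝ, V) ∞ (fun z ↦ k z - F z) x)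
    {c : C(ℝ, M)} {S : Set ℝ} (hc : ContMDiffOn 𝓘(ℝ) (𝓡 m) 1 c S) (a : ℝ) :
    ContDiffOn ℝ 1 (fun t ↦ Ψ (arc c a t) - F (c t)) S := by
  intro t ht
  obtain ⟨k, hk⟩ := hΨ.exists_isPrimitiveAt m (c t)
  have hlocal := hk.eventually_arc_sub_eq hΨ F a
  have hcomp : ContMDiffWithinAt 𝓘(ℝ) 𝓘(ℝ, V) 1 (fun t ↦ (fun z ↦ k z - F z) (c t)) S t :=
    ((hsmooth _ k hk).of_le (by exact_mod_cast le_top)).comp_contMDiffWithinAt t (hc t ht)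
  exact (hcomp.contDiffWithinAt.add contDiffWithinAt_const).congr_of_eventuallyEq
    (mem_nhdsWithin_of_mem_nhds hlocal) hlocal.self_of_nhds

variable [IsManifold (𝓡 m) ∞ M] {g : SmoothMetric m M}

/-- The closed form represented by `F` has comass at most one: it is a calibration. -/
lemma enorm_le_segLength (hΨ : IsPathCocycle Ψ)
    (hsmooth : ∀ x k, IsPrimitiveAt Ψ k x → ContMDiffAt (𝓡 m) 𝓘(ℝ, V) ∞ (fun z ↦ k z - F z) x)
    (hF : ∀ x k, IsPrimitiveAt Ψ k x → ∀ v,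
      ‖mdiff m (fun z ↦ k z - F z) x v‖ ^ 2 ≤ g.inner x v v)
    {c : C(ℝ, M)} {a b : ℝ} (hab : a ≤ b) (hc : ContMDiffOn 𝓘(ℝ) (𝓡 m) 1 c (Icc a b)) :
    ‖Ψ (arc c a b) - F (c b) + F (c a)‖ₑ ≤ segLength g c a b := by
  let u : ℝ → V := fun t ↦ Ψ (arc c a t) - F (c t)
  have hdiff : Ψ (arc c a b) - F (c b) + F (c a) = u b - u a := by
    simp only [u, hΨ.arc_self, zero_sub, sub_neg_eq_add]
  rw [hdiff, segLength_eq_lintegral]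
  refine (enorm_sub_le_lintegral_deriv_of_contDiffOn_Icc
    (hΨ.contDiffOn_arc_sub hsmooth hc a) hab).trans ?_
  rw [← restrict_Ioo_eq_restrict_Icc]
  refine setLIntegral_mono' measurableSet_Ioo fun t ht ↦ ?_
  obtain ⟨k, hk⟩ := hΨ.exists_isPrimitiveAt m (c t)
  have hct : MDifferentiableAt 𝓘(ℝ) (𝓡 m) c t :=
    ((hc t ⟨ht.1.le, ht.2.le⟩).contMDiffAt (Icc_mem_nhds ht.1 ht.2)).mdifferentiableAt one_ne_zero
  have hderiv : HasDerivAt u (mdiff m (fun z ↦ k z - F z) (c t) (velocity m c t)) t :=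
    ((hasDerivAt_comp_curve ((hsmooth _ k hk).mdifferentiableAt (by simp)) hct).add_const
      _).congr_of_eventuallyEq (hk.eventually_arc_sub_eq hΨ F a)
  rw [hderiv.deriv, ← ofReal_norm]
  exact ENNReal.ofReal_le_ofReal (Real.le_sqrt_of_sq_le (hF _ k hk _))

end Calibration

section ClosedCurves

variable {m : ℕ} {M : Type*} [TopologicalSpace M] [ChartedSpace (EuclideanSpace ℝ (Fin m)) M]
  [IsManifold (𝓡 m) ∞ M] {g : SmoothMetric m M} {V : Type*} [NormedAddCommGroup V]
  [NormedSpace ℝ V] {Ψ : C(unitInterval, M) → V} {F : M → V}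

lemma enorm_le_segLength_of_partition (hΨ : IsPathCocycle Ψ)
    (hsmooth : ∀ x k, IsPrimitiveAt Ψ k x → ContMDiffAt (𝓡 m) 𝓘(ℝ, V) ∞ (fun z ↦ k z - F z) x)
    (hF : ∀ x k, IsPrimitiveAt Ψ k x → ∀ v,
      ‖mdiff m (fun z ↦ k z - F z) x v‖ ^ 2 ≤ g.inner x v v)
    {c : C(ℝ, M)} {t : ℕ → ℝ} (ht : Monotone t) {n : ℕ}
    (hc : ∀ i < n, ContMDiffOn 𝓘(ℝ) (𝓡 m) 1 c (Icc (t i) (t (i + 1)))) :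
    ‖Ψ (arc c (t 0) (t n)) - F (c (t n)) + F (c (t 0))‖ₑ ≤ segLength g c (t 0) (t n) := by
  induction n with
  | zero => simp [hΨ.arc_self]
  | succ n ih =>
    have hsplit : Ψ (arc c (t 0) (t (n + 1))) - F (c (t (n + 1))) + F (c (t 0)) =
        (Ψ (arc c (t 0) (t n)) - F (c (t n)) + F (c (t 0))) +
        (Ψ (arc c (t n) (t (n + 1))) - F (c (t (n + 1))) + F (c (t n))) := by
      rw [← hΨ.arc_add c (t 0) (t n) (t (n + 1))]
      abel
    rw [hsplit, ← segLength_add (ht n.zero_le) (ht n.le_succ)]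
    exact (enorm_add_le _ _).trans (add_le_add (ih fun i hi ↦ hc i (hi.trans n.lt_succ_self))
      (enorm_le_segLength hΨ hsmooth hF (ht n.le_succ) (hc n n.lt_succ_self)))

lemma enorm_le_curveLength (hΨ : IsPathCocycle Ψ)
    (hsmooth : ∀ x k, IsPrimitiveAt Ψ k x → ContMDiffAt (𝓡 m) 𝓘(ℝ, V) ∞ (fun z ↦ k z - F z) x)
    (hF : ∀ x k, IsPrimitiveAt Ψ k x → ∀ v,
      ‖mdiff m (fun z ↦ k z - F z) x v‖ ^ 2 ≤ g.inner x v v)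
    {x : M} {p : Path x x} (hp : IsPiecewiseC1 m p.extend) :
    ‖Ψ p.toContinuousMap‖ₑ ≤ curveLength g p.extend := by
  obtain ⟨-, n, t, ht, ht0, htn, hC1⟩ := hp
  let c : C(ℝ, M) := ⟨p.extend, p.continuous_extend⟩
  have hle := enorm_le_segLength_of_partition (c := c) hΨ hsmooth hF ht hC1
  have harc : arc c 0 1 = p.toContinuousMap := by
    ext s
    simp [c, arc_zero_one_apply]
  have hclosed : c 1 = c 0 := by simp [c]
  rwa [ht0, htn, harc, hclosed, sub_add_cancel] at hle

variable {ι : Type*} {γ : ι → C(ℝ, M)}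

theorem exists_conformal_metric [T2Space M] [SigmaCompactSpace M] [Finite ι]
    (g : SmoothMetric m M) (hΨ : IsPathCocycle Ψ) (hγ : ∀ i, IsEmbeddedLoop m (γ i))
    (hdisj : ∀ i j, i ≠ j → ∀ s t, γ i s ≠ γ j t) (hperiod : ∀ i, Ψ (arc (γ i) 0 1) ≠ 0) :
    ∃ g' : SmoothMetric m M, IsConformalTo g g' ∧
      (∀ (x : M) (p : Path x x), IsPiecewiseC1 m p.extend →
        ‖Ψ p.toContinuousMap‖ₑ ≤ curveLength g' p.extend) ∧
      ∀ i a b, segLength g' (γ i) a b = ‖Ψ (arc (γ i) 0 1)‖ₑ * ENNReal.ofReal (b - a) := by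
  obtain ⟨F, hF⟩ := exists_isAdaptedAt g hΨ hγ hdisj
  obtain ⟨f, hf, hfactor⟩ := exists_conformal_factor (N := normSeminorm ℝ V) hΨ (C := 1)
    (fun v ↦ (one_mul ‖v‖).ge) hγ hdisj hF fun i ↦ norm_pos_iff.2 (hperiod i)
  refine ⟨conformalMetric g f hf fun x ↦ (hfactor x).pos,
    ⟨f, hf, fun x ↦ (hfactor x).pos, fun _ _ _ ↦ rfl⟩, fun x p hp ↦ ?_, fun i a b ↦ ?_⟩
  · exact enorm_le_curveLength (g := conformalMetric g f hf _) hΨ (fun x k hk ↦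
      ((hF x).smooth k hk).self_of_nhds) (fun x ↦ (hfactor x).le) hp
  · rw [segLength_of_inner_velocity_eq (norm_nonneg (Ψ (arc (γ i) 0 1)))
      (fun t ↦ (hfactor (γ i t)).eq i t rfl), ofReal_norm]

end ClosedCurves

/-! ### Joining points by curves of controlled length -/

section Join

variable {m : ℕ} {M : Type u} [TopologicalSpace M] [ChartedSpace (EuclideanSpace ℝ (Fin m)) M]
  [IsManifold (𝓡 m) ∞ M] {A : Type*} [AddCommGroup A]
  {Ψ : C(unitInterval, M) → A} {g : SmoothMetric m M} {x y z : M} {a b : A} {r s : ℝ≥0∞}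

omit [IsManifold (𝓡 m) ∞ M] in
lemma IsPathCocycle.arc_comp (hΨ : IsPathCocycle Ψ) (c : C(ℝ, M)) (σ : C(ℝ, ℝ)) :
    Ψ (arc (c.comp σ) 0 1) = Ψ (arc c (σ 0) (σ 1)) := by
  let Γ : C(ℝ × ℝ, ℝ) :=
    ⟨fun z ↦ (1 - z.1) * ((1 - z.2) * σ 0 + z.2 * σ 1) + z.1 * σ z.2, by fun_prop⟩
  have hΓ (s t : ℝ) : Γ (s, t) = (1 - s) * ((1 - t) * σ 0 + t * σ 1) + s * σ t := rfl
  have hleft (s : ℝ) : Γ (s, 0) = Γ (0, 0) := by simp only [hΓ]; ring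
  have hright (s : ℝ) : Γ (s, 1) = Γ (0, 1) := by simp only [hΓ]; ring
  have hhomotopy := hΨ.eq_of_homotopy (c.comp Γ) (fun s ↦ congrArg c (hleft s))
    fun s ↦ congrArg c (hright s)
  convert hhomotopy.symm using 2
  · ext t
    simp only [ContinuousMap.comp_apply, planeSeg_vertical, hΓ, arc_zero_one_apply]
    congr 1
    ring
  · ext t
    simp only [ContinuousMap.comp_apply, planeSeg_vertical, hΓ, arc_apply]
    congr 1
    ring

/-- There is a flat curve of length at most `r` from `x` to `y` on which the path functional `Ψ`
is `a`. -/
def FlatJoinLE (g : SmoothMetric m M) (Ψ : C(unitInterval, M) → A) (x y : M) (a : A) (r : ℝ≥0∞) :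
    Prop :=
  ∃ c : C(ℝ, M), IsFlatCurve m c x y ∧ Ψ (arc c 0 1) = a ∧ segLength g c 0 1 ≤ r

omit [AddCommGroup A] in
lemma FlatJoinLE.mono (h : FlatJoinLE g Ψ x y a r) (hrs : r ≤ s) : FlatJoinLE g Ψ x y a s := by
  obtain ⟨c, hc, hca, hcr⟩ := h
  exact ⟨c, hc, hca, hcr.trans hrs⟩

lemma segLength_concat {c d Q : C(ℝ, M)} (hc : IsFlatCurve m c x y) (hd : IsFlatCurve m d y z)
    (hQ : IsFlatCurve m Q x z) (hQc : ∀ t < 5 / 9, Q t = c (6 * t - 2))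
    (hQd : ∀ t > 4 / 9, Q t = d (6 * t - 3)) :
    segLength g Q 0 1 = segLength g c 0 1 + segLength g d 0 1 := by
  have initial : segLength g Q 0 (1 / 3) = 0 :=
    segLength_eq_zero_of_eq_const fun t ht ↦ hQ.left t ht.2.le
  have final : segLength g Q (2 / 3) 1 = 0 :=
    segLength_eq_zero_of_eq_const fun t ht ↦ hQ.right t ht.1.le
  have first_half : segLength g Q (1 / 3) (1 / 2) = segLength g c 0 1 := by
    rw [segLength_congr (d := c ∘ fun t ↦ 6 * t - 2) fun t ht ↦ hQc t (by linarith [ht.2]),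
      segLength_comp (by norm_num) (fun u v h ↦ by linarith) (by fun_prop)
        (hc.smooth.mdifferentiable (by simp))]
    norm_num
  have second_half : segLength g Q (1 / 2) (2 / 3) = segLength g d 0 1 := by
    rw [segLength_congr (d := d ∘ fun t ↦ 6 * t - 3) fun t ht ↦ hQd t (by linarith [ht.1]),
      segLength_comp (by norm_num) (fun u v h ↦ by linarith) (by fun_prop)
        (hd.smooth.mdifferentiable (by simp))]
    norm_num
  rw [← segLength_add (b := 1 / 3) (by norm_num) (by norm_num),
    ← segLength_add (a := 1 / 3) (b := 1 / 2) (by norm_num) (by norm_num),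
    ← segLength_add (a := 1 / 2) (b := 2 / 3) (by norm_num) (by norm_num),
    initial, first_half, second_half, final, zero_add, add_zero]

lemma FlatJoinLE.trans (hΨ : IsPathCocycle Ψ) (hxy : FlatJoinLE g Ψ x y a r)
    (hyz : FlatJoinLE g Ψ y z b s) : FlatJoinLE g Ψ x z (a + b) (r + s) := by
  obtain ⟨c, hc, rfl, hcr⟩ := hxy
  obtain ⟨d, hd, rfl, hds⟩ := hyz
  obtain ⟨Q, hQ, hQc, hQd⟩ := hc.exists_trans hd
  exact ⟨Q, hQ, hΨ.arc_concat hQ hQc hQd,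
    (segLength_concat hc hd hQ hQc hQd).trans_le (add_le_add hcr hds)⟩

lemma exists_flatJoinLE (g : SmoothMetric m M) (hΨ : IsPathCocycle Ψ) (p : Path x y) :
    ∃ r < ⊤, FlatJoinLE g Ψ x y (Ψ p.toContinuousMap) r := by
  have hjoin := flatJoin_of_path (m := m) hΨ p.toContinuousMap
  rw [show p.toContinuousMap 0 = x from p.source, show p.toContinuousMap 1 = y from p.target]
    at hjoin
  obtain ⟨c, hc, hcp⟩ := hjoin
  exact ⟨_, segLength_lt_top g hc.smooth 0 1, c, hc, hcp, le_rfl⟩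

lemma IsSmoothLoop.flatJoinLE (g : SmoothMetric m M) (hΨ : IsPathCocycle Ψ) {c : C(ℝ, M)}
    (hc : IsSmoothLoop m c) (n : ℕ) :
    FlatJoinLE g Ψ (c 0) (c 0) (n • Ψ (arc c 0 1)) (segLength g c 0 n) := by
  have hσ : ContDiff ℝ ∞ fun t : ℝ ↦ n * Real.smoothTransition (3 * t - 1) :=
    contDiff_const.mul (Real.smoothTransition.contDiff.comp (by fun_prop))
  let σ : C(ℝ, ℝ) := ⟨fun t ↦ n * Real.smoothTransition (3 * t - 1), hσ.continuous⟩
  have hσ_left (t : ℝ) (ht : t ≤ 1 / 3) : σ t = 0 := by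
    simp [σ, Real.smoothTransition.zero_of_nonpos (show 3 * t - 1 ≤ 0 by linarith)]
  have hσ_right (t : ℝ) (ht : 2 / 3 ≤ t) : σ t = n := by
    simp [σ, Real.smoothTransition.one_of_one_le (show 1 ≤ 3 * t - 1 by linarith)]
  have hσ_mono : Monotone σ := fun u v h ↦ mul_le_mul_of_nonneg_left
    (Real.smoothTransition.monotone (by linarith)) n.cast_nonneg
  have hclosed : c n = c 0 := by simpa using hc.add_int 0 n
  have hσ_zero : σ 0 = 0 := hσ_left 0 (by norm_num)
  have hσ_one : σ 1 = n := hσ_right 1 (by norm_num)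
  refine ⟨c.comp σ, ⟨hc.smooth.comp hσ.contMDiff, fun t ht ↦ congrArg c (hσ_left t ht),
    fun t ht ↦ (congrArg c (hσ_right t ht)).trans hclosed⟩, ?_, ?_⟩
  · rw [hΨ.arc_comp, hσ_zero, hσ_one, ← natCast_zsmul, ← hΨ.arc_int hc.periodic, Int.cast_natCast]
  · have hlength := segLength_comp (g := g) zero_le_one hσ_mono (hσ.differentiable (by simp))
      (hc.smooth.mdifferentiable (by simp))
    rw [hσ_zero, hσ_one] at hlength
    exact hlength.le

lemma exists_flatJoinLE_sum [PathConnectedSpace M] (g : SmoothMetric m M) (hΨ : IsPathCocycle Ψ)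
    {ι : Type*} (T : Finset ι) {γ : ι → C(ℝ, M)} (hγ : ∀ i, IsSmoothLoop m (γ i)) (x : M) :
    ∃ R < ⊤, ∀ k : ι → ℕ, FlatJoinLE g Ψ x x (∑ i ∈ T, k i • Ψ (arc (γ i) 0 1))
      (∑ i ∈ T, segLength g (γ i) 0 (k i) + R) := by
  classical
  induction T using Finset.induction_on with
  | empty =>
    obtain ⟨r, hr, hconst⟩ := exists_flatJoinLE g hΨ (Path.refl x)
    have hzero : Ψ (Path.refl x).toContinuousMap = 0 := hΨ.const x
    exact ⟨r, hr, fun k ↦ by simpa only [Finset.sum_empty, zero_add, hzero] using hconst⟩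
  | insert i T hi ih =>
    obtain ⟨R, hR, hT⟩ := ih
    let p : Path x (γ i 0) := PathConnectedSpace.somePath x (γ i 0)
    obtain ⟨r₁, hr₁, hgo⟩ := exists_flatJoinLE g hΨ p
    obtain ⟨r₂, hr₂, hback⟩ := exists_flatJoinLE g hΨ p.symm
    refine ⟨r₁ + r₂ + R, by simp [hr₁, hr₂, hR], fun k ↦ ?_⟩
    have hround := ((hgo.trans hΨ ((hγ i).flatJoinLE g hΨ (k i))).trans hΨ hback).trans hΨ (hT k)
    rw [hΨ.symm, add_neg_cancel_comm] at hround
    rw [Finset.sum_insert hi, Finset.sum_insert hi]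
    refine hround.mono (le_of_eq ?_)
    ring

end Join

section MinLength

variable {m : ℕ} {M : Type u} [TopologicalSpace M] [ChartedSpace (EuclideanSpace ℝ (Fin m)) M]
  [IsManifold (𝓡 m) ∞ M] {Ψ : C(unitInterval, M) → realH1 M} {g : SmoothMetric m M} {x : M}
  {v : realH1 M} {r : ℝ≥0∞}

omit [IsManifold (𝓡 m) ∞ M] in
lemma isPiecewiseC1_of_contMDiffOn {c : ℝ → M} (hc : ContMDiffOn 𝓘(ℝ) (𝓡 m) 1 c (Icc 0 1)) :
    IsPiecewiseC1 m c := by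
  refine ⟨hc.continuousOn, 1, fun k ↦ k, Nat.mono_cast, Nat.cast_zero, Nat.cast_one, ?_⟩
  intro i hi
  obtain rfl : i = 0 := Nat.lt_one_iff.1 hi
  simpa using hc

lemma FlatJoinLE.minLength_le (hΨ : ∀ x (γ : Path x x), Ψ γ.toContinuousMap = loopClass γ)
    (h : FlatJoinLE g Ψ x x v r) : minLength g v ≤ r := by
  obtain ⟨c, hc, rfl, hcr⟩ := h
  let p : Path x x := ⟨arc c 0 1, by simp [arc_apply, hc.left 0],
    by simp [arc_apply, hc.right 1 (by norm_num)]⟩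
  have hp : EqOn p.extend c (Icc 0 1) := fun t ht ↦ by
    rw [p.extend_apply ht]
    exact arc_zero_one_apply c ⟨t, ht⟩
  have hpiecewise : IsPiecewiseC1 m p.extend := isPiecewiseC1_of_contMDiffOn
    ((hc.smooth.of_le (by exact_mod_cast le_top)).contMDiffOn.congr hp)
  calc minLength g (Ψ (arc c 0 1)) ≤ curveLength g p.extend :=
        iInf₂_le_of_le x p (iInf₂_le_of_le hpiecewise (hΨ x p).symm le_rfl)
    _ = segLength g c 0 1 := segLength_congr (g := g) fun t ht ↦ hp ⟨ht.1.le, ht.2.le⟩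
    _ ≤ r := hcr

end MinLength

/-! ### Centrally symmetric polytopes -/

section Seminorm

variable {E : Type*} [AddCommGroup E] [Module ℝ E] {ι : Type*} [Fintype ι] {z : ι → E} {w : ι → ℝ}

omit [Fintype ι] in
lemma exists_pos_forall_sub_mul_pos [Finite ι] (hw : ∀ i, 0 < w i) (c : ι → ℝ) :
    ∃ ε > 0, ∀ i, 0 < w i - ε * c i := by
  have hnear : ∀ᶠ ε in 𝓝 (0 : ℝ), ∀ i, 0 < w i - ε * c i := eventually_all.2 fun i ↦
    (show ContinuousAt (fun ε : ℝ ↦ w i - ε * c i) 0 by fun_prop).eventually_const_lt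
      (by simpa using hw i)
  obtain ⟨ε, hε, hpos⟩ :=
    ((hnear.filter_mono nhdsWithin_le_nhds).and (self_mem_nhdsWithin (s := Ioi (0 : ℝ)))).exists
  exact ⟨ε, hpos, hε⟩

lemma sum_nonpos_of_sum_smul_eq_zero (N : Seminorm ℝ E) (hz : ∀ i, N (z i) ≤ 1)
    (hw : ∀ i, 0 < w i) (hN : ∑ i, w i ≤ N (∑ i, w i • z i)) {c : ι → ℝ}
    (hc : ∑ i, c i • z i = 0) : ∑ i, c i ≤ 0 := by
  obtain ⟨ε, hε, hpos⟩ := exists_pos_forall_sub_mul_pos hw c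
  have hperturb : ∑ i, w i • z i = ∑ i, (w i - ε * c i) • z i := by
    simp only [sub_smul, Finset.sum_sub_distrib, mul_smul, ← Finset.smul_sum, hc, smul_zero,
      sub_zero]
  have hle : ∑ i, w i ≤ ∑ i, w i - ε * ∑ i, c i := calc
    ∑ i, w i ≤ N (∑ i, (w i - ε * c i) • z i) := hperturb ▸ hN
    _ ≤ ∑ i, N ((w i - ε * c i) • z i) :=
      Finset.le_sum_of_subadditive N (map_zero N).le (map_add_le_add N) _ _
    _ ≤ ∑ i, (w i - ε * c i) := Finset.sum_le_sum fun i _ ↦ by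
      rw [map_smul_eq_mul, Real.norm_of_nonneg (hpos i).le]
      exact mul_le_of_le_one_right (hpos i).le (hz i)
    _ = ∑ i, w i - ε * ∑ i, c i := by rw [Finset.sum_sub_distrib, Finset.mul_sum]
  exact nonpos_of_mul_nonpos_right (by linarith) hε

lemma linearIndependent_of_sum_le_seminorm (hai : AffineIndependent ℝ z) (N : Seminorm ℝ E)
    (hz : ∀ i, N (z i) ≤ 1) (hw : ∀ i, 0 < w i)
    (hN : ∑ i, w i ≤ N (∑ i, w i • z i)) : LinearIndependent ℝ z := by
  rw [Fintype.linearIndependent_iff]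
  intro c hc i
  have hnonpos := sum_nonpos_of_sum_smul_eq_zero N hz hw hN hc
  have hnonneg := sum_nonpos_of_sum_smul_eq_zero N hz hw hN (c := -c) (by simp [hc])
  have hsum : ∑ i, c i = 0 := le_antisymm hnonpos (by simpa using hnonneg)
  exact hai.eq_zero_of_sum_eq_zero hsum hc i (Finset.mem_univ i)

end Seminorm

section FiniteDimensional

variable {E : Type*} [AddCommGroup E] [Module ℝ E] [TopologicalSpace E] [IsModuleTopology ℝ E]
  [FiniteDimensional ℝ E]

lemma nonempty_continuousLinearEquiv_euclideanSpace :
    Nonempty (E ≃L[ℝ] EuclideanSpace ℝ (Fin (Module.finrank ℝ E))) := by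
  have := IsModuleTopology.topologicalAddGroup ℝ E
  let e : E ≃ₗ[ℝ] EuclideanSpace ℝ (Fin (Module.finrank ℝ E)) :=
    LinearEquiv.ofFinrankEq _ _ finrank_euclideanSpace_fin.symm
  exact ⟨⟨e, IsModuleTopology.continuous_of_linearMap e.toLinearMap,
    LinearMap.continuous_of_finiteDimensional e.symm.toLinearMap⟩⟩

lemma t2Space_of_isModuleTopology : T2Space E :=
  let ⟨e⟩ := nonempty_continuousLinearEquiv_euclideanSpace (E := E)
  e.toHomeomorph.symm.t2Space

lemma locallyConvexSpace_of_isModuleTopology : LocallyConvexSpace ℝ E :=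
  let ⟨e⟩ := nonempty_continuousLinearEquiv_euclideanSpace (E := E)
  e.toHomeomorph.isInducing.locallyConvexSpace (f := e.toLinearMap)

end FiniteDimensional

section UnitBall

variable {E : Type*} [AddCommGroup E] [Module ℝ E] [TopologicalSpace E] [IsTopologicalAddGroup E]
  [ContinuousSMul ℝ E] {K : Set E}

lemma mem_nhds_zero_of_convex_of_neg_eq (hK : Convex ℝ K) (hsymm : -K = K)
    (hint : (interior K).Nonempty) : K ∈ 𝓝 0 := by
  obtain ⟨z, hz⟩ := hint
  have hneg : -z ∈ interior K := by
    have hinterior : -interior K = interior K :=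
      ((Homeomorph.neg E).preimage_interior K).trans (congrArg interior hsymm)
    rwa [← hinterior, Set.neg_mem_neg]
  have hmid := hK.interior.midpoint_mem hz hneg
  rw [midpoint_self_neg] at hmid
  exact mem_interior_iff_mem_nhds.1 hmid

theorem exists_seminorm_le_one_iff_mem [T2Space E] (hconv : Convex ℝ K) (hcomp : IsCompact K)
    (hsymm : -K = K) (hint : (interior K).Nonempty) :
    ∃ N : Seminorm ℝ E, (∀ u, N u = 0 → u = 0) ∧ ∀ u, N u ≤ 1 ↔ u ∈ K := by
  have hnhds : K ∈ 𝓝 0 := mem_nhds_zero_of_convex_of_neg_eq hconv hsymm hint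
  have habs : Absorbent ℝ K := absorbent_nhds_zero hnhds
  have hbal : Balanced ℝ K := (balanced_iff_neg_mem hconv).2 fun x hx ↦ by
    rwa [← hsymm, Set.neg_mem_neg]
  refine ⟨gaugeSeminorm hbal hconv habs,
    fun u ↦ (gauge_eq_zero habs (hcomp.isVonNBounded (𝕜 := ℝ))).1, fun u ↦ ?_⟩
  exact (gauge_le_one_iff_mem_closure hconv hnhds).trans (by rw [hcomp.isClosed.closure_eq])

lemma convexHull_extremePoints_of_finite [T2Space E] [LocallyConvexSpace ℝ E] {S : Set E}
    (hS : S.Finite) : convexHull ℝ ((convexHull ℝ S).extremePoints ℝ) = convexHull ℝ S := by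
  rw [← ((hS.subset extremePoints_convexHull_subset).isClosed_convexHull ℝ).closure_eq]
  exact closure_convexHull_extremePoints (hS.isCompact_convexHull ℝ) (convex_convexHull ℝ S)

lemma finite_of_nonempty_interior_convexHull {S : Set E} (hS : S.Finite)
    (hint : (interior (convexHull ℝ S)).Nonempty) : Module.Finite ℝ E := by
  have hspan : convexHull ℝ S ⊆ Submodule.span ℝ S :=
    convexHull_min Submodule.subset_span (Submodule.span ℝ S).convex
  exact ⟨Submodule.fg_def.2 ⟨S, hS, Submodule.eq_top_of_nonempty_interior' _
    (hint.mono (interior_mono hspan))⟩⟩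

end UnitBall

section Decomposition

universe v

variable {E : Type v} [AddCommGroup E] [Module ℝ E] {K : Set E} {N : Seminorm ℝ E}

/-- The points `z k` are vertices of one face of `K`, on the cone over which `N` is linear. -/
lemma exists_eq_sum_extremePoints (hK : convexHull ℝ (K.extremePoints ℝ) = K)
    (hdef : ∀ u, N u = 0 → u = 0) (hball : ∀ u, N u ≤ 1 ↔ u ∈ K) (v : E) :
    ∃ (κ : Type v) (_ : Fintype κ) (z : κ → E) (a : κ → ℝ), (∀ k, z k ∈ K.extremePoints ℝ) ∧
      LinearIndependent ℝ z ∧ (∀ k, 0 ≤ a k) ∧ ∑ k, a k • z k = v ∧ ∑ k, a k = N v := by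
  rcases eq_or_ne v 0 with rfl | hv
  · exact ⟨PEmpty, inferInstance, PEmpty.elim, PEmpty.elim, by simp, linearIndependent_empty_type,
      by simp, by simp, by simp⟩
  have hNv : 0 < N v := (apply_nonneg N v).lt_of_ne' fun h ↦ hv (hdef v h)
  have hunit : N ((N v)⁻¹ • v) = 1 := by
    rw [map_smul_eq_mul, Real.norm_of_nonneg (inv_nonneg.2 hNv.le), inv_mul_cancel₀ hNv.ne']
  have hmem : (N v)⁻¹ • v ∈ convexHull ℝ (K.extremePoints ℝ) := by
    rw [hK, ← hball, hunit]
  obtain ⟨κ, _, z, w, hz, hai, hw, hw_sum, hwz⟩ := eq_pos_convex_span_of_mem_convexHull hmem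
  have hind : LinearIndependent ℝ z := linearIndependent_of_sum_le_seminorm hai N
    (fun k ↦ (hball _).2 (extremePoints_subset (hz ⟨k, rfl⟩))) hw (by rw [hwz, hunit, hw_sum])
  refine ⟨κ, ‹_›, z, fun k ↦ N v * w k, fun k ↦ hz ⟨k, rfl⟩, hind,
    fun k ↦ mul_nonneg hNv.le (hw k).le, ?_, ?_⟩
  · simp only [mul_smul, ← Finset.smul_sum, hwz, smul_inv_smul₀ hNv.ne']
  · rw [← Finset.mul_sum, hw_sum, mul_one]

theorem exists_eq_sum_of_extremePoints_eq_smul (hK : convexHull ℝ (K.extremePoints ℝ) = K)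
    (hdef : ∀ u, N u = 0 → u = 0) (hball : ∀ u, N u ≤ 1 ↔ u ∈ K) {ι : Type*} {w : ι → E}
    (hw : ∀ s ∈ K.extremePoints ℝ, s ≠ 0 → ∃ i, ∃ c : ℝ, 0 < c ∧ s = c • w i) (v : E) :
    ∃ (κ : Type v) (_ : Fintype κ) (σ : κ → ι) (b : κ → ℝ), LinearIndependent ℝ (w ∘ σ) ∧
      (∀ k, 0 ≤ b k) ∧ ∑ k, b k • w (σ k) = v ∧ ∑ k, b k * N (w (σ k)) ≤ N v := by
  obtain ⟨κ, _, z, a, hz, hind, ha, rfl, hsum⟩ := exists_eq_sum_extremePoints hK hdef hball v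
  choose σ c hc hzw using fun k ↦ hw (z k) (hz k) (hind.ne_zero k)
  have hNz (k : κ) : c k * N (w (σ k)) ≤ 1 := calc
    c k * N (w (σ k)) = N (z k) := by
      rw [hzw, map_smul_eq_mul, Real.norm_of_nonneg (hc k).le]
    _ ≤ 1 := (hball _).2 (extremePoints_subset (hz k))
  refine ⟨κ, ‹_›, σ, fun k ↦ a k * c k, ?_, fun k ↦ mul_nonneg (ha k) (hc k).le, ?_, ?_⟩
  · refine (LinearIndependent.units_smul_iff _ fun k ↦ Units.mk0 (c k) (hc k).ne').1 ?_
    convert hind using 1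
    exact funext fun k ↦ (hzw k).symm
  · exact Finset.sum_congr rfl fun k _ ↦ by rw [mul_smul, ← hzw]
  · rw [← hsum]
    refine Finset.sum_le_sum fun k _ ↦ ?_
    rw [mul_assoc]
    exact mul_le_of_le_one_right (ha k) (hNz k)

end Decomposition

theorem exists_seminorm_of_polytope {E : Type*} [AddCommGroup E] [Module ℝ E]
    [TopologicalSpace E] [IsModuleTopology ℝ E] {S : Set E}
    (hS : S.Finite) (hsymm : -convexHull ℝ S = convexHull ℝ S)
    (hint : (interior (convexHull ℝ S)).Nonempty) :
    convexHull ℝ ((convexHull ℝ S).extremePoints ℝ) = convexHull ℝ S ∧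
      ∃ N : Seminorm ℝ E, (∀ u, N u = 0 → u = 0) ∧ ∀ u, N u ≤ 1 ↔ u ∈ convexHull ℝ S := by
  have := IsModuleTopology.topologicalAddGroup ℝ E
  have := IsModuleTopology.toContinuousSMul ℝ E
  have := finite_of_nonempty_interior_convexHull hS hint
  have := t2Space_of_isModuleTopology (E := E)
  have := locallyConvexSpace_of_isModuleTopology (E := E)
  exact ⟨convexHull_extremePoints_of_finite hS, exists_seminorm_le_one_iff_mem
    (convex_convexHull ℝ S) (hS.isCompact_convexHull ℝ) hsymm hint⟩

/-! ### The stable norm of the conformal metric -/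

lemma exists_common_denominator {ι : Type*} [Finite ι] {b : ι → ℝ} (hrat : ∀ i, ∃ q : ℚ, b i = q)
    (hb : ∀ i, 0 ≤ b i) : ∃ D : ℕ, 0 < D ∧ ∃ k : ι → ℕ, ∀ i, D * b i = k i := by
  cases nonempty_fintype ι
  choose q hq using hrat
  have hq_nonneg (i : ι) : 0 ≤ q i := by exact_mod_cast hq i ▸ hb i
  lift q to ι → ℚ≥0 using hq_nonneg
  refine ⟨∏ i, (q i).den, Finset.prod_pos fun i _ ↦ (q i).den_pos, ?_⟩
  choose e he using fun i ↦ Finset.dvd_prod_of_mem (fun j ↦ (q j).den) (Finset.mem_univ i)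
  refine ⟨fun i ↦ e i * (q i).num, fun i ↦ ?_⟩
  have hden : ((q i).den : ℝ) * (q i : ℝ) = (q i).num := by
    exact_mod_cast congrArg (NNRat.cast (K := ℝ)) (NNRat.den_mul_eq_num (q i))
  rw [hq, he i]
  push_cast
  rw [mul_right_comm, hden, mul_comm]

lemma tendsto_div_of_bounded_excess {f : ℕ → ℝ≥0∞} {r : ℝ} {R : ℝ≥0∞} (hR : R < ⊤)
    (hlower : ∀ n : ℕ, ENNReal.ofReal (n * r) ≤ f n)
    (hupper : ∀ n : ℕ, f n ≤ ENNReal.ofReal (n * r) + R) :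
    Tendsto (fun n : ℕ ↦ f n / n) atTop (𝓝 (ENNReal.ofReal r)) := by
  have hdiv (n : ℕ) (hn : n ≠ 0) : ENNReal.ofReal (n * r) / n = ENNReal.ofReal r := by
    rw [ENNReal.ofReal_mul n.cast_nonneg, ENNReal.ofReal_natCast, mul_comm]
    exact ENNReal.mul_div_cancel_right (by exact_mod_cast hn) (ENNReal.natCast_ne_top n)
  have hexcess : Tendsto (fun n : ℕ ↦ R / (n : ℝ≥0∞)) atTop (𝓝 0) := by
    simpa using ENNReal.Tendsto.const_div ENNReal.tendsto_nat_nhds_top (Or.inr hR.ne)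
  have hbound : Tendsto (fun n : ℕ ↦ ENNReal.ofReal r + R / n) atTop (𝓝 (ENNReal.ofReal r)) := by
    simpa using tendsto_const_nhds.add hexcess
  refine tendsto_of_tendsto_of_tendsto_of_le_of_le' tendsto_const_nhds hbound ?_ ?_
  all_goals filter_upwards [eventually_ne_atTop 0] with n hn
  · exact hdiv n hn ▸ ENNReal.div_le_div_right (hlower n) _
  · rw [← hdiv n hn, ← ENNReal.add_div]
    exact ENNReal.div_le_div_right (hupper n) _

lemma sum_nsmul_add_mod_nsmul {V : Type*} [AddCommGroup V] [Module ℝ V] {ι : Type*} [Fintype ι]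
    {w : ι → V} {b : ι → ℝ} {v : V} {D : ℕ} {k : ι → ℕ} (hv : ∑ i, b i • w i = v)
    (hk : ∀ i, D * b i = k i) (n : ℕ) : ∑ i, (n / D * k i) • w i + (n % D) • v = n • v := by
  have hmultiple : ∑ i, k i • w i = D • v := by
    rw [← hv, Finset.smul_sum]
    refine Finset.sum_congr rfl fun i _ ↦ ?_
    rw [← Nat.cast_smul_eq_nsmul ℝ, ← Nat.cast_smul_eq_nsmul ℝ, smul_smul, hk]
  simp only [mul_smul, ← Finset.smul_sum]
  rw [hmultiple, ← mul_smul, ← add_smul, Nat.div_add_mod']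

section Seminorm

variable {m : ℕ} {M : Type*} [TopologicalSpace M] [ChartedSpace (EuclideanSpace ℝ (Fin m)) M]
  [IsManifold (𝓡 m) ∞ M] [T2Space M] [SigmaCompactSpace M] {V : Type*} [AddCommGroup V]
  [Module ℝ V] {Ψ : C(unitInterval, M) → V} {ι : Type*} {γ : ι → C(ℝ, M)} {w : ι → V}

theorem exists_conformal_metric_seminorm [Finite ι] (g : SmoothMetric m M) (N : Seminorm ℝ V)
    (hdef : ∀ u, N u = 0 → u = 0) (hΨ : IsPathCocycle Ψ) (hγ : ∀ i, IsEmbeddedLoop m (γ i))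
    (hdisj : ∀ i j, i ≠ j → ∀ s t, γ i s ≠ γ j t) (hγw : ∀ i, Ψ (arc (γ i) 0 1) = w i)
    (hw : ∀ i, w i ≠ 0) :
    ∃ g' : SmoothMetric m M, IsConformalTo g g' ∧
      (∀ (x : M) (p : Path x x), IsPiecewiseC1 m p.extend →
        ENNReal.ofReal (N (Ψ p.toContinuousMap)) ≤ curveLength g' p.extend) ∧
      ∀ i a b, segLength g' (γ i) a b = ENNReal.ofReal (N (w i)) * ENNReal.ofReal (b - a) := by
  obtain rfl : (fun i ↦ Ψ (arc (γ i) 0 1)) = w := funext hγw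
  let norm : AddGroupNorm V := { N.toAddGroupSeminorm with eq_zero_of_map_eq_zero' := hdef }
  let _ : NormedAddCommGroup V := norm.toNormedAddCommGroup
  let _ : NormedSpace ℝ V := { norm_smul_le := fun a v ↦ (map_smul_eq_mul N a v).le }
  have hnorm (v : V) : ‖v‖ₑ = ENNReal.ofReal (N v) := (ofReal_norm v).symm
  simpa only [hnorm] using exists_conformal_metric g hΨ hγ hdisj hw

end Seminorm

section Stable

variable {m : ℕ} {M : Type u} [TopologicalSpace M] [ChartedSpace (EuclideanSpace ℝ (Fin m)) M]
  [IsManifold (𝓡 m) ∞ M] {Ψ : C(unitInterval, M) → realH1 M} {g : SmoothMetric m M}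
  {N : Seminorm ℝ (realH1 M)} {v : realH1 M}

lemma exists_disjoint_embedded_of_isIntegralClass [T2Space M] [PathConnectedSpace M] (hm : 3 ≤ m)
    (hΨ : IsPathCocycle Ψ) (hΨl : ∀ x (γ : Path x x), Ψ γ.toContinuousMap = loopClass γ)
    {ι : Type*} [Finite ι] {w : ι → realH1 M} (hw : ∀ i, IsIntegralClass (w i)) :
    ∃ γ : ι → C(ℝ, M), (∀ i, IsEmbeddedLoop m (γ i)) ∧ (∀ i, Ψ (arc (γ i) 0 1) = w i) ∧
      ∀ i j, i ≠ j → ∀ s t, γ i s ≠ γ j t := by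
  choose p hp using fun i ↦ (hw i).exists_loop (Classical.arbitrary M)
  obtain ⟨γ, hγ, hγp, hdisj⟩ := exists_disjoint_embedded hm hΨ p
  exact ⟨γ, hγ, fun i ↦ by rw [hγp, hΨl, hp], hdisj⟩

lemma FlatJoinLE.nsmul {A : Type*} [AddCommGroup A] {Ψ : C(unitInterval, M) → A} {x : M} {a : A}
    {r s : ℝ≥0∞} (hΨ : IsPathCocycle Ψ) (hzero : FlatJoinLE g Ψ x x 0 s)
    (h : FlatJoinLE g Ψ x x a r) (n : ℕ) : FlatJoinLE g Ψ x x (n • a) (s + n * r) := by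
  induction n with
  | zero => simpa using hzero
  | succ n ih =>
    rw [succ_nsmul]
    refine (ih.trans hΨ h).mono (le_of_eq ?_)
    push_cast
    ring

lemma ofReal_mul_le_minLength (hlower : ∀ (x : M) (p : Path x x), IsPiecewiseC1 m p.extend →
      ENNReal.ofReal (N (loopClass p)) ≤ curveLength g p.extend) (v : realH1 M) (n : ℕ) :
    ENNReal.ofReal (n * N v) ≤ minLength g (n • v) := by
  refine le_iInf fun x ↦ le_iInf fun p ↦ le_iInf fun hp ↦ le_iInf fun hpv ↦ ?_
  have hle := hlower x p hp
  rwa [hpv, ← Nat.cast_smul_eq_nsmul ℝ, map_smul_eq_mul, Real.norm_natCast] at hle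

variable {ι : Type*} [Fintype ι] {γ : ι → C(ℝ, M)} {w : ι → realH1 M} {b : ι → ℝ} {D : ℕ}
  {k : ι → ℕ}

lemma sum_segLength_le
    (hlength : ∀ i a b, segLength g (γ i) a b = ENNReal.ofReal (N (w i)) * ENNReal.ofReal (b - a))
    (hb : ∀ i, 0 ≤ b i) (hN : ∑ i, b i * N (w i) ≤ N v) (hk : ∀ i, D * b i = k i) (q : ℕ) :
    ∑ i, segLength g (γ i) 0 ((q * k i : ℕ) : ℝ) ≤ ENNReal.ofReal ((q * D : ℕ) * N v) := by
  have hterm (i : ι) : segLength g (γ i) 0 ((q * k i : ℕ) : ℝ) =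
      ENNReal.ofReal ((q * D : ℕ) * (b i * N (w i))) := by
    rw [hlength, sub_zero, ← ENNReal.ofReal_mul (apply_nonneg N _)]
    congr 1
    push_cast
    rw [← hk]
    ring
  simp only [hterm]
  rw [← ENNReal.ofReal_sum_of_nonneg fun i _ ↦ mul_nonneg (Nat.cast_nonneg _)
    (mul_nonneg (hb i) (apply_nonneg N _)), ← Finset.mul_sum]
  exact ENNReal.ofReal_le_ofReal (mul_le_mul_of_nonneg_left hN (Nat.cast_nonneg _))

/-- A common denominator `D` of the coefficients makes `D • v` a combination of the loops with
natural coefficients; a loop in the class `v` takes care of the remainder modulo `D`. -/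
theorem exists_minLength_le [PathConnectedSpace M] (hΨ : IsPathCocycle Ψ)
    (hΨl : ∀ x (γ : Path x x), Ψ γ.toContinuousMap = loopClass γ) (hγ : ∀ i, IsSmoothLoop m (γ i))
    (hγw : ∀ i, Ψ (arc (γ i) 0 1) = w i)
    (hlength : ∀ i a b, segLength g (γ i) a b = ENNReal.ofReal (N (w i)) * ENNReal.ofReal (b - a))
    (hw : ∀ i, IsIntegralClass (w i)) (hind : LinearIndependent ℝ w) (hb : ∀ i, 0 ≤ b i)
    (hv : IsIntegralClass v) (hvb : ∑ i, b i • w i = v) (hN : ∑ i, b i * N (w i) ≤ N v) :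
    ∃ R < ⊤, ∀ n : ℕ, minLength g (n • v) ≤ ENNReal.ofReal (n * N v) + R := by
  let x₀ : M := Classical.arbitrary M
  have hrat (i : ι) : ∃ q : ℚ, b i = q := IsIntegralClass.exists_rat_coeff hw
    (by rwa [Finset.coe_univ, linearIndepOn_univ_iff]) (hvb ▸ hv) i (Finset.mem_univ i)
  obtain ⟨D, hD, k, hk⟩ := exists_common_denominator hrat hb
  obtain ⟨R, hR, hloops⟩ := exists_flatJoinLE_sum g hΨ Finset.univ hγ x₀
  obtain ⟨p, hp⟩ := hv.exists_loop x₀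
  obtain ⟨r, hr, hjoin⟩ := exists_flatJoinLE g hΨ p
  obtain ⟨r₀, hr₀, hconst⟩ := exists_flatJoinLE g hΨ (Path.refl x₀)
  have hzero : Ψ (Path.refl x₀).toContinuousMap = 0 := hΨ.const x₀
  rw [hzero] at hconst
  rw [hΨl, hp] at hjoin
  simp only [hγw] at hloops
  refine ⟨R + (r₀ + D * r), by simp [hR, hr₀, ENNReal.mul_lt_top, hr], fun n ↦ ?_⟩
  have hn := (hloops fun i ↦ n / D * k i).trans hΨ (hconst.nsmul hΨ hjoin (n % D))
  rw [sum_nsmul_add_mod_nsmul hvb hk] at hn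
  have hlong : ∑ i, segLength g (γ i) 0 ((n / D * k i : ℕ) : ℝ) ≤ ENNReal.ofReal (n * N v) :=
    (sum_segLength_le hlength hb hN hk (n / D)).trans <| ENNReal.ofReal_le_ofReal <|
      mul_le_mul_of_nonneg_right (by exact_mod_cast Nat.div_mul_le_self n D) (apply_nonneg N v)
  have hrem : ((n % D : ℕ) : ℝ≥0∞) ≤ D := by exact_mod_cast (Nat.mod_lt n hD).le
  calc minLength g (n • v)
    _ ≤ _ := hn.minLength_le hΨl
    _ ≤ ENNReal.ofReal (n * N v) + R + (r₀ + D * r) := by gcongr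
    _ = ENNReal.ofReal (n * N v) + (R + (r₀ + D * r)) := add_assoc _ _ _

end Stable

end

theorem mainTheorem3_general {m : ℕ} (hm : 3 ≤ m) {M : Type u} [TopologicalSpace M] [T2Space M]
    [SigmaCompactSpace M] [ConnectedSpace M] [ChartedSpace (EuclideanSpace ℝ (Fin m)) M]
    [IsManifold (𝓡 m) ∞ M] (g : SmoothMetric m M)
    (K : Set (realH1 M)) (hK : ∃ S : Set (realH1 M), S.Finite ∧ K = convexHull ℝ S)
    (hsymm : -K = K) (hint : (interior K).Nonempty)
    (hrat : ∀ s ∈ K.extremePoints ℝ, HasRationalDirection s) :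
    ∃ g' : SmoothMetric m M, IsConformalTo g g' ∧
      ∃ N : Seminorm ℝ (realH1 M), IsStableNorm g' N ∧ {u | N u ≤ 1} = K := by
  have : LocallyPathConnectedSpace M :=
    ChartedSpace.locallyPathConnectedSpace (EuclideanSpace ℝ (Fin m)) M
  have : PathConnectedSpace M := pathConnectedSpace_iff_connectedSpace.2 inferInstance
  obtain ⟨S, hS, rfl⟩ := hK
  obtain ⟨hvertices, N, hdef, hball⟩ := exists_seminorm_of_polytope hS hsymm hint
  obtain ⟨Ψ, hΨ, hΨl⟩ := exists_isPathCocycle_eq_loopClass (M := M)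
  have : Finite ((convexHull ℝ S).extremePoints ℝ \ {0} : Set (realH1 M)) :=
    hS.subset (sdiff_subset.trans extremePoints_convexHull_subset)
  choose w c hw hc hwc using fun s : ((convexHull ℝ S).extremePoints ℝ \ {0} : Set (realH1 M)) ↦
    (hrat s s.2.1).exists_pos_smul s.2.2
  have hw_ne (s) : w s ≠ 0 := fun h ↦ s.2.2 (by simp [hwc s, h])
  obtain ⟨γ, hγ, hγw, hdisj⟩ := exists_disjoint_embedded_of_isIntegralClass hm hΨ hΨl hw
  obtain ⟨g', hg', hlower, hlength⟩ :=
    exists_conformal_metric_seminorm g N hdef hΨ hγ hdisj hγw hw_ne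
  refine ⟨g', hg', N, ⟨hdef, fun v hv ↦ ?_⟩, Set.ext hball⟩
  obtain ⟨κ, _, σ, b, hind, hb, hvb, hN⟩ := exists_eq_sum_of_extremePoints_eq_smul hvertices hdef
    hball (w := w) (fun s hs hs0 ↦ ⟨⟨s, hs, hs0⟩, c _, hc _, hwc ⟨s, hs, hs0⟩⟩) v
  obtain ⟨R, hR, hupper⟩ := exists_minLength_le hΨ hΨl (fun i ↦ (hγ (σ i)).toIsSmoothLoop)
    (fun i ↦ hγw (σ i)) (fun i ↦ hlength (σ i)) (fun i ↦ hw (σ i)) hind hb hv hvb hN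
  exact tendsto_div_of_bounded_excess hR
    (ofReal_mul_le_minLength (fun x p hp ↦ hΨl x p ▸ hlower x p hp) v) hupper

theorem mainTheorem3 {m : ℕ} (hm : 3 ≤ m) {M : Type u} [TopologicalSpace M] [T2Space M]
    [CompactSpace M] [ConnectedSpace M] [ChartedSpace (EuclideanSpace ℝ (Fin m)) M]
    [IsManifold (𝓡 m) ∞ M] (g : SmoothMetric m M)
    (hb : 1 ≤ Module.finrank ℝ (realH1 M))
    (K : Set (realH1 M)) (hK : ∃ S : Set (realH1 M), S.Finite ∧ K = convexHull ℝ S)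
    (hsymm : -K = K) (hint : (interior K).Nonempty)
    (hrat : ∀ s ∈ K.extremePoints ℝ, HasRationalDirection s) :
    ∃ g' : SmoothMetric m M, IsConformalTo g g' ∧
      ∃ N : Seminorm ℝ (realH1 M), IsStableNorm g' N ∧ {u | N u ≤ 1} = K :=
  mainTheorem3_general hm g K hK hsymm hint hrat
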